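/- Consider tame links in $\mathbb{R}^3$, i.e. subsets of $\mathbb{R}^3$ that are ambient isotopic to a finite disjoint union of simple closed polygons. A link $K$ is *split* if it is ambient isotopic to a link that misses some plane and has components on both sides of that plane. A traditional tile and a corner connection tile are squares with four possible connection points, which are the midpoints of the four sides for traditional tiles and the four corners for corner connection tiles. Each of the two tile sets consists of the same eleven ways of drawing curves between these points: the blank tile; the four tiles with one arc joining two neighbouring connection points; the two tiles with one straight line joining two opposite connection points; the two tiles with two disjoint arcs, each joining two neighbouring connection points; and the two crossings of the two straight lines. A mosaic is an $n\times n$ array ($n$ arbitrary) of tiles of one of the two sets in which every connection point that is an endpoint of a curve on its tile touches an endpoint of a curve on exactly one other tile. It represents $K$ if the link drawn by it, with the overpassing strand of each crossing lifted above the underpassing one, is ambient isotopic to $K$. Let $t(K)$ and $t_c(K)$ be the smallest numbers of non-blank tiles in a mosaic representing $K$ that consists of traditional tiles and of corner connection tiles, respectively. **Theorem.** For every split link $K$, both $t_c(K)$ and $t(K)$ are finite (that is, $K$ is represented by mosaics of both kinds), and $$t_c(K) < t(K).$$ -/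

import Mathlib

namespace KnotMosaic

/-! ### Links in Euclidean three-space -/

/-- Euclidean three-space. -/
abbrev Space : Type := EuclideanSpace ℝ (Fin 3)

/-- `A` can be carried to `B` by an ambient isotopy of three-space: a jointly continuous family
of homeomorphisms `H t`, `t ∈ [0, 1]`, with `H 0 = id` and `H 1 (A) = B`. -/
def AmbientIsotopic (A B : Set Space) : Prop :=
  ∃ H : unitInterval → (Space ≃ₜ Space),
    Continuous (fun p : unitInterval × Space => H p.1 p.2) ∧
    (∀ x, H 0 x = x) ∧ H 1 '' A = B

/-- The `i`-th edge of the closed polygon with the cyclically ordered vertices `v`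
(the addition `i + 1` is modulo the number of vertices). -/
def edge {n : ℕ} (v : Fin (n + 3) → Space) (i : Fin (n + 3)) : Set Space :=
  segment ℝ (v i) (v (i + 1))

/-- The closed polygon with the cyclically ordered vertices `v`, as a subset of space. -/
def polygon {n : ℕ} (v : Fin (n + 3) → Space) : Set Space := ⋃ i, edge v i

/-- The closed polygon with vertices `v` is simple, i.e. a polygonal knot: the vertices are
distinct, consecutive edges meet only in their common vertex, and edges that are not consecutive
are disjoint. -/
structure IsSimplePolygon {n : ℕ} (v : Fin (n + 3) → Space) : Prop where
  injective : Function.Injective v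
  consecutive : ∀ i, edge v i ∩ edge v (i + 1) = {v (i + 1)}
  nonconsecutive : ∀ i j, j ≠ i → j ≠ i + 1 → i ≠ j + 1 → Disjoint (edge v i) (edge v j)

/-- A polygonal link: the union of finitely many (at least one) pairwise disjoint polygonal
knots. -/
def IsPolygonalLink (L : Set Space) : Prop :=
  ∃ (m : ℕ) (n : Fin m → ℕ) (v : ∀ c : Fin m, Fin (n c + 3) → Space),
    0 < m ∧ (∀ c, IsSimplePolygon (v c)) ∧
    (∀ c d, c ≠ d → Disjoint (polygon (v c)) (polygon (v d))) ∧
    L = ⋃ c, polygon (v c)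

/-- A tame link: a subset of space that is ambient isotopic to a polygonal link. -/
def IsTameLink (K : Set Space) : Prop :=
  ∃ L, IsPolygonalLink L ∧ AmbientIsotopic L K

/-- `K` is split: it can be deformed so that it misses some plane `⟪w, x⟫ = c` and has points
(hence, for a link, whole components) on each of the two sides of that plane. -/
def IsSplit (K : Set Space) : Prop :=
  ∃ K' : Set Space, AmbientIsotopic K K' ∧
    ∃ (w : Space) (c : ℝ), w ≠ 0 ∧ (∀ x ∈ K', inner ℝ w x ≠ c) ∧
      (∃ x ∈ K', inner ℝ w x < c) ∧ (∃ x ∈ K', c < inner ℝ w x)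

/-! ### Tiles

A tile is a square with four possible connection points, numbered counterclockwise by `Fin 4`
(so `+ 1` and `+ 2` are cyclic). In the traditional tile set they are the midpoints of the sides,
in the corner connection tile set they are the corners. The curves drawn on the eleven tiles of
the two sets connect these points in the same eleven ways. -/

/-- A curve drawn on a tile: `arc i` joins the neighbouring connection points `i` and `i + 1`;
`low i` and `high i` run through the centre of the tile and join the opposite connection points
`i` and `i + 2`, `high i` being the overpassing strand of a crossing. -/
inductive Strand : Type
  | arc (i : Fin 4)
  | low (i : Fin 4)
  | high (i : Fin 4)

/-- The first end of a strand. -/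
def Strand.first : Strand → Fin 4
  | .arc i => i
  | .low i => i
  | .high i => i

/-- The other end of a strand. -/
def Strand.last : Strand → Fin 4
  | .arc i => i + 1
  | .low i => i + 2
  | .high i => i + 2

/-- The eleven tiles of either tile set: `T0` is blank, `T1`–`T4` carry one arc, `T5` and `T6` one
straight line, `T7` and `T8` two arcs, and `T9` and `T10` a crossing. -/
inductive Tile : Type
  | T0 | T1 | T2 | T3 | T4 | T5 | T6 | T7 | T8 | T9 | T10
  deriving DecidableEq

/-- The strands drawn on each tile. -/
def Tile.strands : Tile → List Strand
  | .T0 => []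
  | .T1 => [.arc 2]
  | .T2 => [.arc 3]
  | .T3 => [.arc 0]
  | .T4 => [.arc 1]
  | .T5 => [.low 0]
  | .T6 => [.low 1]
  | .T7 => [.arc 2, .arc 0]
  | .T8 => [.arc 3, .arc 1]
  | .T9 => [.low 0, .high 1]
  | .T10 => [.high 0, .low 1]

/-- `k` is a connection point of the tile: an endpoint of a curve drawn on it. -/
def Tile.IsConnection (T : Tile) (k : Fin 4) : Prop :=
  ∃ s ∈ T.strands, k = s.first ∨ k = s.last

/-- Traditional tiles, on the square `[-1, 1] × [-1, 1]`: the connection points are the midpoints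
of the sides (right, top, left, bottom). -/
noncomputable def sidePoint : Fin 4 → ℝ × ℝ :=
  ![(1, 0), (0, 1), (-1, 0), (0, -1)]

/-- Corner connection tiles, on the square `[-1, 1] × [-1, 1]`: the connection points are the
corners (top right, top left, bottom left, bottom right). -/
noncomputable def cornerPoint : Fin 4 → ℝ × ℝ :=
  ![(1, 1), (-1, 1), (-1, -1), (1, -1)]

/-- The planar position of the middle point of a strand on the square `[-1, 1] × [-1, 1]`, where
the connection points are placed by `P`: the centre for the strands through the centre, and a
point halfway between the centre and the midpoint of the two ends for an arc. -/
noncomputable def Strand.mid (P : Fin 4 → ℝ × ℝ) : Strand → ℝ × ℝ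
  | .arc i => (1 / 4 : ℝ) • (P i + P (i + 1))
  | .low _ => 0
  | .high _ => 0

/-- The height of the middle point of a strand; only the overpassing strand of a crossing is
lifted. -/
noncomputable def Strand.height : Strand → ℝ
  | .arc _ => 0
  | .low _ => 0
  | .high _ => 1

/-! ### Mosaics -/

/-- An `n × n` array of tiles. -/
abbrev TileArray (n : ℕ) : Type := Fin n → Fin n → Tile

/-- The point of space with local planar coordinates `p` on the tile in row `i` and column `j`,
at height `z`. The tiles are squares of side `2`; rows are numbered downwards and columns from
left to right. -/
noncomputable def place {n : ℕ} (i j : Fin n) (p : ℝ × ℝ) (z : ℝ) : Space :=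
  !₂[2 * ((j : ℕ) : ℝ) + p.1, -2 * ((i : ℕ) : ℝ) + p.2, z]

/-- A strand on the tile in row `i` and column `j`, as a curve in space. -/
noncomputable def Strand.curve (P : Fin 4 → ℝ × ℝ) {n : ℕ} (i j : Fin n) (s : Strand) :
    Set Space :=
  segment ℝ (place i j (P s.first) 0) (place i j (s.mid P) s.height) ∪
    segment ℝ (place i j (s.mid P) s.height) (place i j (P s.last) 0)

/-- The subset of space drawn by an array of tiles with connection points placed by `P`. -/
noncomputable def drawing (P : Fin 4 → ℝ × ℝ) {n : ℕ} (M : TileArray n) : Set Space :=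
  ⋃ (i : Fin n) (j : Fin n), ⋃ s ∈ (M i j).strands, s.curve P i j

/-- Every tile is suitably connected: each of its connection points touches a connection point of
exactly one other tile (for traditional tiles, at most one other tile is there to be touched). -/
def SuitablyConnected (P : Fin 4 → ℝ × ℝ) {n : ℕ} (M : TileArray n) : Prop :=
  ∀ (i j : Fin n) (k : Fin 4), (M i j).IsConnection k →
    ∃! b : Fin n × Fin n, b ≠ (i, j) ∧
      ∃ l : Fin 4, (M b.1 b.2).IsConnection l ∧ place b.1 b.2 (P l) 0 = place i j (P k) 0

/-- The number of tiles used by an array of tiles, i.e. the number of its non-blank tiles. -/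
def tileCount {n : ℕ} (M : TileArray n) : ℕ :=
  (Finset.univ.filter fun b : Fin n × Fin n => M b.1 b.2 ≠ Tile.T0).card

/-- The smallest number of non-blank tiles in a mosaic, of any size, that represents the link `K`,
for tiles with connection points placed by `P`; it is `⊤` if no mosaic represents `K`. -/
noncomputable def tileNumberWith (P : Fin 4 → ℝ × ℝ) (K : Set Space) : ℕ∞ :=
  sInf {t : ℕ∞ | ∃ (n : ℕ) (M : TileArray n),
    SuitablyConnected P M ∧ AmbientIsotopic (drawing P M) K ∧ t = (tileCount M : ℕ∞)}

/-- The (traditional) tile number `t(K)`. -/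
noncomputable def tileNumber (K : Set Space) : ℕ∞ := tileNumberWith sidePoint K

/-- The corner connection tile number `t_c(K)`. -/
noncomputable def cornerTileNumber (K : Set Space) : ℕ∞ := tileNumberWith cornerPoint K

end KnotMosaic

namespace KnotMosaic

open Set Topology Filter NNReal

/-! ### Ambient isotopy -/

/-! The saving comes from the top of a traditional mosaic. Turning the plane by 45 degrees and
scaling by √2 carries traditional tiles to corner connection tiles, so a traditional mosaic is at
once a corner connection mosaic with equally many non-blank tiles. The turned tiles occupy the
squares of one colour of a chessboard; the squares of the other colour, centred at the corners of
the old tiles, are free.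

In the uppermost non-blank row the leftmost non-blank tile can only be `T2`; to its right follow
some tiles `T5` and a closing `T1` (`SuitablyConnected.exists_topRun`). Nothing lies above this cap,
so it can be pushed down onto the line through the lower sides of its tiles, where it becomes a
straight segment joining the two lower connection points. After the turn this segment consists of
diagonals of free squares, one fewer than the cap had tiles (`IsTopRun.tileCount_lt`), and the
result is still suitably connected (`IsTopRun.suitablyConnected`). The push is an isotopy since the
cap is the graph of a Lipschitz function over that line while the rest of the link stays below its
mirror image (`IsTopRun.restOfDrawing_below`, `ambientIsotopic_flatten`). Applied to a traditional
mosaic with the least number of tiles, this gives the strict inequality. Splitness enters only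
through the existence of a point of the link, which rules out the blank mosaic.

Finiteness, and with it the existence of a minimal traditional mosaic, requires that tame links have
mosaics (`IsTameLink.exists_mosaic`). The vertices of a polygonal link are put into general
position, and each edge is replaced by a fine staircase that is monotone in both planar coordinates.
At each vertex the side of the staircases is chosen such that the incoming and the outgoing one do
not collide (`exists_side`). The result projects to a grid diagram
(`IsPolygonalLink.exists_gridCycle`). Rows and columns of the diagram are numbered in their order,
and a linear motion of vertices carries the diagram to the drawing of a mosaic
(`GridChart.pos_injective`).

All these isotopies come from one principle, `ambientIsotopic_of_gauge`: if the maps `S + t • u` are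
bounded below, for each `t`, by a multiple of a gauge for which `u` is Lipschitz, then their images
are ambient isotopic. For small time steps the displacement has a small Lipschitz constant, extends
to all of space by Lipschitz extension, and gives a homeomorphism as a small perturbation of the
identity. -/

theorem AmbientIsotopic.refl (A : Set Space) : AmbientIsotopic A A :=
  ⟨fun _ => Homeomorph.refl _, by simpa using continuous_snd, fun _ => rfl, by simp⟩

theorem AmbientIsotopic.symm {A B : Set Space} (h : AmbientIsotopic A B) :
    AmbientIsotopic B A := by
  obtain ⟨H, hc, h0, h1⟩ := h
  -- Time runs backwards after the fixed map `(H 1).symm`, so joint continuity is inherited from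
  -- `H`; for the family of all inverses `(H t).symm` it would need an argument.
  refine ⟨fun t => (H 1).symm.trans (H (unitInterval.symm t)), ?_, fun x => ?_, ?_⟩
  · exact hc.comp ((unitInterval.continuous_symm.comp continuous_fst).prodMk
      ((H 1).symm.continuous.comp continuous_snd))
  · simp
  · rw [← h1, ← image_comp]
    have : (⇑((H 1).symm.trans (H (unitInterval.symm 1))) ∘ ⇑(H 1)) = id := by
      funext x
      simp [h0]
    rw [this, image_id]

theorem AmbientIsotopic.trans {A B C : Set Space} (h : AmbientIsotopic A B)
    (h' : AmbientIsotopic B C) : AmbientIsotopic A C := by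
  obtain ⟨H, hc, h0, h1⟩ := h
  obtain ⟨G, gc, g0, g1⟩ := h'
  refine ⟨fun t => (H t).trans (G t), ?_, fun x => by simp [h0, g0], ?_⟩
  · exact gc.comp (continuous_fst.prodMk hc)
  · rw [← g1, ← h1, ← image_comp]
    rfl

/-- A perturbation of the identity by a map with Lipschitz constant less than one is a
homeomorphism. -/
theorem exists_homeomorph_add {g : Space → Space} {K : ℝ≥0} (hg : LipschitzWith K g)
    (hK : K < 1) : ∃ h : Space ≃ₜ Space, ∀ x, h x = x + g x := by
  have happ : ApproximatesLinearOn (fun x => x + g x)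
      ((ContinuousLinearEquiv.refl ℝ Space : Space ≃L[ℝ] Space) : Space →L[ℝ] Space)
      univ K := by
    intro x _ y _
    have := hg.dist_le_mul x y
    rw [dist_eq_norm, dist_eq_norm] at this
    have e : x + g x - (y + g y) - (x - y) = g x - g y := by abel
    simpa [e] using this
  have hc : Subsingleton Space ∨
      K < ‖((ContinuousLinearEquiv.refl ℝ Space).symm : Space →L[ℝ] Space)‖₊⁻¹ := by
    right
    refine lt_of_lt_of_le hK ?_
    have h1 : ‖((ContinuousLinearEquiv.refl ℝ Space).symm : Space →L[ℝ] Space)‖₊ ≤ 1 :=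
      ContinuousLinearMap.norm_id_le
    have h2 : (0 : ℝ≥0) < ‖((ContinuousLinearEquiv.refl ℝ Space).symm : Space →L[ℝ] Space)‖₊ := by
      have : ‖ContinuousLinearMap.id ℝ Space‖ = 1 := ContinuousLinearMap.norm_id
      rw [← NNReal.coe_pos]
      change 0 < ‖ContinuousLinearMap.id ℝ Space‖
      rw [this]; exact one_pos
    exact (one_le_inv₀ h2).2 h1
  exact ⟨ApproximatesLinearOn.toHomeomorph _ happ hc, fun x => rfl⟩

/-- A displacement of a subset of space that is Lipschitz with small constant extends to an
ambient isotopy. -/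
theorem ambientIsotopic_of_lipschitz {X : Type*} (S u : X → Space) (K : ℝ≥0)
    (hK : lipschitzExtensionConstant Space * K < 1)
    (h : ∀ a b, dist (u a) (u b) ≤ K * dist (S a) (S b)) :
    AmbientIsotopic (range S) (range fun a => S a + u a) := by
  classical
  rcases isEmpty_or_nonempty X with hX | hX
  · simp only [range_eq_empty]
    exact AmbientIsotopic.refl _
  -- The Lipschitz hypothesis forces `u` to factor through `S`, so the choice of preimages made here
  -- is harmless.
  set f : Space → Space := fun y => u (Function.invFun S y) with hf
  have hfS : ∀ a, f (S a) = u a := fun a => by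
    have h1 : S (Function.invFun S (S a)) = S a := Function.invFun_eq ⟨a, rfl⟩
    have h2 := h (Function.invFun S (S a)) a
    rw [h1, dist_self, mul_zero] at h2
    exact dist_le_zero.1 h2
  have hL : LipschitzOnWith K f (range S) := by
    refine LipschitzOnWith.of_dist_le_mul ?_
    rintro _ ⟨a, rfl⟩ _ ⟨b, rfl⟩
    rw [hfS, hfS]
    exact h a b
  -- Extension to all of space costs only the factor `lipschitzExtensionConstant Space`, for which
  -- `hK` leaves room.
  obtain ⟨g, hg, hgf⟩ := hL.extend_finite_dimension
  have hgt : ∀ t : unitInterval, LipschitzWith (lipschitzExtensionConstant Space * K)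
      (fun x => (t : ℝ) • g x) := fun t => by
    refine LipschitzWith.of_dist_le_mul fun x y => ?_
    rw [dist_smul₀]
    have h1 := hg.dist_le_mul x y
    have h2 : ‖(t : ℝ)‖ ≤ 1 := by
      rw [Real.norm_of_nonneg t.2.1]; exact t.2.2
    calc ‖(t : ℝ)‖ * dist (g x) (g y) ≤ 1 * dist (g x) (g y) := by gcongr
      _ ≤ _ := by rw [one_mul]; exact h1
  choose H hH using fun t => exists_homeomorph_add (hgt t) hK
  refine ⟨H, ?_, fun x => by simp [hH], ?_⟩
  · simp only [hH]
    have := hg.continuous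
    fun_prop
  · rw [← range_comp]
    congr 1
    funext a
    have : g (S a) = u a := by rw [← hgf (mem_range_self a), hfS]
    simp [hH, this]

/-- A family of maps `S + t • u`, `t ∈ [0, 1]`, that are expanding up to constants with respect
to some gauge `ρ`, while `u` is Lipschitz with respect to it, extends to an ambient isotopy. -/
theorem ambientIsotopic_of_gauge {X : Type*} (ρ : X → X → ℝ) (S u : X → Space) (C : ℝ)
    (hρ : ∀ a b, 0 ≤ ρ a b)
    (hu : ∀ a b, dist (u a) (u b) ≤ C * ρ a b)
    (hS : ∀ t ∈ Icc (0 : ℝ) 1, ∃ c > 0, ∀ a b,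
      c * ρ a b ≤ dist (S a + t • u a) (S b + t • u b)) :
    AmbientIsotopic (range S) (range fun a => S a + u a) := by
  have key : AmbientIsotopic (range fun a => S a + (0 : ℝ) • u a)
      (range fun a => S a + (1 : ℝ) • u a) := by
    -- The constant `c` may depend on `t` in an arbitrary way. Being isotopic is an equivalence
    -- relation, so by connectedness of the interval a comparison with nearby times suffices.
    have hconn : IsPreconnected (Icc (0 : ℝ) 1) := isPreconnected_Icc
    refine hconn.induction₂' (fun t r => AmbientIsotopic (range fun a => S a + t • u a)
      (range fun a => S a + r • u a)) (fun t ht => ?_)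
      (fun _ _ _ _ _ _ h h' => h.trans h') (by simp) (by simp)
    suffices ∀ᶠ r in 𝓝[Icc (0 : ℝ) 1] t, AmbientIsotopic (range fun a => S a + t • u a)
        (range fun a => S a + r • u a) from this.mono fun r hr => ⟨hr, hr.symm⟩
    obtain ⟨c, hc, hcS⟩ := hS t ht
    set L : ℝ≥0 := lipschitzExtensionConstant Space
    have hLpos : 0 < L := lipschitzExtensionConstant_pos Space
    -- steps of length less than `δ` are harmless
    set δ : ℝ := c / ((L + 1) * (|C| + 1)) with hδ
    have hδpos : 0 < δ := by positivity
    refine Filter.Eventually.filter_mono nhdsWithin_le_nhds ?_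
    filter_upwards [Metric.ball_mem_nhds t hδpos] with r hr
    rw [Metric.mem_ball, Real.dist_eq] at hr
    have hbound : ∀ a b, dist ((r - t) • u a) ((r - t) • u b) ≤
        (1 / (L + 1) : ℝ≥0) * dist (S a + t • u a) (S b + t • u b) := fun a b => by
      rw [dist_smul₀, Real.norm_eq_abs]
      have h2 := hcS a b
      have h3 : dist (u a) (u b) ≤ (|C| + 1) * ρ a b :=
        (hu a b).trans (mul_le_mul_of_nonneg_right (by linarith [le_abs_self C]) (hρ a b))
      have e : ((1 / (L + 1) : ℝ≥0) : ℝ) = 1 / (L + 1) := by push_cast; rfl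
      rw [e]
      calc |r - t| * dist (u a) (u b) ≤ δ * ((|C| + 1) * ρ a b) := by gcongr
        _ = 1 / (L + 1) * (c * ρ a b) := by rw [hδ]; field_simp
        _ ≤ _ := by gcongr
    have hK : L * (1 / (L + 1)) < 1 := by
      rw [mul_one_div]
      exact (div_lt_one (by positivity)).2 (by simp)
    have := ambientIsotopic_of_lipschitz (fun a => S a + t • u a) (fun a => (r - t) • u a) _ hK hbound
    convert this using 3
    rw [sub_smul]; abel_nf
  simpa using key

/-! ### Linear maps on cones and on finite complexes of segments -/

theorem exists_pos_forall_le {ι : Type*} [Finite ι] (f : ι → ℝ) (hf : ∀ i, 0 < f i) :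
    ∃ c > 0, ∀ i, c ≤ f i := by
  rcases isEmpty_or_nonempty ι with h | h
  · exact ⟨1, one_pos, fun i => h.elim i⟩
  · obtain ⟨i, hi⟩ := Finite.exists_min f
    exact ⟨f i, hf i, hi⟩

/-- A positively homogeneous continuous function that is positive on a closed cone away from the
origin is bounded below by a multiple of the norm. -/
theorem exists_mul_norm_le_of_cone {E : Type*} [NormedAddCommGroup E] [NormedSpace ℝ E]
    [FiniteDimensional ℝ E] {C : Set E} (hC : IsClosed C)
    (hsmul : ∀ r : ℝ, 0 ≤ r → ∀ x ∈ C, r • x ∈ C) {f : E → ℝ} (hf : Continuous f)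
    (hhom : ∀ r : ℝ, 0 ≤ r → ∀ x, f (r • x) = r * f x) (hpos : ∀ x ∈ C, x ≠ 0 → 0 < f x) :
    ∃ c > 0, ∀ x ∈ C, c * ‖x‖ ≤ f x := by
  have hcomp : IsCompact (Metric.sphere (0 : E) 1 ∩ C) := (isCompact_sphere 0 1).inter_right hC
  have hf0 : f 0 = 0 := by simpa using hhom 0 le_rfl 0
  rcases (Metric.sphere (0 : E) 1 ∩ C).eq_empty_or_nonempty with he | hne
  · refine ⟨1, one_pos, fun x hx => ?_⟩
    by_cases hx0 : x = 0
    · simp [hx0, hf0]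
    · exfalso
      have hn : 0 < ‖x‖ := norm_pos_iff.2 hx0
      have : ‖x‖⁻¹ • x ∈ Metric.sphere (0 : E) 1 ∩ C :=
        ⟨by simp [norm_smul, hn.ne'], hsmul _ (by positivity) x hx⟩
      rw [he] at this
      exact this
  · obtain ⟨y, hy, hmin⟩ := hcomp.exists_isMinOn hne hf.continuousOn
    have hy0 : y ≠ 0 := by
      rintro rfl
      simpa using hy.1
    refine ⟨f y, hpos y hy.2 hy0, fun x hx => ?_⟩
    by_cases hx0 : x = 0
    · simp [hx0, hf0]
    · have hn : 0 < ‖x‖ := norm_pos_iff.2 hx0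
      have hmem : ‖x‖⁻¹ • x ∈ Metric.sphere (0 : E) 1 ∩ C :=
        ⟨by simp [norm_smul, hn.ne'], hsmul _ (by positivity) x hx⟩
      have h1 : f y ≤ f (‖x‖⁻¹ • x) := hmin hmem
      rw [hhom _ (by positivity)] at h1
      calc f y * ‖x‖ ≤ (‖x‖⁻¹ * f x) * ‖x‖ := by gcongr
        _ = f x := by field_simp

section Complex

set_option linter.unusedSectionVars false

variable {V : Type*} [Fintype V] [DecidableEq V]

/-- The vertex `v` of the standard simplex on `V`. -/
def vert (v : V) : V → ℝ := Pi.single v 1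

/-- The linear map that sends the vertex `v` of the standard simplex to `p v`. -/
noncomputable def realize (p : V → Space) : (V → ℝ) →ₗ[ℝ] Space := Fintype.linearCombination ℝ p

theorem realize_vert (p : V → Space) (v : V) : realize p (vert v) = p v := by
  simp [realize, vert, Fintype.linearCombination_apply_single]

theorem realize_lineMap (p : V → Space) (a b : V) (s : ℝ) :
    realize p (AffineMap.lineMap (vert a) (vert b) s) = AffineMap.lineMap (p a) (p b) s := by
  simp [AffineMap.lineMap_apply_module', realize_vert]

theorem vert_apply_self (v : V) : vert v v = 1 := by simp [vert]

theorem vert_apply_ne {v w : V} (h : w ≠ v) : vert v w = 0 := by simp [vert, h]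

theorem realize_image_segment (p : V → Space) (a b : V) :
    realize p '' segment ℝ (vert a) (vert b) = segment ℝ (p a) (p b) := by
  simp only [segment_eq_image_lineMap, ← image_comp]
  refine image_congr fun s _ => ?_
  exact realize_lineMap p a b s

theorem continuous_realize (p : V → Space) : Continuous (realize p) :=
  LinearMap.continuous_of_finiteDimensional _

/-- Near the shared vertex the distance has no positive minimum, but it is homogeneous: the
difference of the two image points is linear in the pair of parameters, which ranges over a
quadrant. Injectivity excludes zeros there, and the cone lemma gives the constant. If the two edges
agree, the map is affine on a single segment. -/
theorem exists_mul_norm_sub_le_common (p : V → Space) {a b b' : V} (hab : a ≠ b) (hab' : a ≠ b')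
    (hself : p a ≠ p b)
    (hinj : ∀ x ∈ segment ℝ (vert a) (vert b), ∀ y ∈ segment ℝ (vert a) (vert b'),
      realize p x = realize p y → x = y) :
    ∃ c > 0, ∀ x ∈ segment ℝ (vert a) (vert b), ∀ y ∈ segment ℝ (vert a) (vert b'),
      c * ‖x - y‖ ≤ ‖realize p x - realize p y‖ := by
  by_cases hbb : b = b'
  · subst hbb
    have h0 : 0 < ‖p b - p a‖ := norm_pos_iff.2 (sub_ne_zero.2 hself.symm)
    have hv : 0 < ‖(vert b - vert a : V → ℝ)‖ := by
      refine norm_pos_iff.2 (sub_ne_zero.2 fun h => ?_)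
      have := congrFun h b
      rw [vert_apply_self, vert_apply_ne hab.symm] at this
      exact one_ne_zero this
    refine ⟨‖p b - p a‖ / ‖(vert b - vert a : V → ℝ)‖, by positivity, ?_⟩
    rw [segment_eq_image_lineMap]
    rintro _ ⟨s, -, rfl⟩ _ ⟨s', -, rfl⟩
    have e : (AffineMap.lineMap (vert a) (vert b) s - AffineMap.lineMap (vert a) (vert b) s' :
        V → ℝ) = (s - s') • (vert b - vert a) := by
      simp only [AffineMap.lineMap_apply_module']; module
    rw [← map_sub (realize p), e, map_smul, map_sub, realize_vert, realize_vert, norm_smul, norm_smul]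
    apply le_of_eq
    field_simp
  · obtain ⟨c, hc, hcone⟩ := exists_mul_norm_le_of_cone (E := ℝ × ℝ)
      (C := {z | 0 ≤ z.1 ∧ 0 ≤ z.2})
      (f := fun z => ‖z.1 • (p b - p a) - z.2 • (p b' - p a)‖)
      ((isClosed_le continuous_const continuous_fst).inter
        (isClosed_le continuous_const continuous_snd))
      (fun r hr x hx => ⟨mul_nonneg hr hx.1, mul_nonneg hr hx.2⟩) (by fun_prop)
      (fun r hr x => by
        rw [Prod.smul_fst, Prod.smul_snd, smul_assoc, smul_assoc, ← smul_sub, norm_smul,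
          Real.norm_of_nonneg hr])
      (fun z hz hz0 => by
        refine norm_pos_iff.2 fun h => hz0 ?_
        obtain ⟨h1, h2⟩ := hz
        by_contra hne
        have hs : 0 < z.1 + z.2 := by
          rcases h1.eq_or_lt with h1' | h1'
          · rcases h2.eq_or_lt with h2' | h2'
            · exact absurd (Prod.ext h1'.symm h2'.symm) hne
            · linarith
          · linarith
        -- Division by `z.1 + z.2` brings both parameters into the unit interval, so a zero in the
        -- quadrant becomes a coincidence of points of the two edges.
        have hx := hinj (AffineMap.lineMap (vert a) (vert b) (z.1 / (z.1 + z.2)))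
          (by rw [segment_eq_image_lineMap]
              exact ⟨_, ⟨by positivity, (div_le_one hs).2 (by linarith)⟩, rfl⟩)
          (AffineMap.lineMap (vert a) (vert b') (z.2 / (z.1 + z.2)))
          (by rw [segment_eq_image_lineMap]
              exact ⟨_, ⟨by positivity, (div_le_one hs).2 (by linarith)⟩, rfl⟩)
          (by
            rw [realize_lineMap, realize_lineMap, AffineMap.lineMap_apply_module',
              AffineMap.lineMap_apply_module', div_eq_inv_mul, div_eq_inv_mul, mul_smul,
              mul_smul, sub_eq_zero.1 h])
        have hb := congrFun hx b
        have hb' := congrFun hx b'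
        simp only [AffineMap.lineMap_apply_module', Pi.add_apply, Pi.smul_apply, Pi.sub_apply,
          vert_apply_self, vert_apply_ne hab.symm, vert_apply_ne hab'.symm, vert_apply_ne hbb,
          vert_apply_ne (Ne.symm hbb), smul_eq_mul, sub_zero, mul_one, mul_zero, add_zero,
          div_eq_zero_iff, hs.ne', or_false] at hb hb'
        have hb2 := hb'.symm
        rw [div_eq_zero_iff] at hb2
        rcases hb2 with hb2 | hb2 <;> linarith)
    set M : ℝ := ‖(vert b - vert a : V → ℝ)‖ + ‖(vert b' - vert a : V → ℝ)‖ + 1 with hM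
    have hMpos : 0 < M := by positivity
    refine ⟨c / M, by positivity, ?_⟩
    rw [segment_eq_image_lineMap, segment_eq_image_lineMap]
    rintro _ ⟨s, hs, rfl⟩ _ ⟨s', hs', rfl⟩
    have h1 := hcone (s, s') ⟨hs.1, hs'.1⟩
    have e : (AffineMap.lineMap (vert a) (vert b) s - AffineMap.lineMap (vert a) (vert b') s' :
        V → ℝ) = s • (vert b - vert a) - s' • (vert b' - vert a) := by
      simp only [AffineMap.lineMap_apply_module']; module
    rw [← map_sub (realize p), e, map_sub, map_smul, map_smul, map_sub, map_sub, realize_vert, realize_vert,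
      realize_vert]
    have hsn : s ≤ ‖(s, s')‖ := (le_abs_self s).trans (norm_fst_le (s, s'))
    have hsn' : s' ≤ ‖(s, s')‖ := (le_abs_self s').trans (norm_snd_le (s, s'))
    have h2 : ‖(s • (vert b - vert a) - s' • (vert b' - vert a) : V → ℝ)‖ ≤ ‖(s, s')‖ * M := by
      refine (norm_sub_le _ _).trans ?_
      rw [norm_smul, norm_smul, Real.norm_of_nonneg hs.1, Real.norm_of_nonneg hs'.1, hM]
      have := norm_nonneg (vert b - vert a : V → ℝ)
      have := norm_nonneg (vert b' - vert a : V → ℝ)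
      have := norm_nonneg (s, s')
      nlinarith
    calc c / M * ‖(s • (vert b - vert a) - s' • (vert b' - vert a) : V → ℝ)‖
        ≤ c / M * (‖(s, s')‖ * M) := by gcongr
      _ = c * ‖(s, s')‖ := by field_simp
      _ ≤ _ := h1

theorem norm_le_one_of_mem_segment {a b : V} {x : V → ℝ}
    (hx : x ∈ segment ℝ (vert a) (vert b)) : ‖x‖ ≤ 1 := by
  have hv : ∀ v : V, vert v ∈ Metric.closedBall (0 : V → ℝ) 1 := fun v => by
    rw [mem_closedBall_zero_iff, pi_norm_le_iff_of_nonneg zero_le_one]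
    intro w
    by_cases h : w = v
    · rw [h, vert_apply_self, norm_one]
    · rw [vert_apply_ne h, norm_zero]; exact zero_le_one
  exact mem_closedBall_zero_iff.1
    ((convex_closedBall (0 : V → ℝ) 1).segment_subset (hv a) (hv b) hx)

theorem isCompact_segment (x y : V → ℝ) : IsCompact (segment ℝ x y) := by
  rw [segment_eq_image_lineMap]
  exact isCompact_Icc.image AffineMap.lineMap_continuous

/-- Without a common vertex, injectivity and compactness keep the image segments at a positive
distance. -/
theorem exists_mul_norm_sub_le_disjoint (p : V → Space) {a b a' b' : V} (hab : a ≠ b)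
    (h1 : a ≠ a') (h2 : a ≠ b') (h3 : b ≠ a') (h4 : b ≠ b')
    (hinj : ∀ x ∈ segment ℝ (vert a) (vert b), ∀ y ∈ segment ℝ (vert a') (vert b'),
      realize p x = realize p y → x = y) :
    ∃ c > 0, ∀ x ∈ segment ℝ (vert a) (vert b), ∀ y ∈ segment ℝ (vert a') (vert b'),
      c * ‖x - y‖ ≤ ‖realize p x - realize p y‖ := by
  have hcont : Continuous fun z : (V → ℝ) × (V → ℝ) => ‖realize p z.1 - realize p z.2‖ :=
    (((continuous_realize p).comp continuous_fst).sub
      ((continuous_realize p).comp continuous_snd)).norm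
  obtain ⟨z, hz, hmin⟩ := ((isCompact_segment (vert a) (vert b)).prod
    (isCompact_segment (vert a') (vert b'))).exists_isMinOn
    ⟨(vert a, vert a'), left_mem_segment _ _ _, left_mem_segment _ _ _⟩ hcont.continuousOn
  have hzpos : 0 < ‖realize p z.1 - realize p z.2‖ := by
    refine norm_pos_iff.2 (sub_ne_zero.2 fun h => ?_)
    have hxy := hinj _ hz.1 _ hz.2 h
    obtain ⟨h5, h6⟩ := hz
    rw [segment_eq_image_lineMap] at h5 h6
    obtain ⟨s, hs, hs1⟩ := h5
    obtain ⟨s', hs', hs1'⟩ := h6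
    rw [← hs1, ← hs1'] at hxy
    have ha := congrFun hxy a
    have hb := congrFun hxy b
    simp only [AffineMap.lineMap_apply_module', Pi.add_apply, Pi.smul_apply, Pi.sub_apply,
      vert_apply_self, vert_apply_ne hab, vert_apply_ne hab.symm, vert_apply_ne h1,
      vert_apply_ne h2, vert_apply_ne h3, vert_apply_ne h4, smul_eq_mul] at ha hb
    linarith
  -- The factor 2 bounds the distance of two points of the simplex in the sup norm.
  refine ⟨‖realize p z.1 - realize p z.2‖ / 2, by positivity, fun x hx y hy => ?_⟩
  have hm : ‖realize p z.1 - realize p z.2‖ ≤ ‖realize p x - realize p y‖ :=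
    hmin (a := (x, y)) ⟨hx, hy⟩
  have : ‖x - y‖ ≤ 2 := (norm_sub_le _ _).trans
    (by linarith [norm_le_one_of_mem_segment hx, norm_le_one_of_mem_segment hy])
  calc _ ≤ ‖realize p z.1 - realize p z.2‖ / 2 * 2 := by gcongr
    _ = ‖realize p z.1 - realize p z.2‖ := by ring
    _ ≤ _ := hm

/-- If `realize p` separates the points of two edges of the standard simplex, it does so in a
bi-Lipschitz way. -/
theorem exists_mul_norm_sub_le_edges (p : V → Space) {a b a' b' : V} (hab : a ≠ b) (hab' : a' ≠ b')
    (hself : p a ≠ p b)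
    (hinj : ∀ x ∈ segment ℝ (vert a) (vert b), ∀ y ∈ segment ℝ (vert a') (vert b'),
      realize p x = realize p y → x = y) :
    ∃ c > 0, ∀ x ∈ segment ℝ (vert a) (vert b), ∀ y ∈ segment ℝ (vert a') (vert b'),
      c * ‖x - y‖ ≤ ‖realize p x - realize p y‖ := by
  by_cases h1 : a = a'
  · subst h1; exact exists_mul_norm_sub_le_common p hab hab' hself hinj
  by_cases h2 : a = b'
  · subst h2
    rw [segment_symm ℝ (vert a')] at hinj ⊢
    exact exists_mul_norm_sub_le_common p hab hab'.symm hself hinj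
  by_cases h3 : b = a'
  · subst h3
    rw [segment_symm ℝ (vert a)] at hinj ⊢
    exact exists_mul_norm_sub_le_common p hab.symm hab' hself.symm hinj
  by_cases h4 : b = b'
  · subst h4
    rw [segment_symm ℝ (vert a), segment_symm ℝ (vert a')] at hinj ⊢
    exact exists_mul_norm_sub_le_common p hab.symm hab'.symm hself.symm hinj
  exact exists_mul_norm_sub_le_disjoint p hab h1 h2 h3 h4 hinj

/-- The union of the edges of the complex `𝓔` on the standard simplex. -/
def formalEdges (𝓔 : Set (V × V)) : Set (V → ℝ) :=
  {x | ∃ e ∈ 𝓔, x ∈ segment ℝ (vert e.1) (vert e.2)}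

theorem vert_mem_formalEdges_fst {𝓔 : Set (V × V)} {e : V × V} (he : e ∈ 𝓔) :
    vert e.1 ∈ formalEdges 𝓔 := ⟨e, he, left_mem_segment _ _ _⟩

theorem vert_mem_formalEdges_snd {𝓔 : Set (V × V)} {e : V × V} (he : e ∈ 𝓔) :
    vert e.2 ∈ formalEdges 𝓔 := ⟨e, he, right_mem_segment _ _ _⟩

theorem vert_injective : Function.Injective (vert : V → V → ℝ) := fun a b h => by
  by_contra hab
  have := congrFun h a
  rw [vert_apply_self, vert_apply_ne hab] at this
  exact one_ne_zero this

/-- An embedding of a finite one-dimensional complex that is linear on the edges is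
bi-Lipschitz. -/
theorem exists_mul_norm_sub_le (𝓔 : Set (V × V)) (h𝓔 : ∀ e ∈ 𝓔, e.1 ≠ e.2) (p : V → Space)
    (hinj : InjOn (realize p) (formalEdges 𝓔)) :
    ∃ c > 0, ∀ x ∈ formalEdges 𝓔, ∀ y ∈ formalEdges 𝓔,
      c * ‖x - y‖ ≤ ‖realize p x - realize p y‖ := by
  have hpair : ∀ e : 𝓔 × 𝓔, ∃ c > 0, ∀ x ∈ segment ℝ (vert e.1.1.1) (vert e.1.1.2),
      ∀ y ∈ segment ℝ (vert e.2.1.1) (vert e.2.1.2),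
      c * ‖x - y‖ ≤ ‖realize p x - realize p y‖ := fun e => by
    refine exists_mul_norm_sub_le_edges p (h𝓔 _ e.1.2) (h𝓔 _ e.2.2) (fun h => ?_)
      fun x hx y hy h => hinj ⟨_, e.1.2, hx⟩ ⟨_, e.2.2, hy⟩ h
    rw [← realize_vert p e.1.1.1, ← realize_vert p e.1.1.2] at h
    exact h𝓔 _ e.1.2 (vert_injective
      (hinj (vert_mem_formalEdges_fst e.1.2) (vert_mem_formalEdges_snd e.1.2) h))
  choose c hc hcle using hpair
  obtain ⟨c₀, hc₀, hle⟩ := exists_pos_forall_le c hc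
  refine ⟨c₀, hc₀, ?_⟩
  rintro x ⟨e, he, hx⟩ y ⟨e', he', hy⟩
  calc c₀ * ‖x - y‖ ≤ c (⟨e, he⟩, ⟨e', he'⟩) * ‖x - y‖ := by gcongr; exact hle _
    _ ≤ _ := hcle (⟨e, he⟩, ⟨e', he'⟩) x hx y hy

theorem exists_norm_realize_le (u : V → Space) :
    ∀ x : V → ℝ, ‖realize u x‖ ≤ (∑ v, ‖u v‖) * ‖x‖ := fun x => by
  rw [realize, Fintype.linearCombination_apply, Finset.sum_mul]
  refine (norm_sum_le _ _).trans (Finset.sum_le_sum fun v _ => ?_)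
  rw [norm_smul, mul_comm]
  gcongr
  exact norm_le_pi_norm x v

theorem realize_add_smul (p u : V → Space) (t : ℝ) (x : V → ℝ) :
    realize (fun v => p v + t • u v) x = realize p x + t • realize u x := by
  simp only [realize, Fintype.linearCombination_apply, Finset.smul_sum, ← Finset.sum_add_distrib]
  refine Finset.sum_congr rfl fun v _ => ?_
  module

/-- Moving the vertices of an embedded complex of segments linearly and such that the complex
remains embedded does not change the ambient isotopy type. -/
theorem ambientIsotopic_of_complex (𝓔 : Set (V × V)) (h𝓔 : ∀ e ∈ 𝓔, e.1 ≠ e.2) (p u : V → Space)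
    (hinj : ∀ t ∈ Icc (0 : ℝ) 1,
      InjOn (realize fun v => p v + t • u v) (formalEdges 𝓔)) :
    AmbientIsotopic (⋃ e ∈ 𝓔, segment ℝ (p e.1) (p e.2))
      (⋃ e ∈ 𝓔, segment ℝ (p e.1 + u e.1) (p e.2 + u e.2)) := by
  have hset : ∀ q : V → Space, range (fun x : formalEdges 𝓔 => realize q x) =
      ⋃ e ∈ 𝓔, segment ℝ (q e.1) (q e.2) := fun q => by
    ext y
    simp only [← realize_image_segment, mem_range, mem_iUnion, exists_prop, mem_image]
    constructor
    · rintro ⟨⟨x, e, he, hx⟩, rfl⟩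
      exact ⟨e, he, x, hx, rfl⟩
    · rintro ⟨e, he, x, hx, rfl⟩
      exact ⟨⟨x, e, he, hx⟩, rfl⟩
  -- The gauge is the distance in the standard simplex: linear maps are Lipschitz for it, and
  -- embeddedness at each time supplies the lower bound.
  have := ambientIsotopic_of_gauge (X := formalEdges 𝓔) (fun x y => ‖x.1 - y.1‖)
    (fun x => realize p x) (fun x => realize u x) (∑ v, ‖u v‖) (fun _ _ => norm_nonneg _)
    (fun a b => by rw [dist_eq_norm, ← map_sub]; exact exists_norm_realize_le u _)
    (fun t ht => by
      obtain ⟨c, hc, h⟩ := exists_mul_norm_sub_le 𝓔 h𝓔 _ (hinj t ht)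
      refine ⟨c, hc, fun a b => ?_⟩
      have := h a a.2 b b.2
      rw [realize_add_smul, realize_add_smul] at this
      rwa [dist_eq_norm])
  rw [hset p] at this
  rw [← hset (fun v => p v + u v)]
  convert this using 3
  have := realize_add_smul p u 1
  simp only [one_smul] at this
  exact this _

end Complex

/-! ### Polygonal links as closed cycles of vertices -/

section Cycles

set_option linter.unusedSectionVars false

variable {V : Type*} [Fintype V] [DecidableEq V]

/-- The point with parameter `θ` on the edge from `p v` to `p (σ v)`. -/
noncomputable def edgePt (σ : Equiv.Perm V) (p : V → Space) (v : V) (θ : ℝ) : Space :=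
  AffineMap.lineMap (p v) (p (σ v)) θ

/-- The point with parameter `θ` on the formal edge from `v` to `σ v`. -/
noncomputable def formalPt (σ : Equiv.Perm V) (v : V) (θ : ℝ) : V → ℝ :=
  AffineMap.lineMap (vert v) (vert (σ v)) θ

/-- The closed polygons with vertices `p v`, where `σ v` follows `v`, form a link. -/
def IsEmbeddedCycle (σ : Equiv.Perm V) (p : V → Space) : Prop :=
  ∀ v w : V, ∀ θ ∈ Ico (0 : ℝ) 1, ∀ θ' ∈ Ico (0 : ℝ) 1,
    edgePt σ p v θ = edgePt σ p w θ' → v = w ∧ θ = θ'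

/-- The union of the closed polygons with vertices `p v`. -/
def cycleSet (σ : Equiv.Perm V) (p : V → Space) : Set Space :=
  ⋃ v, segment ℝ (p v) (p (σ v))

/-- The edges of a cycle. -/
def cycleEdges (σ : Equiv.Perm V) : Set (V × V) := {e | e.2 = σ e.1}

variable {σ : Equiv.Perm V} {p : V → Space}

theorem realize_formalPt (q : V → Space) (v : V) (θ : ℝ) :
    realize q (formalPt σ v θ) = edgePt σ q v θ := realize_lineMap _ _ _ _

theorem formalPt_one (v : V) : formalPt σ v 1 = formalPt σ (σ v) 0 := by simp [formalPt]

/-- A constant edge would take the same value at the parameters 0 and 1/2. -/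
theorem IsEmbeddedCycle.apply_ne (h : IsEmbeddedCycle σ p) (v : V) : σ v ≠ v := fun hv => by
  have := h v v 0 (by norm_num) (1 / 2) (by norm_num) (by simp [edgePt, hv])
  norm_num at this

/-- Two edges that traverse one segment in opposite directions would share their midpoint. -/
theorem IsEmbeddedCycle.apply_apply_ne (h : IsEmbeddedCycle σ p) (v : V) : σ (σ v) ≠ v :=
  fun hv => by
  have := h v (σ v) (1 / 2) (by norm_num) (1 / 2) (by norm_num) (by
    simp only [edgePt, hv, AffineMap.lineMap_apply_module]
    module)
  exact h.apply_ne v this.1.symm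

theorem mem_formalEdges_cycleEdges {x : V → ℝ} :
    x ∈ formalEdges (cycleEdges σ) ↔ ∃ v, ∃ θ ∈ Icc (0 : ℝ) 1, x = formalPt σ v θ := by
  constructor
  · rintro ⟨⟨v, w⟩, he, hx⟩
    obtain rfl : w = σ v := he
    rw [segment_eq_image_lineMap] at hx
    obtain ⟨θ, hθ, rfl⟩ := hx
    exact ⟨v, θ, hθ, rfl⟩
  · rintro ⟨v, θ, hθ, rfl⟩
    refine ⟨(v, σ v), rfl, ?_⟩
    rw [segment_eq_image_lineMap]
    exact ⟨θ, hθ, rfl⟩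

theorem formalPt_mem {v : V} {θ : ℝ} (hθ : θ ∈ Icc (0 : ℝ) 1) :
    formalPt σ v θ ∈ formalEdges (cycleEdges σ) :=
  mem_formalEdges_cycleEdges.2 ⟨v, θ, hθ, rfl⟩

/-- Every formal point has a parameter in `[0, 1)`. -/
theorem exists_formalPt_eq (v : V) {θ : ℝ} (hθ : θ ∈ Icc (0 : ℝ) 1) :
    ∃ w, ∃ η ∈ Ico (0 : ℝ) 1, formalPt σ v θ = formalPt σ w η := by
  rcases hθ.2.eq_or_lt with h | h
  · exact ⟨σ v, 0, by norm_num, by rw [h, formalPt_one]⟩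
  · exact ⟨v, θ, ⟨hθ.1, h⟩, rfl⟩

theorem IsEmbeddedCycle.injOn (h : IsEmbeddedCycle σ p) :
    InjOn (realize p) (formalEdges (cycleEdges σ)) := by
  intro x hx y hy hxy
  obtain ⟨v, θ, hθ, rfl⟩ := mem_formalEdges_cycleEdges.1 hx
  obtain ⟨w, η, hη, rfl⟩ := mem_formalEdges_cycleEdges.1 hy
  obtain ⟨v', θ', hθ', e⟩ := exists_formalPt_eq (σ := σ) v hθ
  obtain ⟨w', η', hη', e'⟩ := exists_formalPt_eq (σ := σ) w hη
  rw [e, e', realize_formalPt, realize_formalPt] at hxy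
  obtain ⟨rfl, rfl⟩ := h v' w' θ' hθ' η' hη' hxy
  rw [e, e']

theorem IsEmbeddedCycle.formalPt_inj (h : IsEmbeddedCycle σ p) {v w : V} {θ η : ℝ}
    (hθ : θ ∈ Ico (0 : ℝ) 1) (hη : η ∈ Ico (0 : ℝ) 1) (e : formalPt σ v θ = formalPt σ w η) :
    v = w ∧ θ = η :=
  h v w θ hθ η hη (by rw [← realize_formalPt, e, realize_formalPt])

theorem IsEmbeddedCycle.edges_ne (h : IsEmbeddedCycle σ p) :
    ∀ e ∈ cycleEdges σ, e.1 ≠ e.2 := by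
  rintro ⟨v, w⟩ he hvw
  obtain rfl : w = σ v := he
  exact h.apply_ne v hvw.symm

theorem IsEmbeddedCycle.exists_mul_le (h : IsEmbeddedCycle σ p) :
    ∃ c > 0, ∀ v w, ∀ θ ∈ Icc (0 : ℝ) 1, ∀ η ∈ Icc (0 : ℝ) 1,
      c * ‖formalPt σ v θ - formalPt σ w η‖ ≤ ‖edgePt σ p v θ - edgePt σ p w η‖ := by
  obtain ⟨c, hc, hle⟩ := exists_mul_norm_sub_le _ h.edges_ne p h.injOn
  refine ⟨c, hc, fun v w θ hθ η hη => ?_⟩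
  rw [← realize_formalPt, ← realize_formalPt]
  exact hle _ (formalPt_mem hθ) _ (formalPt_mem hη)

theorem biUnion_cycleEdges (q : V → Space) :
    ⋃ e ∈ cycleEdges σ, segment ℝ (q e.1) (q e.2) = cycleSet σ q := by
  ext x
  simp only [cycleSet, mem_iUnion, exists_prop, cycleEdges, mem_ofPred_eq, Prod.exists]
  constructor
  · rintro ⟨v, w, rfl, hx⟩
    exact ⟨v, hx⟩
  · rintro ⟨v, hx⟩
    exact ⟨v, _, rfl, hx⟩

/-- Small perturbations of the vertices do not change the ambient isotopy type. -/
theorem IsEmbeddedCycle.exists_perturb (h : IsEmbeddedCycle σ p) :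
    ∃ ε > 0, ∀ q : V → Space, (∀ v, ‖q v - p v‖ < ε) →
      IsEmbeddedCycle σ q ∧ AmbientIsotopic (cycleSet σ p) (cycleSet σ q) := by
  obtain ⟨c, hc, hle⟩ := exists_mul_norm_sub_le _ h.edges_ne p h.injOn
  -- The sum of all displacements bounds `realize u` as an operator; with this choice it stays below
  -- the constant `c` of the embedding. The `+ 1` makes this strict.
  refine ⟨c / (Fintype.card V + 1), by positivity, fun q hq => ?_⟩
  set u : V → Space := fun v => q v - p v with hu
  have hsum : ∑ v, ‖u v‖ < c := by
    calc ∑ v, ‖u v‖ ≤ ∑ _v : V, c / (Fintype.card V + 1) := Finset.sum_le_sum fun v _ => (hq v).le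
      _ = Fintype.card V * (c / (Fintype.card V + 1)) := by simp
      _ < c := by
        rw [← mul_div_assoc, div_lt_iff₀ (by positivity)]
        nlinarith
  have hinj : ∀ t ∈ Icc (0 : ℝ) 1, InjOn (realize fun v => p v + t • u v)
      (formalEdges (cycleEdges σ)) := by
    intro t ht x hx y hy hxy
    by_contra hne
    have hpos : 0 < ‖x - y‖ := norm_pos_iff.2 (sub_ne_zero.2 hne)
    rw [realize_add_smul, realize_add_smul] at hxy
    have e : realize p x - realize p y = -(t • realize u (x - y)) := by
      rw [map_sub, smul_sub]
      rw [← sub_eq_zero] at hxy ⊢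
      rw [← hxy]
      module
    have h1 := hle x hx y hy
    rw [e, norm_neg, norm_smul, Real.norm_of_nonneg ht.1] at h1
    have h2 := exists_norm_realize_le u (x - y)
    have h3 : t * ‖realize u (x - y)‖ ≤ 1 * ((∑ v, ‖u v‖) * ‖x - y‖) :=
      mul_le_mul ht.2 h2 (norm_nonneg _) zero_le_one
    nlinarith
  have hq' : ∀ v, p v + u v = q v := fun v => by simp [hu]
  constructor
  · intro v w θ hθ η hη he
    have h1 := hinj 1 (by norm_num)
    simp only [one_smul, hq'] at h1
    refine h.formalPt_inj hθ hη (h1 (formalPt_mem ⟨hθ.1, hθ.2.le⟩) (formalPt_mem ⟨hη.1, hη.2.le⟩) ?_)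
    rw [realize_formalPt, realize_formalPt, he]
  · have := ambientIsotopic_of_complex _ h.edges_ne p u hinj
    simp only [hq'] at this
    rwa [biUnion_cycleEdges, biUnion_cycleEdges] at this

end Cycles

/-- Half-open parameters assign each vertex to the edge that leaves it: the common point of
consecutive edges has the excluded parameter 1 on the first of them. -/
theorem IsSimplePolygon.isEmbedded {n : ℕ} {v : Fin (n + 3) → Space} (h : IsSimplePolygon v)
    (i j : Fin (n + 3)) {θ η : ℝ} (hθ : θ ∈ Ico (0 : ℝ) 1) (hη : η ∈ Ico (0 : ℝ) 1)
    (he : (AffineMap.lineMap (v i) (v (i + 1)) θ : Space) = AffineMap.lineMap (v j) (v (j + 1)) η) :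
    i = j ∧ θ = η := by
  have hne : ∀ i, v i ≠ v (i + 1) := fun i hi => by
    have := h.injective hi
    simp at this
  have hmem : ∀ i, ∀ θ ∈ Ico (0 : ℝ) 1, (AffineMap.lineMap (v i) (v (i + 1)) θ : Space) ∈ edge v i :=
    fun i θ hθ => by
      rw [edge, segment_eq_image_lineMap]
      exact ⟨θ, ⟨hθ.1, hθ.2.le⟩, rfl⟩
  have hcons : ∀ i, ∀ θ ∈ Ico (0 : ℝ) 1, ∀ η ∈ Ico (0 : ℝ) 1,
      (AffineMap.lineMap (v i) (v (i + 1)) θ : Space) ≠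
        AffineMap.lineMap (v (i + 1)) (v (i + 1 + 1)) η := fun i θ hθ η hη he => by
    have h1 : (AffineMap.lineMap (v i) (v (i + 1)) θ : Space) ∈ edge v i ∩ edge v (i + 1) :=
      ⟨hmem i θ hθ, he ▸ hmem (i + 1) η hη⟩
    rw [h.consecutive, mem_singleton_iff] at h1
    have h2 : (AffineMap.lineMap (v i) (v (i + 1)) θ : Space) =
        AffineMap.lineMap (v i) (v (i + 1)) (1 : ℝ) := by rw [h1, AffineMap.lineMap_apply_one]
    exact hθ.2.ne (AffineMap.lineMap_injective ℝ (hne i) h2)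
  by_cases hij : i = j
  · subst hij
    exact ⟨rfl, AffineMap.lineMap_injective ℝ (hne i) he⟩
  exfalso
  by_cases h1 : j = i + 1
  · subst h1
    exact hcons i θ hθ η hη he
  by_cases h2 : i = j + 1
  · subst h2
    exact hcons j η hη θ hθ he.symm
  exact Set.disjoint_left.1 (h.nonconsecutive i j (Ne.symm hij) h1 h2) (hmem i θ hθ)
    (he ▸ hmem j η hη)

/-- Collecting all components in one vertex set with a successor permutation removes the components
from the later arguments. -/
theorem IsPolygonalLink.exists_cycle {L : Set Space} (hL : IsPolygonalLink L) :
    ∃ (V : Type) (_ : Fintype V) (_ : DecidableEq V) (_ : Nonempty V) (σ : Equiv.Perm V)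
      (p : V → Space), IsEmbeddedCycle σ p ∧ L = cycleSet σ p := by
  obtain ⟨m, n, v, hm, hv, hdisj, rfl⟩ := hL
  refine ⟨Σ c : Fin m, Fin (n c + 3), inferInstance, inferInstance, ⟨⟨0, hm⟩, 0⟩,
    Equiv.sigmaCongrRight fun c => Equiv.addRight (1 : Fin (n c + 3)), fun x => v x.1 x.2, ?_, ?_⟩
  · rintro ⟨c, i⟩ ⟨d, j⟩ θ hθ η hη he
    simp only [edgePt] at he
    by_cases hcd : c = d
    · subst hcd
      obtain ⟨rfl, rfl⟩ := (hv c).isEmbedded i j hθ hη he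
      exact ⟨rfl, rfl⟩
    · exfalso
      have hmem : ∀ c i, ∀ θ ∈ Ico (0 : ℝ) 1,
          (AffineMap.lineMap (v c i) (v c (i + 1)) θ : Space) ∈ polygon (v c) := fun c i θ hθ => by
        refine mem_iUnion.2 ⟨i, ?_⟩
        rw [edge, segment_eq_image_lineMap]
        exact ⟨θ, ⟨hθ.1, hθ.2.le⟩, rfl⟩
      exact Set.disjoint_left.1 (hdisj c d hcd) (hmem c i θ hθ) (he ▸ hmem d j η hη)
  · ext x
    simp only [polygon, edge, cycleSet, mem_iUnion, Sigma.exists]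
    exact Iff.rfl

/-! ### Coordinates and general position -/

theorem abs_apply_le_norm (z : Space) (i : Fin 3) : |z i| ≤ ‖z‖ := PiLp.norm_apply_le z i

theorem norm_le_sum_abs (z : Space) : ‖z‖ ≤ |z 0| + |z 1| + |z 2| := by
  rw [EuclideanSpace.norm_eq, Fin.sum_univ_three]
  refine Real.sqrt_le_iff.2 ⟨by positivity, ?_⟩
  simp only [Real.norm_eq_abs]
  nlinarith [mul_nonneg (abs_nonneg (z 0)) (abs_nonneg (z 1)),
    mul_nonneg (abs_nonneg (z 0)) (abs_nonneg (z 2)),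
    mul_nonneg (abs_nonneg (z 1)) (abs_nonneg (z 2))]

theorem lineMap_apply_coord (a b : Space) (s : ℝ) (i : Fin 3) :
    (AffineMap.lineMap a b s : Space) i = a i + s * (b i - a i) := by
  simp [AffineMap.lineMap_apply_module']; ring

theorem space_ext {a b : Space} (h0 : a 0 = b 0) (h1 : a 1 = b 1) (h2 : a 2 = b 2) : a = b := by
  ext i
  fin_cases i
  · exact h0
  · exact h1
  · exact h2

section Generic

set_option linter.unusedSectionVars false

variable {V : Type*} [Fintype V]

/-- Countably many hyperplanes can be avoided by an arbitrarily small displacement. -/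
theorem exists_near_avoiding (F : Set (V → ℝ)) (hF : F.Countable) (hne : ∀ f ∈ F, f ≠ 0)
    (y₀ : V → ℝ) {ε : ℝ} (hε : 0 < ε) :
    ∃ y : V → ℝ, (∀ v, |y v - y₀ v| < ε) ∧ ∀ f ∈ F, ∑ v, f v * y v ≠ 0 := by
  let N : (V → ℝ) → Submodule ℝ (V → ℝ) := fun f => LinearMap.ker (Fintype.linearCombination ℝ f)
  -- A nonzero `f` does not annihilate itself, so each kernel is a proper subspace and has measure
  -- zero; countably many of them cannot cover a ball.
  have hnull : MeasureTheory.volume (⋃ f ∈ F, (N f : Set (V → ℝ))) = 0 := by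
    rw [MeasureTheory.measure_biUnion_null_iff hF]
    intro f hf
    refine MeasureTheory.Measure.addHaar_submodule _ _ fun htop => hne f hf ?_
    have : f ∈ N f := htop ▸ Submodule.mem_top
    simp only [N, LinearMap.mem_ker, Fintype.linearCombination_apply, smul_eq_mul] at this
    funext v
    have h2 := (Finset.sum_eq_zero_iff_of_nonneg fun v _ => mul_self_nonneg (f v)).1 this v
      (Finset.mem_univ v)
    simpa using h2
  have hball : 0 < MeasureTheory.volume (Metric.ball y₀ ε) := Metric.measure_ball_pos _ _ hε
  obtain ⟨y, hy, hyN⟩ : ∃ y ∈ Metric.ball y₀ ε, y ∉ ⋃ f ∈ F, (N f : Set (V → ℝ)) := by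
    by_contra! hcon
    exact absurd (MeasureTheory.measure_mono_null hcon hnull) hball.ne'
  refine ⟨y, fun v => ?_, fun f hf h => hyN ?_⟩
  · rw [Metric.mem_ball] at hy
    exact (dist_le_pi_dist y y₀ v).trans_lt hy
  · simp only [mem_iUnion]
    refine ⟨f, hf, ?_⟩
    simp only [N, SetLike.mem_coe, LinearMap.mem_ker, Fintype.linearCombination_apply, smul_eq_mul]
    rw [← h]
    exact Finset.sum_congr rfl fun v _ => mul_comm _ _

variable [DecidableEq V] {σ : Equiv.Perm V} {p : V → Space}

theorem sum_vert_mul (v : V) (y : V → ℝ) : ∑ w, vert v w * y w = y v := by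
  simp [vert, Pi.single_apply]

theorem sum_formalPt_mul (v : V) (a : ℝ) (y : V → ℝ) :
    ∑ w, formalPt σ v a w * y w = y v + a * (y (σ v) - y v) := by
  have : ∀ w, formalPt σ v a w * y w =
      vert v w * y w + a * (vert (σ v) w * y w - vert v w * y w) := fun w => by
    simp [formalPt, AffineMap.lineMap_apply_module']; ring
  simp only [this, Finset.sum_add_distrib, ← Finset.mul_sum, Finset.sum_sub_distrib, sum_vert_mul]

/-- The coordinate values `y v` are such that the values at the rational points of the edges are
all distinct. -/
def IsGenericCoord (σ : Equiv.Perm V) (y : V → ℝ) : Prop :=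
  ∀ v w : V, ∀ a b : ℚ, (a : ℝ) ∈ Ico (0 : ℝ) 1 → (b : ℝ) ∈ Ico (0 : ℝ) 1 →
    y v + a * (y (σ v) - y v) = y w + b * (y (σ w) - y w) → v = w ∧ a = b

/-- The functionals that are to be avoided by generic coordinate values. -/
def rationalDifferences (σ : Equiv.Perm V) : Set (V → ℝ) :=
  {f | f ≠ 0 ∧ ∃ z : V × V × ℚ × ℚ, f = formalPt σ z.1 z.2.2.1 - formalPt σ z.2.1 z.2.2.2}

theorem countable_rationalDifferences : (rationalDifferences σ).Countable := by
  refine (countable_range fun z : V × V × ℚ × ℚ =>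
    formalPt σ z.1 z.2.2.1 - formalPt σ z.2.1 z.2.2.2).mono ?_
  rintro f ⟨-, z, rfl⟩
  exact ⟨z, rfl⟩

theorem IsEmbeddedCycle.isGenericCoord (h : IsEmbeddedCycle σ p) {y : V → ℝ}
    (hy : ∀ f ∈ rationalDifferences σ, ∑ v, f v * y v ≠ 0) : IsGenericCoord σ y := by
  intro v w a b ha hb he
  by_contra hne
  refine hy (formalPt σ v a - formalPt σ w b) ⟨fun h0 => hne ?_, (v, w, a, b), rfl⟩ ?_
  · have := h.formalPt_inj ha hb (sub_eq_zero.1 h0)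
    exact ⟨this.1, by exact_mod_cast this.2⟩
  · simp only [Pi.sub_apply, sub_mul, Finset.sum_sub_distrib, sum_formalPt_mul, he, sub_self]

theorem IsGenericCoord.apply_ne {y : V → ℝ} (hy : IsGenericCoord σ y) {v : V} (hv : σ v ≠ v) :
    y (σ v) - y v ≠ 0 := fun h => by
  have := hy v (σ v) 0 0 (by norm_num) (by norm_num) (by simp; linarith)
  exact hv this.1.symm

/-- The coordinates along the `i`-th axis. -/
def coord (p : V → Space) (i : Fin 3) : V → ℝ := fun v => p v i

/-- The direction of the edge from `p v` to `p (σ v)` along the `i`-th axis. -/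
def edgeDir (σ : Equiv.Perm V) (p : V → Space) (i : Fin 3) (v : V) : ℝ := p (σ v) i - p v i

/-- General position of the projection to the first two coordinates. -/
structure IsGeneric (σ : Equiv.Perm V) (p : V → Space) : Prop where
  embedded : IsEmbeddedCycle σ p
  coord_zero : IsGenericCoord σ (coord p 0)
  coord_one : IsGenericCoord σ (coord p 1)
  cross : ∀ v, edgeDir σ p 0 v * edgeDir σ p 1 (σ v) ≠ edgeDir σ p 1 v * edgeDir σ p 0 (σ v)

/-- The abscissae are chosen first. Once they are fixed, parallelism of the projections of
consecutive edges is a linear condition on the ordinates, so it merely adds finitely many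
hyperplanes to be avoided. The heights need not move. -/
theorem IsEmbeddedCycle.exists_generic (h : IsEmbeddedCycle σ p) :
    ∃ q, IsGeneric σ q ∧ AmbientIsotopic (cycleSet σ p) (cycleSet σ q) := by
  obtain ⟨ε, hε, hq⟩ := h.exists_perturb
  obtain ⟨x, hx, hxF⟩ := exists_near_avoiding (rationalDifferences σ) countable_rationalDifferences
    (fun f hf => hf.1) (coord p 0) (half_pos hε)
  have hxG := h.isGenericCoord hxF
  -- The functional `g v` is the determinant of the directions of two consecutive edges; it is
  -- nonzero since its coefficient at `σ (σ v)` is the first coordinate of an edge direction.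
  let g : V → V → ℝ := fun v => (x (σ v) - x v) • (vert (σ (σ v)) - vert (σ v)) -
    (x (σ (σ v)) - x (σ v)) • (vert (σ v) - vert v)
  have hg : ∀ v, g v ≠ 0 := fun v h0 => by
    have h1 := congrFun h0 (σ (σ v))
    simp only [g, Pi.sub_apply, Pi.smul_apply, vert_apply_self, vert_apply_ne (h.apply_ne (σ v)),
      vert_apply_ne (h.apply_apply_ne v), smul_eq_mul, Pi.zero_apply] at h1
    exact hxG.apply_ne (h.apply_ne v) (by linarith)
  obtain ⟨y, hy, hyF⟩ := exists_near_avoiding (rationalDifferences σ ∪ range g)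
    (countable_rationalDifferences.union (countable_range g))
    (by
      rintro f (hf | ⟨v, rfl⟩)
      · exact hf.1
      · exact hg v) (coord p 1) (half_pos hε)
  have hyG := h.isGenericCoord fun f hf => hyF f (Or.inl hf)
  let q : V → Space := fun v => !₂[x v, y v, p v 2]
  have hnear : ∀ v, ‖q v - p v‖ < ε := fun v => by
    refine (norm_le_sum_abs _).trans_lt ?_
    have h1 := hx v
    have h2 := hy v
    simp only [coord] at h1 h2
    simp [q]
    linarith
  obtain ⟨he, hiso⟩ := hq q hnear
  have hq0 : coord q 0 = x := by funext v; simp [coord, q]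
  have hq1 : coord q 1 = y := by funext v; simp [coord, q]
  refine ⟨q, ⟨he, hq0 ▸ hxG, hq1 ▸ hyG, fun v hv => hyF (g v) (Or.inr ⟨v, rfl⟩) ?_⟩, hiso⟩
  simp only [g, Pi.sub_apply, Pi.smul_apply, smul_eq_mul, sub_mul, mul_sub, mul_assoc,
    Finset.sum_sub_distrib, ← Finset.mul_sum, sum_vert_mul]
  simp [edgeDir, q] at hv
  linarith

end Generic

/-! ### Staircases -/

/-- At a vertex of a polygon with incoming direction `(a, b)` and outgoing direction `(a', b')`,
staircases along the two edges on one of the two sides diverge. -/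
theorem exists_side {a b a' b' : ℝ} (ha : a ≠ 0) (hb : b ≠ 0) (ha' : a' ≠ 0) (hb' : b' ≠ 0)
    (hcross : a * b' ≠ b * a') :
    ∃ τ : Bool, ∃ c > 0, ∀ A B A' B' : ℝ, 0 ≤ A → 0 ≤ B → 0 ≤ A' → 0 ≤ B' →
      (τ = false → A ≤ B ∧ B' ≤ A') → (τ = true → B ≤ A ∧ A' ≤ B') →
      c * (A + B + A' + B') ≤ |a * A + a' * A'| + |b * B + b' * B'| := by
  -- Here `A` and `B` measure how far the incoming staircase still is from the vertex in the two
  -- coordinates, `A'` and `B'` how far the outgoing one already is. Two such points differ by the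
  -- vector with the entries on the right, so it has to be shown that they coincide only in the
  -- vertex; homogeneity then gives `c`.
  have hside : ∃ τ : Bool, ∀ A B A' B' : ℝ, 0 ≤ A → 0 ≤ B → 0 ≤ A' → 0 ≤ B' →
      (τ = false → A ≤ B ∧ B' ≤ A') → (τ = true → B ≤ A ∧ A' ≤ B') →
      a * A + a' * A' = 0 → b * B + b' * B' = 0 → A = 0 ∧ B = 0 ∧ A' = 0 ∧ B' = 0 := by
    have pos : ∀ {a a' A A' : ℝ}, 0 < a * a' → 0 ≤ A → 0 ≤ A' → a * A + a' * A' = 0 →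
        A = 0 ∧ A' = 0 := fun {a a' A A'} h hA hA' he => by
      have ha : a ≠ 0 := by rintro rfl; simp at h
      have e : a * a * A + a * a' * A' = 0 := by linear_combination a * he
      have h1 : 0 < a * a := mul_self_pos.2 ha
      have h2 : 0 ≤ a * a * A := by positivity
      have h3 : 0 ≤ a * a' * A' := by positivity
      have h4 : a * a * A = 0 := by linarith
      have h5 : a * a' * A' = 0 := by linarith
      exact ⟨(mul_eq_zero.1 h4).resolve_left h1.ne', (mul_eq_zero.1 h5).resolve_left h.ne'⟩
    -- If a coordinate does not reverse its direction at the vertex, its equation alone forces both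
    -- of its variables to vanish, and either side will do.
    by_cases h1 : 0 < a * a'
    · refine ⟨false, fun A B A' B' hA hB hA' hB' hf _ e1 e2 => ?_⟩
      obtain ⟨rfl, rfl⟩ := pos h1 hA hA' e1
      have : B' = 0 := le_antisymm (hf rfl).2 hB'
      subst this
      refine ⟨rfl, ?_, rfl, rfl⟩
      simpa [hb] using e2
    by_cases h2 : 0 < b * b'
    · refine ⟨false, fun A B A' B' hA hB hA' hB' hf _ e1 e2 => ?_⟩
      obtain ⟨rfl, rfl⟩ := pos h2 hB hB' e2
      have : A = 0 := le_antisymm (hf rfl).1 hA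
      subst this
      refine ⟨rfl, rfl, ?_, rfl⟩
      simpa [ha'] using e1
    -- the vertex is extremal for both coordinates
    have h1' : a * a' < 0 := lt_of_le_of_ne (not_lt.1 h1) (mul_ne_zero ha ha')
    have h2' : b * b' < 0 := lt_of_le_of_ne (not_lt.1 h2) (mul_ne_zero hb hb')
    set κ : ℝ := -a' / a with hκ
    set μ : ℝ := -b' / b with hμ
    have hκpos : 0 < κ := by
      have : κ = -(a * a') / (a * a) := by rw [hκ]; field_simp
      rw [this]
      have : 0 < a * a := mul_self_pos.2 ha
      exact div_pos (by linarith) this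
    have hμpos : 0 < μ := by
      have : μ = -(b * b') / (b * b) := by rw [hμ]; field_simp
      rw [this]
      have : 0 < b * b := mul_self_pos.2 hb
      exact div_pos (by linarith) this
    have hne : κ ≠ μ := fun h => hcross (by
      rw [hκ, hμ, div_eq_div_iff ha hb] at h
      linarith)
    have eA : ∀ A A' : ℝ, a * A + a' * A' = 0 → A = κ * A' := fun A A' h => by
      rw [hκ]; field_simp; linarith
    have eB : ∀ B B' : ℝ, b * B + b' * B' = 0 → B = μ * B' := fun B B' h => by
      rw [hμ]; field_simp; linarith
    -- Seen from the vertex, both edges of the hairpin lie in one quadrant and have different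
    -- slopes. The side is chosen such that both staircases run outside the wedge between the edges.
    rcases lt_or_gt_of_ne hne with h | h
    · refine ⟨true, fun A B A' B' hA hB hA' hB' _ hf e1 e2 => ?_⟩
      obtain ⟨f1, f2⟩ := hf rfl
      have e3 := eA _ _ e1
      have e4 := eB _ _ e2
      have : B' = 0 := by nlinarith
      subst this
      have : A' = 0 := by linarith
      subst this
      simp [e3, e4]
    · refine ⟨false, fun A B A' B' hA hB hA' hB' hf _ e1 e2 => ?_⟩
      obtain ⟨f1, f2⟩ := hf rfl
      have e3 := eA _ _ e1
      have e4 := eB _ _ e2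
      have : A' = 0 := by nlinarith
      subst this
      have : B' = 0 := by linarith
      subst this
      simp [e3, e4]
  obtain ⟨τ, hτ⟩ := hside
  refine ⟨τ, ?_⟩
  obtain ⟨c, hc, hcone⟩ := exists_mul_norm_le_of_cone (E := ℝ × ℝ × ℝ × ℝ)
    (C := {z | 0 ≤ z.1 ∧ 0 ≤ z.2.1 ∧ 0 ≤ z.2.2.1 ∧ 0 ≤ z.2.2.2 ∧
      (τ = false → z.1 ≤ z.2.1 ∧ z.2.2.2 ≤ z.2.2.1) ∧
      (τ = true → z.2.1 ≤ z.1 ∧ z.2.2.1 ≤ z.2.2.2)})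
    (f := fun z => |a * z.1 + a' * z.2.2.1| + |b * z.2.1 + b' * z.2.2.2|)
    (by
      cases τ <;> simp only [reduceCtorEq, true_implies, false_implies, and_true, true_and] <;>
      simp only [ofPred_and] <;>
      refine IsClosed.inter (isClosed_le (by fun_prop) (by fun_prop))
        (IsClosed.inter (isClosed_le (by fun_prop) (by fun_prop))
        (IsClosed.inter (isClosed_le (by fun_prop) (by fun_prop))
        (IsClosed.inter (isClosed_le (by fun_prop) (by fun_prop))
        (IsClosed.inter (isClosed_le (by fun_prop) (by fun_prop))
        (isClosed_le (by fun_prop) (by fun_prop)))))))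
    (by
      rintro r hr ⟨A, B, A', B'⟩ ⟨h1, h2, h3, h4, h5, h6⟩
      exact ⟨mul_nonneg hr h1, mul_nonneg hr h2, mul_nonneg hr h3, mul_nonneg hr h4,
        fun h => ⟨mul_le_mul_of_nonneg_left (h5 h).1 hr, mul_le_mul_of_nonneg_left (h5 h).2 hr⟩,
        fun h => ⟨mul_le_mul_of_nonneg_left (h6 h).1 hr, mul_le_mul_of_nonneg_left (h6 h).2 hr⟩⟩)
    (by fun_prop)
    (by
      rintro r hr ⟨A, B, A', B'⟩
      simp only [Prod.smul_mk, smul_eq_mul]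
      rw [show a * (r * A) + a' * (r * A') = r * (a * A + a' * A') by ring,
        show b * (r * B) + b' * (r * B') = r * (b * B + b' * B') by ring, abs_mul, abs_mul,
        abs_of_nonneg hr]
      ring)
    (by
      rintro ⟨A, B, A', B'⟩ ⟨h1, h2, h3, h4, h5, h6⟩ hne
      by_contra hcon
      have e1 : |a * A + a' * A'| = 0 := by
        have := abs_nonneg (a * A + a' * A'); have := abs_nonneg (b * B + b' * B'); simp only at hcon; linarith
      have e2 : |b * B + b' * B'| = 0 := by
        have := abs_nonneg (a * A + a' * A'); have := abs_nonneg (b * B + b' * B'); simp only at hcon; linarith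
      obtain ⟨rfl, rfl, rfl, rfl⟩ := hτ A B A' B' h1 h2 h3 h4 h5 h6 (abs_eq_zero.1 e1)
        (abs_eq_zero.1 e2)
      exact hne rfl)
  -- The factor 4 compares the sum of four coordinates with their maximum.
  refine ⟨c / 4, by positivity, fun A B A' B' hA hB hA' hB' h5 h6 => ?_⟩
  have h := hcone (A, B, A', B') ⟨hA, hB, hA', hB', h5, h6⟩
  simp only at h
  have n1 : A ≤ ‖(A, B, A', B')‖ := (le_abs_self A).trans (norm_fst_le (A, B, A', B'))
  have n0 : ‖(B, A', B')‖ ≤ ‖(A, B, A', B')‖ := norm_snd_le (A, B, A', B')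
  have n2 : B ≤ ‖(B, A', B')‖ := (le_abs_self B).trans (norm_fst_le (B, A', B'))
  have n00 : ‖(A', B')‖ ≤ ‖(B, A', B')‖ := norm_snd_le (B, A', B')
  have n3 : A' ≤ ‖(A', B')‖ := (le_abs_self A').trans (norm_fst_le (A', B'))
  have n4 : B' ≤ ‖(A', B')‖ := (le_abs_self B').trans (norm_snd_le (A', B'))
  refine le_trans ?_ h
  calc c / 4 * (A + B + A' + B') ≤ c / 4 * (4 * ‖(A, B, A', B')‖) := by gcongr; linarith
    _ = _ := by ring

/-! ### Combinatorics of one staircase -/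

section Stairs

variable {V : Type*} (σ : Equiv.Perm V) (τ : V → Bool) (m : ℕ)

/-- The number of half steps of a staircase. -/
def halfSteps : ℕ := 2 * (2 * m + 1)

/-- The offset of a staircase at a vertex, depending on the side on which it starts or ends. -/
def sideOffset (v : V) : ℕ := if τ v then 2 else 0

/-- The level of the `k`-th horizontal step of the staircase along the edge that starts in `v`. -/
def level (v : V) (k : ℕ) : ℕ :=
  2 * k + if k < m then sideOffset τ v else if k = m then 1 else sideOffset τ (σ v)

/-- The levels, extended by the levels of the two ends of the edge. -/
def levelExt (v : V) : ℕ → ℕ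
  | 0 => 0
  | k + 1 => if k < 2 * m + 1 then level σ τ m v k else halfSteps m

/-- The points of the staircase along the edge that starts in `v`, in units of half steps. -/
def OnStairs (v : V) (α β : ℝ) : Prop :=
  (∃ k < 2 * m + 1, 2 * (k : ℝ) ≤ α ∧ α ≤ 2 * k + 2 ∧ β = levelExt σ τ m v (k + 1)) ∨
    ∃ j ≤ 2 * m + 1, α = 2 * (j : ℝ) ∧ (levelExt σ τ m v j : ℝ) ≤ β ∧
      β ≤ levelExt σ τ m v (j + 1)

variable {σ τ m}

theorem sideOffset_le (v : V) : sideOffset τ v ≤ 2 := by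
  unfold sideOffset; split_ifs <;> omega

theorem two_mul_le_level (v : V) (k : ℕ) : 2 * k ≤ level σ τ m v k := by
  unfold level; omega

theorem level_le (v : V) (k : ℕ) : level σ τ m v k ≤ 2 * k + 2 := by
  have := sideOffset_le (τ := τ) v
  have := sideOffset_le (τ := τ) (σ v)
  unfold level; split_ifs <;> omega

theorem level_lt_succ (v : V) (k : ℕ) : level σ τ m v k < level σ τ m v (k + 1) := by
  have := sideOffset_le (τ := τ) v
  have := sideOffset_le (τ := τ) (σ v)
  unfold level; split_ifs <;> omega

theorem level_strictMono (v : V) : StrictMono (level σ τ m v) :=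
  strictMono_nat_of_lt_succ (level_lt_succ v)

theorem levelExt_succ (v : V) {k : ℕ} (hk : k < 2 * m + 1) :
    levelExt σ τ m v (k + 1) = level σ τ m v k := if_pos hk

theorem levelExt_last (v : V) : levelExt σ τ m v (2 * m + 1 + 1) = halfSteps m :=
  if_neg (lt_irrefl _)

theorem levelExt_mono (v : V) : Monotone (levelExt σ τ m v) := by
  refine monotone_nat_of_le_succ fun j => ?_
  cases j with
  | zero => exact Nat.zero_le _
  | succ k =>
    have h1 := level_lt_succ (σ := σ) (τ := τ) (m := m) v k
    have h2 := level_le (σ := σ) (τ := τ) (m := m) v k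
    simp only [levelExt, halfSteps]
    split_ifs <;> omega

theorem levelExt_bounds (v : V) {j : ℕ} (hj : j ≤ 2 * m + 1) :
    2 * j ≤ levelExt σ τ m v j + 2 ∧ levelExt σ τ m v (j + 1) ≤ 2 * j + 2 := by
  constructor
  · cases j with
    | zero => omega
    | succ k =>
      have := two_mul_le_level (σ := σ) (τ := τ) (m := m) v k
      rw [levelExt_succ v (by omega)]
      omega
  · have := level_le (σ := σ) (τ := τ) (m := m) v j
    simp only [levelExt, halfSteps]
    split_ifs <;> omega

theorem levelExt_le (v : V) {j : ℕ} (hj : j ≤ 2 * m + 2) : levelExt σ τ m v j ≤ halfSteps m :=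
  (levelExt_mono v hj).trans (levelExt_last v).le

theorem OnStairs.le_of_lt {v : V} {α β α' β' : ℝ} (h : OnStairs σ τ m v α β)
    (h' : OnStairs σ τ m v α' β') (hlt : α < α') : β ≤ β' := by
  have key : ∀ j : ℕ, α < 2 * (j : ℝ) → β ≤ levelExt σ τ m v j := fun j hj => by
    rcases h with ⟨k, -, hk, -, rfl⟩ | ⟨i, -, rfl, -, hi⟩
    · have : (k : ℝ) < j := by linarith
      exact_mod_cast levelExt_mono v (by exact_mod_cast this)
    · have : (i : ℝ) < j := by linarith
      refine hi.trans ?_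
      exact_mod_cast levelExt_mono v (by exact_mod_cast this)
  rcases h' with ⟨k, -, -, hk, rfl⟩ | ⟨j, -, rfl, hj, -⟩
  · exact key (k + 1) (by push_cast; linarith)
  · exact (key j hlt).trans hj

/-- Both coordinates are monotone along a staircase. Hence the change of `α - β` is at most that of
`α + β`, and points with the same sum coincide. -/
theorem OnStairs.mul_nonneg {v : V} {α β α' β' : ℝ} (h : OnStairs σ τ m v α β)
    (h' : OnStairs σ τ m v α' β') : 0 ≤ (α - α') * (β - β') := by
  rcases lt_trichotomy α α' with hlt | rfl | hlt
  · exact mul_nonneg_of_nonpos_of_nonpos (by linarith) (by linarith [h.le_of_lt h' hlt])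
  · simp
  · exact _root_.mul_nonneg (by linarith) (by linarith [h'.le_of_lt h hlt])

/-- A staircase departs from the diagonal `α = β` by at most one step, which is two half steps; in
proportion to the edge this becomes arbitrarily small. -/
theorem OnStairs.bounds {v : V} {α β : ℝ} (h : OnStairs σ τ m v α β) :
    0 ≤ α ∧ α ≤ halfSteps m ∧ 0 ≤ β ∧ β ≤ halfSteps m ∧ |α - β| ≤ 2 := by
  have hK : ((halfSteps m : ℕ) : ℝ) = 2 * (2 * m + 1) := by simp [halfSteps]
  rcases h with ⟨k, hk, h1, h2, rfl⟩ | ⟨j, hj, rfl, h1, h2⟩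
  · have hk' : (k : ℝ) + 1 ≤ 2 * m + 1 := by exact_mod_cast hk
    have h3 := levelExt_le (σ := σ) (τ := τ) (m := m) v (show k + 1 ≤ 2 * m + 2 by omega)
    have h4 := level_le (σ := σ) (τ := τ) (m := m) v k
    have h5 := two_mul_le_level (σ := σ) (τ := τ) (m := m) v k
    rw [← levelExt_succ v hk] at h4 h5
    have h4' : (levelExt σ τ m v (k + 1) : ℝ) ≤ 2 * k + 2 := by exact_mod_cast h4
    have h5' : 2 * (k : ℝ) ≤ levelExt σ τ m v (k + 1) := by exact_mod_cast h5
    refine ⟨by linarith [k.cast_nonneg (α := ℝ)], by rw [hK]; linarith, by positivity,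
      by exact_mod_cast h3, abs_le.2 ⟨by linarith, by linarith⟩⟩
  · obtain ⟨h3, h4⟩ := levelExt_bounds (σ := σ) (τ := τ) (m := m) v hj
    have h5 := levelExt_le (σ := σ) (τ := τ) (m := m) v (show j + 1 ≤ 2 * m + 2 by omega)
    have hj' : (j : ℝ) ≤ 2 * m + 1 := by exact_mod_cast hj
    have h3' : 2 * (j : ℝ) ≤ levelExt σ τ m v j + 2 := by exact_mod_cast h3
    have h4' : (levelExt σ τ m v (j + 1) : ℝ) ≤ 2 * j + 2 := by exact_mod_cast h4
    have h5' : (levelExt σ τ m v (j + 1) : ℝ) ≤ halfSteps m := by exact_mod_cast h5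
    refine ⟨by positivity, by rw [hK]; linarith, le_trans (Nat.cast_nonneg _) h1, h2.trans h5',
      abs_le.2 ⟨by linarith, by linarith⟩⟩

/-- Before the middle step all levels carry the offset of the initial vertex: offset 0 keeps the
staircase on the side `β ≤ α` of the diagonal, offset 2 on the other side. The odd level of the
middle step `k = m` serves to change over to the side prescribed at the final vertex. -/
theorem OnStairs.side_start {v : V} {α β : ℝ} (h : OnStairs σ τ m v α β) (hα : α < 2 * m) :
    (τ v = false → β ≤ α) ∧ (τ v = true → α ≤ β) := by
  rcases h with ⟨k, hk, h1, h2, rfl⟩ | ⟨j, hj, rfl, h1, h2⟩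
  · have hkm : k < m := by exact_mod_cast (show (k : ℝ) < m by linarith)
    rw [levelExt_succ v hk, level, if_pos hkm, sideOffset]
    constructor <;> intro hτ <;> simp [hτ] <;> linarith
  · have hjm : j < m := by exact_mod_cast (show (j : ℝ) < m by linarith)
    rw [levelExt_succ v (by omega), level, if_pos hjm, sideOffset] at h2
    constructor <;> intro hτ
    · simpa [hτ] using h2
    · cases j with
      | zero => simpa [levelExt] using h1
      | succ i =>
        rw [levelExt_succ v (by omega), level, if_pos (by omega), sideOffset] at h1
        simp [hτ] at h1
        push_cast
        linarith

theorem OnStairs.side_end {v : V} {α β : ℝ} (h : OnStairs σ τ m v α β) (hα : 2 * m + 2 < α) :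
    (τ (σ v) = false → β ≤ α) ∧ (τ (σ v) = true → α ≤ β) := by
  rcases h with ⟨k, hk, h1, h2, rfl⟩ | ⟨j, hj, rfl, h1, h2⟩
  · have hkm : m < k := by exact_mod_cast (show (m : ℝ) < k by linarith)
    rw [levelExt_succ v hk, level, if_neg (by omega), if_neg (by omega), sideOffset]
    constructor <;> intro hτ <;> simp [hτ] <;> linarith
  · have hjm : m + 1 < j := by exact_mod_cast (show (m : ℝ) + 1 < j by linarith)
    constructor <;> intro hτ
    · rcases hj.lt_or_eq with hj' | rfl
      · rw [levelExt_succ v hj', level, if_neg (by omega), if_neg (by omega), sideOffset] at h2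
        simpa [hτ] using h2
      · rw [levelExt_last, halfSteps] at h2
        exact_mod_cast h2
    · obtain ⟨i, rfl⟩ : ∃ i, j = i + 1 := ⟨j - 1, by omega⟩
      rw [levelExt_succ v (by omega), level, if_neg (by omega), if_neg (by omega), sideOffset] at h1
      simp [hτ] at h1
      push_cast
      linarith

/-- The sum `α + β` grows without gaps along the staircase, so it serves as a parameter; the
induction runs over the vertical steps. -/
theorem exists_onStairs (v : V) {s : ℝ} (hs : 0 ≤ s) (hs' : s ≤ 2 * halfSteps m) :
    ∃ α β, OnStairs σ τ m v α β ∧ α + β = s := by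
  have key : ∀ j : ℕ, j ≤ 2 * m + 1 → s ≤ 2 * j + levelExt σ τ m v (j + 1) →
      ∃ α β, OnStairs σ τ m v α β ∧ α + β = s := by
    intro j
    induction j with
    | zero =>
      intro _ h
      exact ⟨0, s, Or.inr ⟨0, by omega, by simp, by simpa [levelExt] using hs,
        by simpa using h⟩, by simp⟩
    | succ j ih =>
      intro hj h
      push_cast at h
      by_cases h1 : s ≤ 2 * j + levelExt σ τ m v (j + 1)
      · exact ih (by omega) h1
      by_cases h2 : s ≤ 2 * j + 2 + levelExt σ τ m v (j + 1)
      · exact ⟨s - levelExt σ τ m v (j + 1), levelExt σ τ m v (j + 1),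
          Or.inl ⟨j, by omega, by linarith, by linarith, rfl⟩, by ring⟩
      · exact ⟨2 * ((j + 1 : ℕ) : ℝ), s - 2 * ((j + 1 : ℕ) : ℝ),
          Or.inr ⟨j + 1, hj, rfl, by push_cast; linarith, by push_cast; linarith⟩, by ring⟩
  refine key (2 * m + 1) le_rfl ?_
  rw [levelExt_last]
  have hK : ((halfSteps m : ℕ) : ℝ) = 2 * (2 * m + 1) := by simp [halfSteps]
  push_cast
  linarith

end Stairs

end KnotMosaic

namespace KnotMosaic

open Set Topology Filter

/-! ### Distances between formal points of a cycle -/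

section FormalNorm

set_option linter.unusedSectionVars false

variable {V : Type*} [Fintype V] [DecidableEq V] {σ : Equiv.Perm V}

theorem formalPt_apply (v u : V) (θ : ℝ) :
    formalPt σ v θ u = (1 - θ) * vert v u + θ * vert (σ v) u := by
  simp [formalPt, AffineMap.lineMap_apply_module']; ring

theorem norm_vert_sub_le (v w : V) : ‖(vert v - vert w : V → ℝ)‖ ≤ 2 := by
  have h : ∀ v : V, ‖(vert v : V → ℝ)‖ ≤ 1 := fun v =>
    norm_le_one_of_mem_segment (left_mem_segment ℝ (vert v) (vert v))
  exact (norm_sub_le _ _).trans (by linarith [h v, h w])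

theorem norm_formalPt_same_le (v : V) (θ η : ℝ) :
    ‖formalPt σ v θ - formalPt σ v η‖ ≤ 2 * |θ - η| := by
  have e : formalPt σ v θ - formalPt σ v η = (θ - η) • (vert (σ v) - vert v) := by
    simp only [formalPt, AffineMap.lineMap_apply_module']; module
  rw [e, norm_smul, Real.norm_eq_abs, mul_comm]
  gcongr
  exact norm_vert_sub_le _ _

theorem norm_formalPt_adj_le (v : V) {θ η : ℝ} (hθ : θ ≤ 1) (hη : 0 ≤ η) :
    ‖formalPt σ v θ - formalPt σ (σ v) η‖ ≤ 2 * (1 - θ + η) := by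
  have h1 := norm_formalPt_same_le (σ := σ) v θ 1
  have h2 := norm_formalPt_same_le (σ := σ) (σ v) 0 η
  rw [formalPt_one] at h1
  have := norm_sub_le_norm_sub_add_norm_sub (formalPt σ v θ) (formalPt σ (σ v) 0)
    (formalPt σ (σ v) η)
  rw [abs_of_nonpos (by linarith)] at h1 h2
  linarith

theorem abs_formalPt_sub_le (v w u : V) (θ η : ℝ) :
    |formalPt σ v θ u - formalPt σ w η u| ≤ ‖formalPt σ v θ - formalPt σ w η‖ :=
  norm_le_pi_norm (formalPt σ v θ - formalPt σ w η) u

variable (h1 : ∀ v, σ v ≠ v) (h2 : ∀ v, σ (σ v) ≠ v)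

include h1 in
theorem abs_sub_le_norm_formalPt_same (v : V) (θ η : ℝ) :
    |θ - η| ≤ ‖formalPt σ v θ - formalPt σ v η‖ := by
  have := abs_formalPt_sub_le (σ := σ) v v (σ v) θ η
  simpa [formalPt_apply, vert_apply_self, vert_apply_ne (h1 v)] using this

-- The coordinates at `v` and at `σ (σ v)` each belong to only one of the two consecutive edges, and
-- there the difference can be read off.
include h1 h2 in
theorem le_norm_formalPt_adj (v : V) (θ η : ℝ) :
    1 - θ ≤ ‖formalPt σ v θ - formalPt σ (σ v) η‖ ∧
      η ≤ ‖formalPt σ v θ - formalPt σ (σ v) η‖ := by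
  have e1 := abs_formalPt_sub_le (σ := σ) v (σ v) v θ η
  have e2 := abs_formalPt_sub_le (σ := σ) v (σ v) (σ (σ v)) θ η
  simp only [formalPt_apply, vert_apply_self, vert_apply_ne (h1 _).symm, vert_apply_ne (h2 v).symm,
    vert_apply_ne (h1 _), vert_apply_ne (h2 _)] at e1 e2
  have e1' := (le_abs_self _).trans e1
  have e2' := (neg_le_abs _).trans e2
  constructor <;> linarith

/-- The first point has coordinates `1 - θ` and `θ` at the ends of its edge, where the second point
has zeros; these two numbers have sum 1. -/
theorem le_norm_formalPt_far {v w : V} (ha : w ≠ v) (hb : w ≠ σ v) (hc : v ≠ σ w)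
    (h1 : ∀ v, σ v ≠ v) (θ η : ℝ) : 1 / 2 ≤ ‖formalPt σ v θ - formalPt σ w η‖ := by
  have e1 := abs_formalPt_sub_le (σ := σ) v w v θ η
  have e2 := abs_formalPt_sub_le (σ := σ) v w (σ v) θ η
  have hd : σ v ≠ σ w := fun h => ha (σ.injective h).symm
  simp only [formalPt_apply, vert_apply_self, vert_apply_ne (h1 _).symm, vert_apply_ne ha.symm,
    vert_apply_ne hc, vert_apply_ne (h1 _), vert_apply_ne hb.symm, vert_apply_ne hd] at e1 e2
  have e1' := (le_abs_self _).trans e1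
  have e2' := (le_abs_self _).trans e2
  linarith

end FormalNorm

/-! ### Deformation of the edges into fine staircases -/

section StairIsotopy

set_option linter.unusedSectionVars false

variable {V : Type*} [Fintype V] [DecidableEq V] (σ : Equiv.Perm V) (p : V → Space) (m : ℕ)

/-- The direction in which the staircases deviate from the edges. -/
noncomputable def sideDir (v : V) : Space := !₂[edgeDir σ p 0 v, -edgeDir σ p 1 v, 0]

/-- The point on the way from the edge to its staircase. -/
noncomputable def stairAt (t : ℝ) (v : V) (α β : ℝ) : Space :=
  edgePt σ p v ((α + β) / (2 * halfSteps m)) + t • ((α - β) / (2 * halfSteps m)) • sideDir σ p v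

/-- The point of the staircase with coordinates `α` and `β` in units of half steps. -/
noncomputable def stairPt (v : V) (α β : ℝ) : Space :=
  !₂[p v 0 + edgeDir σ p 0 v * (α / halfSteps m), p v 1 + edgeDir σ p 1 v * (β / halfSteps m),
    p v 2 + edgeDir σ p 2 v * ((α + β) / (2 * halfSteps m))]

variable {σ p m}

theorem halfSteps_pos : (0 : ℝ) < halfSteps m := by
  simp only [halfSteps]; push_cast; positivity

theorem cast_halfSteps : ((halfSteps m : ℕ) : ℝ) = 4 * m + 2 := by
  simp only [halfSteps]; push_cast; ring

theorem stairAt_zero (t : ℝ) (v : V) (α β : ℝ) : stairAt σ p m t v α β 0 =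
    p v 0 + edgeDir σ p 0 v * ((α + β) / (2 * halfSteps m) + t * ((α - β) / (2 * halfSteps m))) := by
  simp [stairAt, edgePt, lineMap_apply_coord, sideDir, edgeDir]; ring

theorem stairAt_one (t : ℝ) (v : V) (α β : ℝ) : stairAt σ p m t v α β 1 =
    p v 1 + edgeDir σ p 1 v * ((α + β) / (2 * halfSteps m) - t * ((α - β) / (2 * halfSteps m))) := by
  simp [stairAt, edgePt, lineMap_apply_coord, sideDir, edgeDir]; ring

theorem stairAt_two (t : ℝ) (v : V) (α β : ℝ) : stairAt σ p m t v α β 2 =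
    p v 2 + edgeDir σ p 2 v * ((α + β) / (2 * halfSteps m)) := by
  simp [stairAt, edgePt, lineMap_apply_coord, sideDir, edgeDir]; ring

/-- Adding and subtracting half of `α - β` turns the mean of `α` and `β` into `α` in the first
coordinate and into `β` in the second; the height remains linear in `α + β`. -/
theorem stairAt_eq_stairPt (v : V) (α β : ℝ) : stairAt σ p m 1 v α β = stairPt σ p m v α β := by
  have hK := (halfSteps_pos (m := m)).ne'
  refine space_ext ?_ ?_ ?_
  · rw [stairAt_zero]; simp [stairPt]; left; field_simp; ring
  · rw [stairAt_one]; simp [stairPt]; left; field_simp; ring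
  · rw [stairAt_two]; simp [stairPt]

theorem dist_coord_le (x y : Space) (i : Fin 3) : |x i - y i| ≤ dist x y := by
  rw [dist_eq_norm]; exact abs_apply_le_norm (x - y) i

variable {τ : V → Bool}

/-- The position along the edge and the deviation from it of a point of a staircase. -/
theorem OnStairs.params {v : V} {α β : ℝ} (h : OnStairs σ τ m v α β) :
    (α + β) / (2 * halfSteps m) ∈ Icc (0 : ℝ) 1 ∧
    |(α - β) / (2 * halfSteps m)| ≤ (α + β) / (2 * halfSteps m) ∧
    |(α - β) / (2 * halfSteps m)| ≤ 1 - (α + β) / (2 * halfSteps m) ∧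
    |(α - β) / (2 * halfSteps m)| ≤ 1 / halfSteps m := by
  have hK := halfSteps_pos (m := m)
  obtain ⟨h1, h2, h3, h4, h5⟩ := h.bounds
  rw [abs_div, abs_of_pos (show (0 : ℝ) < 2 * halfSteps m by positivity)]
  refine ⟨⟨by positivity, (div_le_one (by positivity)).2 (by linarith)⟩, ?_, ?_, ?_⟩
  · gcongr
    exact abs_le.2 ⟨by linarith, by linarith⟩
  · rw [div_le_iff₀ (by positivity), sub_mul, div_mul_cancel₀ _ (by positivity)]
    exact abs_le.2 ⟨by linarith, by linarith⟩
  · rw [div_le_div_iff₀ (by positivity) hK]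
    nlinarith

/-- The total size of the directions of deviation. -/
noncomputable def sideSum (σ : Equiv.Perm V) (p : V → Space) : ℝ := ∑ v, ‖sideDir σ p v‖

theorem norm_sideDir_le (v : V) : ‖sideDir σ p v‖ ≤ sideSum σ p :=
  Finset.single_le_sum (f := fun v => ‖sideDir σ p v‖) (fun _ _ => norm_nonneg _)
    (Finset.mem_univ v)

theorem sideSum_nonneg : 0 ≤ sideSum σ p := Finset.sum_nonneg fun _ _ => norm_nonneg _

/-- On one edge this is monotonicity of the staircase. On consecutive edges each deviation is at
most the parameter distance to the common vertex, hence at most the formal distance. On remote edges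
the formal distance is at least 1/2, while each of the two factors is at most 1/2. -/
theorem norm_deviation_sub_le (h1 : ∀ v, σ v ≠ v) (h2 : ∀ v, σ (σ v) ≠ v) {v w : V} {α β α' β' : ℝ}
    (h : OnStairs σ τ m v α β) (h' : OnStairs σ τ m w α' β') :
    ‖((α - β) / (2 * halfSteps m)) • sideDir σ p v - ((α' - β') / (2 * halfSteps m)) • sideDir σ p w‖ ≤
      4 * sideSum σ p * ‖formalPt σ v ((α + β) / (2 * halfSteps m)) -
        formalPt σ w ((α' + β') / (2 * halfSteps m))‖ := by
  have hK := halfSteps_pos (m := m)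
  obtain ⟨hθ, ha, hb, -⟩ := h.params
  obtain ⟨hη, ha', hb', -⟩ := h'.params
  have hS := sideSum_nonneg (σ := σ) (p := p)
  have hv := norm_sideDir_le (σ := σ) (p := p) v
  have hw := norm_sideDir_le (σ := σ) (p := p) w
  have htri : ‖((α - β) / (2 * halfSteps m)) • sideDir σ p v -
      ((α' - β') / (2 * halfSteps m)) • sideDir σ p w‖ ≤
      (|(α - β) / (2 * halfSteps m)| + |(α' - β') / (2 * halfSteps m)|) * sideSum σ p := by
    refine (norm_sub_le _ _).trans ?_
    rw [norm_smul, norm_smul, Real.norm_eq_abs, Real.norm_eq_abs, add_mul]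
    gcongr
  by_cases hvw : w = v
  · subst hvw
    have h3 := abs_sub_le_norm_formalPt_same h1 w ((α + β) / (2 * halfSteps m))
      ((α' + β') / (2 * halfSteps m))
    have h4 : |(α - β) / (2 * halfSteps m) - (α' - β') / (2 * halfSteps m)| ≤
        |(α + β) / (2 * halfSteps m) - (α' + β') / (2 * halfSteps m)| := by
      rw [div_sub_div_same, div_sub_div_same, abs_div, abs_div]
      gcongr ?_ / _
      refine sq_le_sq.1 ?_
      nlinarith [h.mul_nonneg h']
    rw [← sub_smul, norm_smul, Real.norm_eq_abs]
    have h5 := norm_nonneg (formalPt σ w ((α + β) / (2 * halfSteps m)) -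
        formalPt σ w ((α' + β') / (2 * halfSteps m)))
    calc _ ≤ ‖formalPt σ w ((α + β) / (2 * halfSteps m)) -
          formalPt σ w ((α' + β') / (2 * halfSteps m))‖ * sideSum σ p := by
            gcongr
            exact h4.trans h3
      _ ≤ _ := by nlinarith [mul_nonneg hS h5]
  refine htri.trans ?_
  by_cases hs : w = σ v
  · subst hs
    obtain ⟨h3, h4⟩ := le_norm_formalPt_adj h1 h2 v ((α + β) / (2 * halfSteps m))
      ((α' + β') / (2 * halfSteps m))
    have : |(α - β) / (2 * halfSteps m)| + |(α' - β') / (2 * halfSteps m)| ≤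
        4 * ‖formalPt σ v ((α + β) / (2 * halfSteps m)) -
        formalPt σ (σ v) ((α' + β') / (2 * halfSteps m))‖ := by
      linarith [abs_nonneg ((α - β) / (2 * halfSteps m))]
    nlinarith
  by_cases hs' : v = σ w
  · subst hs'
    obtain ⟨h3, h4⟩ := le_norm_formalPt_adj h1 h2 w ((α' + β') / (2 * halfSteps m))
      ((α + β) / (2 * halfSteps m))
    rw [norm_sub_rev] at h3 h4
    have : |(α - β) / (2 * halfSteps m)| + |(α' - β') / (2 * halfSteps m)| ≤
        4 * ‖formalPt σ (σ w) ((α + β) / (2 * halfSteps m)) -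
        formalPt σ w ((α' + β') / (2 * halfSteps m))‖ := by
      linarith [abs_nonneg ((α - β) / (2 * halfSteps m))]
    nlinarith
  · have h3 := le_norm_formalPt_far hvw hs hs' h1 ((α + β) / (2 * halfSteps m))
      ((α' + β') / (2 * halfSteps m))
    have : |(α - β) / (2 * halfSteps m)| + |(α' - β') / (2 * halfSteps m)| ≤
        4 * ‖formalPt σ v ((α + β) / (2 * halfSteps m)) -
        formalPt σ w ((α' + β') / (2 * halfSteps m))‖ := by
      linarith [hθ.1, hη.1]
    nlinarith

/-- The constants that control the deformation into staircases. -/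
structure StairBounds (σ : Equiv.Perm V) (p : V → Space) (τ : V → Bool) (c : ℝ) : Prop where
  pos : 0 < c
  apply_ne : ∀ v, σ v ≠ v
  apply_apply_ne : ∀ v, σ (σ v) ≠ v
  edge : ∀ v w, ∀ θ ∈ Icc (0 : ℝ) 1, ∀ η ∈ Icc (0 : ℝ) 1,
      c * ‖formalPt σ v θ - formalPt σ w η‖ ≤ ‖edgePt σ p v θ - edgePt σ p w η‖
  dir : ∀ v, c ≤ |edgeDir σ p 0 v| ∧ c ≤ |edgeDir σ p 1 v|
  side : ∀ v, ∀ A B A' B' : ℝ, 0 ≤ A → 0 ≤ B → 0 ≤ A' → 0 ≤ B' →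
      (τ (σ v) = false → A ≤ B ∧ B' ≤ A') → (τ (σ v) = true → B ≤ A ∧ A' ≤ B') →
      c * (A + B + A' + B') ≤ |edgeDir σ p 0 v * A + edgeDir σ p 0 (σ v) * A'| +
        |edgeDir σ p 1 v * B + edgeDir σ p 1 (σ v) * B'|

theorem IsGeneric.exists_stairBounds (h : IsGeneric σ p) : ∃ τ c, StairBounds σ p τ c := by
  have hne := h.embedded.apply_ne
  have hx : ∀ v, edgeDir σ p 0 v ≠ 0 := fun v => h.coord_zero.apply_ne (hne v)
  have hy : ∀ v, edgeDir σ p 1 v ≠ 0 := fun v => h.coord_one.apply_ne (hne v)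
  -- The side is found for the pair of edges that meet at `σ v`, so it is indexed by `v` here and
  -- has to be shifted by `σ.symm` to become a function of the vertex.
  choose τ c hc hτ using fun v => exists_side (hx v) (hy v) (hx (σ v)) (hy (σ v)) (h.cross v)
  obtain ⟨c₁, hc₁, hle₁⟩ := exists_pos_forall_le c hc
  obtain ⟨c₂, hc₂, hle₂⟩ := exists_pos_forall_le (fun v => |edgeDir σ p 0 v|) fun v =>
    abs_pos.2 (hx v)
  obtain ⟨c₃, hc₃, hle₃⟩ := exists_pos_forall_le (fun v => |edgeDir σ p 1 v|) fun v =>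
    abs_pos.2 (hy v)
  obtain ⟨c₄, hc₄, hle₄⟩ := h.embedded.exists_mul_le
  refine ⟨fun v => τ (σ.symm v), min (min c₁ c₂) (min c₃ c₄), by positivity, hne,
    h.embedded.apply_apply_ne, fun v w θ hθ η hη => ?_, fun v => ⟨?_, ?_⟩,
    fun v A B A' B' hA hB hA' hB' f1 f2 => ?_⟩
  · refine le_trans ?_ (hle₄ v w θ hθ η hη)
    gcongr
    exact (min_le_right _ _).trans (min_le_right _ _)
  · exact ((min_le_left _ _).trans (min_le_right _ _)).trans (hle₂ v)
  · exact ((min_le_right _ _).trans (min_le_left _ _)).trans (hle₃ v)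
  · simp only [Equiv.symm_apply_apply] at f1 f2
    refine le_trans ?_ (hτ v A B A' B' hA hB hA' hB' f1 f2)
    gcongr
    exact ((min_le_left _ _).trans (min_le_left _ _)).trans (hle₁ v)

/-- Close to the common vertex both staircases are on the chosen side, and `side` applies at all
times, since scaling the deviation by `t` preserves its sign. Otherwise the formal distance is at
least 1/6, and half of `c` times this distance pays for the deviations, which together are at most
`c / 12` by `hbig`. -/
theorem StairBounds.adj_le {c : ℝ} (hb : StairBounds σ p τ c) (hm : 1 ≤ m)
    (hbig : 24 * sideSum σ p ≤ c * halfSteps m) {t : ℝ} (ht : t ∈ Icc (0 : ℝ) 1)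
    {v : V} {α β α' β' : ℝ} (h : OnStairs σ τ m v α β) (h' : OnStairs σ τ m (σ v) α' β')
    (hfar : c * ‖formalPt σ v ((α + β) / (2 * halfSteps m)) -
        formalPt σ (σ v) ((α' + β') / (2 * halfSteps m))‖ - 2 * (sideSum σ p / halfSteps m) ≤
      dist (stairAt σ p m t v α β) (stairAt σ p m t (σ v) α' β')) :
    c / 2 * ‖formalPt σ v ((α + β) / (2 * halfSteps m)) -
        formalPt σ (σ v) ((α' + β') / (2 * halfSteps m))‖ ≤
      dist (stairAt σ p m t v α β) (stairAt σ p m t (σ v) α' β') := by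
  have hK := halfSteps_pos (m := m)
  have hc := hb.pos
  have hm' : (1 : ℝ) ≤ m := by exact_mod_cast hm
  obtain ⟨hθ, ha, hb1, -⟩ := h.params
  obtain ⟨hη, ha', hb1', -⟩ := h'.params
  obtain ⟨-, -, -, -, hd⟩ := h.bounds
  obtain ⟨-, -, -, -, hd'⟩ := h'.bounds
  have h24 : 2 * (sideSum σ p / halfSteps m) ≤ c / 12 := by
    rw [← mul_div_assoc, div_le_iff₀ hK]; linarith
  obtain ⟨hl1, hl2⟩ := le_norm_formalPt_adj hb.apply_ne hb.apply_apply_ne v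
    ((α + β) / (2 * halfSteps m)) ((α' + β') / (2 * halfSteps m))
  by_cases hA : 2 * m + 2 < α
  · by_cases hB : α' < 2 * m
    · -- both points are close to the common vertex
      have hside := h.side_end hA
      have hside' := h'.side_start hB
      have hup := norm_formalPt_adj_le (σ := σ) v hθ.2 hη.1
      have hx := dist_coord_le (stairAt σ p m t v α β) (stairAt σ p m t (σ v) α' β') 0
      have hy := dist_coord_le (stairAt σ p m t v α β) (stairAt σ p m t (σ v) α' β') 1
      rw [stairAt_zero, stairAt_zero] at hx
      rw [stairAt_one, stairAt_one] at hy
      have sgn : ∀ {x y : ℝ}, x ≤ y → 0 ≤ (y - x) / (2 * halfSteps m) := fun hxy =>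
        div_nonneg (sub_nonneg.2 hxy) (by positivity)
      have sgn' : ∀ {x y : ℝ}, y ≤ x → (y - x) / (2 * halfSteps m) ≤ 0 := fun hxy =>
        div_nonpos_of_nonpos_of_nonneg (sub_nonpos.2 hxy) (by positivity)
      set θ := (α + β) / (2 * halfSteps m)
      set η := (α' + β') / (2 * halfSteps m)
      set g := (α - β) / (2 * halfSteps m)
      set g' := (α' - β') / (2 * halfSteps m)
      have tg : |t * g| ≤ |g| := by
        rw [abs_mul, abs_of_nonneg ht.1]
        exact mul_le_of_le_one_left (abs_nonneg _) ht.2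
      have tg' : |t * g'| ≤ |g'| := by
        rw [abs_mul, abs_of_nonneg ht.1]
        exact mul_le_of_le_one_left (abs_nonneg _) ht.2
      have b1 := abs_le.1 tg
      have b2 := abs_le.1 tg'
      have key := hb.side v (1 - θ - t * g) (1 - θ + t * g) (η + t * g') (η - t * g')
        (by linarith) (by linarith) (by linarith) (by linarith)
        (fun hτ => by
          have := mul_nonneg ht.1 (sgn (hside.1 hτ))
          have := mul_nonneg ht.1 (sgn (hside'.1 hτ))
          constructor <;> linarith)
        (fun hτ => by
          have := mul_nonpos_of_nonneg_of_nonpos ht.1 (sgn' (hside.2 hτ))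
          have := mul_nonpos_of_nonneg_of_nonpos ht.1 (sgn' (hside'.2 hτ))
          constructor <;> linarith)
      have ex : p v 0 + edgeDir σ p 0 v * (θ + t * g) -
          (p (σ v) 0 + edgeDir σ p 0 (σ v) * (η + t * g')) =
          -(edgeDir σ p 0 v * (1 - θ - t * g) + edgeDir σ p 0 (σ v) * (η + t * g')) := by
        rw [show p (σ v) 0 = p v 0 + edgeDir σ p 0 v by simp [edgeDir]]; ring
      have ey : p v 1 + edgeDir σ p 1 v * (θ - t * g) -
          (p (σ v) 1 + edgeDir σ p 1 (σ v) * (η - t * g')) =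
          -(edgeDir σ p 1 v * (1 - θ + t * g) + edgeDir σ p 1 (σ v) * (η - t * g')) := by
        rw [show p (σ v) 1 = p v 1 + edgeDir σ p 1 v by simp [edgeDir]]; ring
      rw [ex, abs_neg] at hx
      rw [ey, abs_neg] at hy
      nlinarith
    -- From `α' ≥ 2m` and `|α' - β'| ≤ 2` the sum is at least `4m - 2`, which is at least one sixth
    -- of `8m + 4` because `m ≥ 1`.
    · have h6 : 1 / 6 ≤ (α' + β') / (2 * halfSteps m) := by
        rw [cast_halfSteps, div_le_div_iff₀ (by norm_num) (by positivity)]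
        have := abs_le.1 hd'
        linarith
      nlinarith
  · have h6 : 1 / 6 ≤ 1 - (α + β) / (2 * halfSteps m) := by
      have : (α + β) / (2 * halfSteps m) ≤ 5 / 6 := by
        rw [cast_halfSteps, div_le_div_iff₀ (by positivity) (by norm_num)]
        have := abs_le.1 hd
        linarith
      linarith
    nlinarith

/-- On one edge the nonzero directions in both coordinates suffice: the deviations cancel when the
two coordinate differences are added. Consecutive edges are left to `adj_le`. Remote edges are so
far apart that small deviations do not matter. -/
theorem StairBounds.le {c : ℝ} (hb : StairBounds σ p τ c) (hm : 1 ≤ m)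
    (hbig : 24 * sideSum σ p ≤ c * halfSteps m) {t : ℝ} (ht : t ∈ Icc (0 : ℝ) 1)
    {v w : V} {α β α' β' : ℝ} (h : OnStairs σ τ m v α β) (h' : OnStairs σ τ m w α' β') :
    c / 2 * ‖formalPt σ v ((α + β) / (2 * halfSteps m)) -
        formalPt σ w ((α' + β') / (2 * halfSteps m))‖ ≤
      dist (stairAt σ p m t v α β) (stairAt σ p m t w α' β') := by
  have hK := halfSteps_pos (m := m)
  have hc := hb.pos
  obtain ⟨hθ, ha, hb1, hs⟩ := h.params
  obtain ⟨hη, ha', hb1', hs'⟩ := h'.params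
  have hS := sideSum_nonneg (σ := σ) (p := p)
  have hsmall : ∀ {v : V} {g : ℝ}, |g| ≤ 1 / halfSteps m →
      ‖t • g • sideDir σ p v‖ ≤ sideSum σ p / halfSteps m := fun {v g} hg => by
    rw [norm_smul, norm_smul, Real.norm_of_nonneg ht.1, Real.norm_eq_abs]
    calc t * (|g| * ‖sideDir σ p v‖) ≤ 1 * (1 / halfSteps m * sideSum σ p) := by
          gcongr
          · exact ht.2
          · exact norm_sideDir_le v
      _ = _ := by ring
  -- Each deviation has length at most `sideSum σ p / halfSteps m`, so the bound for the edges
  -- survives up to twice this error.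
  have hfar : c * ‖formalPt σ v ((α + β) / (2 * halfSteps m)) -
        formalPt σ w ((α' + β') / (2 * halfSteps m))‖ - 2 * (sideSum σ p / halfSteps m) ≤
      dist (stairAt σ p m t v α β) (stairAt σ p m t w α' β') := by
    have h1 := hb.edge v w _ hθ _ hη
    have h2 := hsmall (v := v) hs
    have h3 := hsmall (v := w) hs'
    have e : edgePt σ p v ((α + β) / (2 * halfSteps m)) - edgePt σ p w ((α' + β') / (2 * halfSteps m)) =
      (stairAt σ p m t v α β - stairAt σ p m t w α' β') -
      (t • ((α - β) / (2 * halfSteps m)) • sideDir σ p v -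
       t • ((α' - β') / (2 * halfSteps m)) • sideDir σ p w) := by
      simp only [stairAt]; abel
    rw [e] at h1
    have h4 := norm_sub_le (stairAt σ p m t v α β - stairAt σ p m t w α' β')
      (t • ((α - β) / (2 * halfSteps m)) • sideDir σ p v -
       t • ((α' - β') / (2 * halfSteps m)) • sideDir σ p w)
    have h5 := norm_sub_le (t • ((α - β) / (2 * halfSteps m)) • sideDir σ p v)
       (t • ((α' - β') / (2 * halfSteps m)) • sideDir σ p w)
    rw [dist_eq_norm]
    linarith
  by_cases hvw : w = v
  · subst hvw
    have hup := norm_formalPt_same_le (σ := σ) w ((α + β) / (2 * halfSteps m))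
      ((α' + β') / (2 * halfSteps m))
    have hx := dist_coord_le (stairAt σ p m t w α β) (stairAt σ p m t w α' β') 0
    have hy := dist_coord_le (stairAt σ p m t w α β) (stairAt σ p m t w α' β') 1
    rw [stairAt_zero, stairAt_zero, add_sub_add_left_eq_sub, ← mul_sub, abs_mul] at hx
    rw [stairAt_one, stairAt_one, add_sub_add_left_eq_sub, ← mul_sub, abs_mul] at hy
    set θ := (α + β) / (2 * halfSteps m)
    set η := (α' + β') / (2 * halfSteps m)
    set g := (α - β) / (2 * halfSteps m)
    set g' := (α' - β') / (2 * halfSteps m)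
    obtain ⟨d1, d2⟩ := hb.dir w
    have hx' := (mul_le_mul_of_nonneg_right d1 (abs_nonneg (θ + t * g - (η + t * g')))).trans hx
    have hy' := (mul_le_mul_of_nonneg_right d2 (abs_nonneg (θ - t * g - (η - t * g')))).trans hy
    have hsum : 2 * |θ - η| ≤ |θ + t * g - (η + t * g')| + |θ - t * g - (η - t * g')| := by
      have e : 2 * (θ - η) = (θ + t * g - (η + t * g')) + (θ - t * g - (η - t * g')) := by ring
      have e' : 2 * |θ - η| = |2 * (θ - η)| := by rw [abs_mul, abs_two]
      rw [e', e]
      exact abs_add_le _ _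
    nlinarith
  by_cases hs1 : w = σ v
  · subst hs1
    exact hb.adj_le hm hbig ht h h' hfar
  by_cases hs2 : v = σ w
  · subst hs2
    rw [norm_sub_rev, dist_comm] at hfar ⊢
    exact hb.adj_le hm hbig ht h' h hfar
  · have h3 := le_norm_formalPt_far hvw hs1 hs2 hb.apply_ne ((α + β) / (2 * halfSteps m))
      ((α' + β') / (2 * halfSteps m))
    have h24 : 2 * (sideSum σ p / halfSteps m) ≤ c / 12 := by
      rw [← mul_div_assoc, div_le_iff₀ hK]; linarith
    nlinarith

/-- The union of the staircases. -/
def stairSet (σ : Equiv.Perm V) (p : V → Space) (τ : V → Bool) (m : ℕ) : Set Space :=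
  {x | ∃ v α β, OnStairs σ τ m v α β ∧ x = stairPt σ p m v α β}

/-- The constants of the generic polygon are fixed before `m`, so the steps can be made fine enough
for them. The final clause is the time 1 instance of the lower bound; it is what excludes crossings
in space later on. -/
theorem IsGeneric.exists_stairSet (h : IsGeneric σ p) : ∃ τ m, m ≠ 0 ∧
    AmbientIsotopic (cycleSet σ p) (stairSet σ p τ m) ∧
    ∀ v w α β α' β', OnStairs σ τ m v α β → OnStairs σ τ m w α' β' →
      stairPt σ p m v α β = stairPt σ p m w α' β' →
      formalPt σ v ((α + β) / (2 * halfSteps m)) = formalPt σ w ((α' + β') / (2 * halfSteps m)) := by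
  obtain ⟨τ, c, hb⟩ := h.exists_stairBounds
  have hc := hb.pos
  obtain ⟨m, hm⟩ := exists_nat_gt (24 * sideSum σ p / c + 1)
  have hS := sideSum_nonneg (σ := σ) (p := p)
  have hm1 : 1 ≤ m := by
    have : 0 ≤ 24 * sideSum σ p / c := by positivity
    exact_mod_cast (show (1 : ℝ) ≤ m by linarith)
  have hbig : 24 * sideSum σ p ≤ c * halfSteps m := by
    have h1 : 24 * sideSum σ p / c < halfSteps m := by
      rw [cast_halfSteps]; linarith [m.cast_nonneg (α := ℝ)]
    rw [div_lt_iff₀ hc] at h1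
    linarith
  refine ⟨τ, m, by omega, ?_, fun v w α β α' β' hv hw he => ?_⟩
  · let X := {z : V × ℝ × ℝ // OnStairs σ τ m z.1 z.2.1 z.2.2}
    have := ambientIsotopic_of_gauge (X := X)
      (fun z z' => ‖formalPt σ z.1.1 ((z.1.2.1 + z.1.2.2) / (2 * halfSteps m)) -
        formalPt σ z'.1.1 ((z'.1.2.1 + z'.1.2.2) / (2 * halfSteps m))‖)
      (fun z => edgePt σ p z.1.1 ((z.1.2.1 + z.1.2.2) / (2 * halfSteps m)))
      (fun z => ((z.1.2.1 - z.1.2.2) / (2 * halfSteps m)) • sideDir σ p z.1.1)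
      (4 * sideSum σ p) (fun _ _ => norm_nonneg _)
      (fun a b => by
        rw [dist_eq_norm]
        exact norm_deviation_sub_le h.embedded.apply_ne h.embedded.apply_apply_ne a.2 b.2)
      (fun t ht => ⟨c / 2, by positivity, fun a b => hb.le hm1 hbig ht a.2 b.2⟩)
    convert this using 1
    · ext x
      simp only [cycleSet, mem_iUnion, mem_range, segment_eq_image_lineMap]
      constructor
      · rintro ⟨v, θ, hθ, rfl⟩
        have hK := halfSteps_pos (m := m)
        obtain ⟨α, β, hst, he⟩ := exists_onStairs (σ := σ) (τ := τ) (m := m) v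
          (s := 2 * halfSteps m * θ) (by have := hθ.1; positivity)
          (by have := hθ.2; nlinarith)
        refine ⟨⟨(v, α, β), hst⟩, ?_⟩
        simp only [he]
        rw [mul_div_cancel_left₀ _ (by positivity)]
        rfl
      · rintro ⟨⟨⟨v, α, β⟩, hst⟩, rfl⟩
        exact ⟨v, _, hst.params.1, rfl⟩
    · ext x
      simp only [stairSet, mem_range]
      constructor
      · rintro ⟨v, α, β, hst, rfl⟩
        exact ⟨⟨(v, α, β), hst⟩, by rw [← stairAt_eq_stairPt]; simp [stairAt]⟩
      · rintro ⟨⟨⟨v, α, β⟩, hst⟩, rfl⟩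
        exact ⟨v, α, β, hst, by rw [← stairAt_eq_stairPt]; simp [stairAt]⟩
  · have h1 := hb.le hm1 hbig (t := 1) (by norm_num) hv hw
    rw [stairAt_eq_stairPt, stairAt_eq_stairPt, he, dist_self] at h1
    rw [← sub_eq_zero, ← norm_eq_zero]
    refine le_antisymm ?_ (norm_nonneg _)
    by_contra hcon
    have : 0 < c / 2 * ‖formalPt σ v ((α + β) / (2 * halfSteps m)) -
      formalPt σ w ((α' + β') / (2 * halfSteps m))‖ := mul_pos (by positivity) (not_le.1 hcon)
    linarith

end StairIsotopy

/-! ### Grid cycles -/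

section GridCycle

variable {W : Type*} (s : Equiv.Perm W) (x y zK zC : W → ℝ)

/-- The start of the horizontal segment `w`. -/
noncomputable def gridKey (w : W) : Space := !₂[x w, y w, zK w]

/-- The end of the horizontal segment `w`; here a vertical segment to the start of the horizontal
segment `s w` begins. -/
noncomputable def gridCorner (w : W) : Space := !₂[x (s w), y w, zC w]

/-- The union of the horizontal and vertical segments. -/
def gridSet : Set Space := ⋃ w, segment ℝ (gridKey x y zK w) (gridCorner s x y zC w) ∪
  segment ℝ (gridCorner s x y zC w) (gridKey x y zK (s w))

/-- A link that projects to a union of rectilinear polygons, with at most one segment on each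
horizontal and each vertical line. -/
structure IsGridCycle : Prop where
  apply_ne : ∀ w, s w ≠ w
  x_injective : Function.Injective x
  y_injective : Function.Injective y
  cross : ∀ w u, ∀ a ∈ Ioo (0 : ℝ) 1, ∀ b ∈ Ioo (0 : ℝ) 1,
    (AffineMap.lineMap (gridKey x y zK w) (gridCorner s x y zC w) a : Space) ≠
      AffineMap.lineMap (gridCorner s x y zC u) (gridKey x y zK (s u)) b

end GridCycle

/-! ### Staircases as grid cycles -/

section StairGrid

variable {V : Type*} (σ : Equiv.Perm V) (p : V → Space) (τ : V → Bool) (m : ℕ)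

/-- The cyclic order of the horizontal steps of the staircases. -/
def stairNext : Equiv.Perm (Fin (2 * m + 1) × V) :=
  Equiv.prodShear (Equiv.addRight 1) fun k => if k = Fin.last (2 * m) then σ else Equiv.refl V

variable {σ p τ m}

theorem stairNext_of_lt {k : Fin (2 * m + 1)} (hk : k.val < 2 * m) (v : V) :
    stairNext σ m (k, v) = (⟨k.val + 1, by omega⟩, v) := by
  have hne : k ≠ Fin.last (2 * m) := fun h => by
    rw [h, Fin.val_last] at hk; omega
  simp only [stairNext, Equiv.prodShear_apply, Equiv.coe_addRight, if_neg hne, Equiv.refl_apply]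
  refine Prod.ext (Fin.ext ?_) rfl
  simp only
  rw [Fin.val_add_one, if_neg hne]

theorem stairNext_last (v : V) : stairNext σ m (Fin.last (2 * m), v) = (0, σ v) := by
  simp [stairNext]

variable (σ p τ m)

/-- The abscissa of a horizontal step. -/
noncomputable def stairX (w : Fin (2 * m + 1) × V) : ℝ := stairPt σ p m w.2 (2 * (w.1 : ℕ))
  (level σ τ m w.2 w.1) 0

/-- The ordinate of a horizontal step. -/
noncomputable def stairY (w : Fin (2 * m + 1) × V) : ℝ := stairPt σ p m w.2 (2 * (w.1 : ℕ))
  (level σ τ m w.2 w.1) 1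

/-- The height of the start of a horizontal step. -/
noncomputable def stairZ (w : Fin (2 * m + 1) × V) : ℝ := stairPt σ p m w.2 (2 * (w.1 : ℕ))
  (level σ τ m w.2 w.1) 2

/-- The height of the end of a horizontal step. -/
noncomputable def stairZ' (w : Fin (2 * m + 1) × V) : ℝ := stairPt σ p m w.2 (2 * (w.1 : ℕ) + 2)
  (level σ τ m w.2 w.1) 2

variable {σ p τ m}

theorem stair_gridKey (w : Fin (2 * m + 1) × V) :
    gridKey (stairX σ p τ m) (stairY σ p τ m) (stairZ σ p τ m) w =
      stairPt σ p m w.2 (2 * (w.1 : ℕ)) (level σ τ m w.2 w.1) :=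
  space_ext rfl rfl rfl

theorem stairPt_end (v : V) : stairPt σ p m v (halfSteps m) (halfSteps m) = p (σ v) := by
  have hK := (halfSteps_pos (m := m)).ne'
  refine space_ext ?_ ?_ ?_
  · simp [stairPt, edgeDir, hK]
  · simp [stairPt, edgeDir, hK]
  · simp [stairPt, edgeDir]
    field_simp
    ring

theorem stairPt_start (v : V) : stairPt σ p m v 0 0 = p v := by
  refine space_ext ?_ ?_ ?_ <;> simp [stairPt]

/-- On the last step, the end of one edge and the start of the next have the same abscissa, so the
successor in the cyclic order is right there as well. -/
theorem stair_gridCorner (w : Fin (2 * m + 1) × V) :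
    gridCorner (stairNext σ m) (stairX σ p τ m) (stairY σ p τ m) (stairZ' σ p τ m) w =
      stairPt σ p m w.2 (2 * (w.1 : ℕ) + 2) (level σ τ m w.2 w.1) := by
  refine space_ext ?_ rfl rfl
  obtain ⟨k, v⟩ := w
  change stairX σ p τ m (stairNext σ m (k, v)) = _
  by_cases hk : k.val < 2 * m
  · rw [stairNext_of_lt hk]
    simp [stairX, stairPt]
    left; ring
  · obtain rfl : k = Fin.last (2 * m) := Fin.ext (by rw [Fin.val_last]; omega)
    rw [stairNext_last]
    have hK := (halfSteps_pos (m := m)).ne'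
    have e : 2 * (2 * (m : ℝ)) + 2 = halfSteps m := by rw [cast_halfSteps]; ring
    simp [stairX, stairPt, edgeDir, e, hK]

theorem lineMap_stairPt_h (v : V) (α α' β r : ℝ) :
    (AffineMap.lineMap (stairPt σ p m v α β) (stairPt σ p m v α' β) r : Space) =
      stairPt σ p m v (α + r * (α' - α)) β := by
  refine space_ext ?_ ?_ ?_ <;> rw [lineMap_apply_coord] <;> simp [stairPt] <;> ring

theorem lineMap_stairPt_v (v : V) (α β β' r : ℝ) :
    (AffineMap.lineMap (stairPt σ p m v α β) (stairPt σ p m v α β') r : Space) =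
      stairPt σ p m v α (β + r * (β' - β)) := by
  refine space_ext ?_ ?_ ?_ <;> rw [lineMap_apply_coord] <;> simp [stairPt] <;> ring

theorem onStairs_h (k : Fin (2 * m + 1)) (v : V) {r : ℝ} (hr : r ∈ Icc (0 : ℝ) 1) :
    OnStairs σ τ m v (2 * (k : ℕ) + r * (2 * (k : ℕ) + 2 - 2 * (k : ℕ))) (level σ τ m v k) := by
  refine Or.inl ⟨k, k.2, ?_, ?_, by rw [levelExt_succ v k.2]⟩
  · nlinarith [hr.1]
  · nlinarith [hr.2]

theorem cast_halfSteps' : ((halfSteps m : ℕ) : ℝ) = 2 * ((2 * m + 1 : ℕ) : ℝ) := by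
  rw [cast_halfSteps]; push_cast; ring

theorem level_zero_of_false {v : V} (h : τ v = false) : m ≠ 0 → level σ τ m v 0 = 0 := fun hm => by
  simp [level, Nat.pos_of_ne_zero hm, sideOffset, h]

theorem level_zero_of_true {v : V} (h : τ v = true) : m ≠ 0 → level σ τ m v 0 = 2 := fun hm => by
  simp [level, Nat.pos_of_ne_zero hm, sideOffset, h]

theorem level_last_of_true {v : V} (h : τ (σ v) = true) (hm : m ≠ 0) :
    level σ τ m v (2 * m) = halfSteps m := by
  rw [level, if_neg (by omega), if_neg (by omega), sideOffset, if_pos h, halfSteps]; ring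

/-- Every point of a vertical segment lies on a staircase, on a vertical step. -/
theorem exists_onStairs_v (hm : m ≠ 0) (w : Fin (2 * m + 1) × V) {r : ℝ} (hr : r ∈ Icc (0 : ℝ) 1) :
    ∃ v, ∃ i : ℕ, ∃ β, OnStairs σ τ m v (2 * (i : ℝ)) β ∧
      (AffineMap.lineMap (gridCorner (stairNext σ m) (stairX σ p τ m) (stairY σ p τ m)
        (stairZ' σ p τ m) w) (gridKey (stairX σ p τ m) (stairY σ p τ m) (stairZ σ p τ m)
        (stairNext σ m w)) r : Space) = stairPt σ p m v (2 * (i : ℝ)) β := by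
  rw [stair_gridCorner, stair_gridKey]
  obtain ⟨k, v⟩ := w
  by_cases hk : k.val < 2 * m
  · rw [stairNext_of_lt hk]
    refine ⟨v, k + 1, level σ τ m v k + r * (level σ τ m v (k + 1) - level σ τ m v k),
      Or.inr ⟨k + 1, by omega, rfl, ?_, ?_⟩, ?_⟩
    · rw [levelExt_succ v k.2]
      have : (level σ τ m v k : ℝ) ≤ level σ τ m v (k + 1) := by
        exact_mod_cast (level_lt_succ v k).le
      nlinarith [hr.1]
    · rw [levelExt_succ v (by omega)]
      have : (level σ τ m v k : ℝ) ≤ level σ τ m v (k + 1) := by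
        exact_mod_cast (level_lt_succ v k).le
      nlinarith [hr.2]
    · have e : ((k.val + 1 : ℕ) : ℝ) * 2 = 2 * (k.val : ℝ) + 2 := by push_cast; ring
      simp only
      rw [mul_comm, mul_comm 2 (((k.val + 1 : ℕ) : ℝ)), e, mul_comm, lineMap_stairPt_v]
  · obtain rfl : k = Fin.last (2 * m) := Fin.ext (by rw [Fin.val_last]; omega)
    rw [stairNext_last]
    simp only [Fin.val_last]
    have eα : 2 * (((2 * m : ℕ)) : ℝ) + 2 = halfSteps m := by rw [cast_halfSteps]; push_cast; ring
    rw [eα]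
    -- At a vertex exactly one staircase has a vertical step of positive length: the incoming one if
    -- the side is `false`, the outgoing one if it is `true`. So horizontal and vertical steps
    -- alternate also across vertices, and the connecting segment lies on a single staircase.
    cases hτ : τ (σ v)
    · have e0 : stairPt σ p m (σ v) (2 * ((0 : Fin (2 * m + 1)) : ℕ))
          (level σ τ m (σ v) ((0 : Fin (2 * m + 1)) : ℕ)) = stairPt σ p m v (halfSteps m) (halfSteps m) := by
        rw [stairPt_end]
        simp [level_zero_of_false hτ hm, stairPt_start]
      rw [e0]
      refine ⟨v, 2 * m + 1, level σ τ m v (2 * m) + r * (halfSteps m - level σ τ m v (2 * m)),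
        Or.inr ⟨2 * m + 1, le_rfl, rfl, ?_, ?_⟩, ?_⟩
      · rw [levelExt_succ v (by omega)]
        have := level_le (σ := σ) (τ := τ) (m := m) v (2 * m)
        have : (level σ τ m v (2 * m) : ℝ) ≤ halfSteps m := by
          rw [halfSteps]; exact_mod_cast (by omega)
        nlinarith [hr.1]
      · rw [levelExt_last]
        have := level_le (σ := σ) (τ := τ) (m := m) v (2 * m)
        have : (level σ τ m v (2 * m) : ℝ) ≤ halfSteps m := by
          rw [halfSteps]; exact_mod_cast (by omega)
        nlinarith [hr.2]
      · rw [← cast_halfSteps', lineMap_stairPt_v]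
    · rw [level_last_of_true hτ hm, stairPt_end, ← stairPt_start (σ := σ) (p := p) (m := m) (σ v)]
      simp only [Fin.val_zero, Nat.cast_zero, mul_zero]
      rw [level_zero_of_true hτ hm]
      refine ⟨σ v, 0, r * 2, Or.inr ⟨0, by omega, rfl, ?_, ?_⟩, ?_⟩
      · simpa [levelExt] using hr.1
      · rw [levelExt_succ _ (by omega), level_zero_of_true hτ hm]
        push_cast
        nlinarith [hr.2]
      · rw [lineMap_stairPt_v]
        simp

theorem stairSet_eq [Fintype V] [DecidableEq V] (hm : m ≠ 0) :
    stairSet σ p τ m = gridSet (stairNext σ m) (stairX σ p τ m) (stairY σ p τ m)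
      (stairZ σ p τ m) (stairZ' σ p τ m) := by
  have hv : ∀ v (k : ℕ) (hk : k < 2 * m) (β : ℝ), (level σ τ m v k : ℝ) ≤ β →
      β ≤ level σ τ m v (k + 1) → stairPt σ p m v (2 * ((k + 1 : ℕ) : ℝ)) β ∈
      gridSet (stairNext σ m) (stairX σ p τ m) (stairY σ p τ m) (stairZ σ p τ m)
        (stairZ' σ p τ m) := fun v k hk β h1 h2 => by
    refine mem_iUnion.2 ⟨(⟨k, by omega⟩, v), Or.inr ?_⟩
    have hlt : (level σ τ m v k : ℝ) < level σ τ m v (k + 1) := by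
      exact_mod_cast level_lt_succ v k
    rw [stair_gridCorner, stair_gridKey, stairNext_of_lt hk, segment_eq_image_lineMap]
    refine ⟨(β - level σ τ m v k) / (level σ τ m v (k + 1) - level σ τ m v k),
      ⟨div_nonneg (by linarith) (by linarith), (div_le_one (by linarith)).2 (by linarith)⟩, ?_⟩
    simp only
    rw [show 2 * (k : ℝ) + 2 = 2 * ((k + 1 : ℕ) : ℝ) by push_cast; ring, lineMap_stairPt_v,
      div_mul_cancel₀ _ (by linarith)]
    congr 1; ring
  apply Subset.antisymm
  · rintro _ ⟨v, α, β, hst, rfl⟩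
    rcases hst with ⟨k, hk, h1, h2, rfl⟩ | ⟨j, hj, rfl, h1, h2⟩
    · refine mem_iUnion.2 ⟨(⟨k, hk⟩, v), Or.inl ?_⟩
      rw [stair_gridCorner, stair_gridKey, segment_eq_image_lineMap]
      refine ⟨(α - 2 * k) / 2, ⟨by linarith, by linarith⟩, ?_⟩
      simp only
      rw [lineMap_stairPt_h, levelExt_succ v hk]
      congr 1; ring
    · rcases Nat.eq_zero_or_pos j with rfl | hjpos
      · rw [levelExt_succ _ (by omega)] at h2
        simp only [levelExt, Nat.cast_zero] at h1
        cases hτ : τ v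
        · rw [level_zero_of_false hτ hm, Nat.cast_zero] at h2
          obtain rfl : β = 0 := le_antisymm h2 h1
          refine mem_iUnion.2 ⟨(0, v), Or.inl ?_⟩
          rw [stair_gridKey]
          simp only [Fin.val_zero, level_zero_of_false hτ hm]
          simpa using left_mem_segment ℝ _ _
        · rw [level_zero_of_true hτ hm] at h2
          refine mem_iUnion.2 ⟨(Fin.last _, σ.symm v), Or.inr ?_⟩
          rw [stair_gridCorner, stair_gridKey, stairNext_last, segment_eq_image_lineMap]
          refine ⟨β / 2, ⟨by linarith, by push_cast at h2; linarith⟩, ?_⟩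
          simp only [Fin.val_last, Equiv.apply_symm_apply]
          rw [level_last_of_true (by simpa using hτ) hm,
            show 2 * (((2 * m : ℕ)) : ℝ) + 2 = halfSteps m by rw [cast_halfSteps]; push_cast; ring,
            stairPt_end, Equiv.apply_symm_apply, ← stairPt_start (σ := σ) (p := p) (m := m) v]
          simp only [Fin.val_zero, Nat.cast_zero, mul_zero]
          rw [level_zero_of_true hτ hm, lineMap_stairPt_v]
          congr 1
          push_cast; ring
      · obtain ⟨k, rfl⟩ : ∃ k, j = k + 1 := ⟨j - 1, by omega⟩
        rw [levelExt_succ _ (by omega)] at h1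
        rcases hj.lt_or_eq with hj' | hj'
        · rw [levelExt_succ _ hj'] at h2
          exact hv v k (by omega) β h1 h2
        · obtain rfl : k = 2 * m := by omega
          rw [levelExt_last] at h2
          refine mem_iUnion.2 ⟨(Fin.last _, v), Or.inr ?_⟩
          have eα : 2 * (((2 * m : ℕ)) : ℝ) + 2 = halfSteps m := by
            rw [cast_halfSteps]; push_cast; ring
          rw [stair_gridCorner, stair_gridKey, stairNext_last, ← cast_halfSteps']
          simp only [Fin.val_last]
          rw [eα]
          cases hτ : τ (σ v)
          · have e0 : stairPt σ p m (σ v) (2 * ((0 : Fin (2 * m + 1)) : ℕ))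
                (level σ τ m (σ v) ((0 : Fin (2 * m + 1)) : ℕ)) =
                stairPt σ p m v (halfSteps m) (halfSteps m) := by
              rw [stairPt_end]
              simp [level_zero_of_false hτ hm, stairPt_start]
            have hlt : (level σ τ m v (2 * m) : ℝ) < halfSteps m := by
              rw [level, if_neg (by omega), if_neg (by omega), sideOffset, hτ, halfSteps]
              push_cast
              simp
            rw [e0, segment_eq_image_lineMap]
            refine ⟨(β - level σ τ m v (2 * m)) / (halfSteps m - level σ τ m v (2 * m)),
              ⟨div_nonneg (by linarith) (by linarith), (div_le_one (by linarith)).2 (by linarith)⟩, ?_⟩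
            rw [lineMap_stairPt_v, div_mul_cancel₀ _ (by linarith)]
            congr 1; ring
          · rw [level_last_of_true hτ hm] at h1 ⊢
            obtain rfl : β = halfSteps m := le_antisymm h2 h1
            exact left_mem_segment _ _ _
  · intro z hz
    obtain ⟨w, hz | hz⟩ := mem_iUnion.1 hz
    · rw [stair_gridCorner, stair_gridKey, segment_eq_image_lineMap] at hz
      obtain ⟨r, hr, rfl⟩ := hz
      exact ⟨w.2, _, _, onStairs_h w.1 w.2 hr, lineMap_stairPt_h _ _ _ _ _⟩
    · rw [segment_eq_image_lineMap] at hz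
      obtain ⟨r, hr, rfl⟩ := hz
      obtain ⟨v, i, β, hst, he⟩ := exists_onStairs_v (σ := σ) (p := p) (τ := τ) hm w hr
      exact ⟨v, _, _, hst, he⟩

end StairGrid

/-- All steps sit at rational parameters of the edges, where generic coordinates take distinct
values; since genericity covers all rational parameters, it could be arranged before `m` was known.
-/
theorem IsGeneric.isGridCycle {V : Type*} [Fintype V] [DecidableEq V] {σ : Equiv.Perm V}
    {p : V → Space} {τ : V → Bool} {m : ℕ} (hm : m ≠ 0) (h : IsGeneric σ p)
    (hinj : ∀ v w α β α' β', OnStairs σ τ m v α β → OnStairs σ τ m w α' β' →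
      stairPt σ p m v α β = stairPt σ p m w α' β' →
      formalPt σ v ((α + β) / (2 * halfSteps m)) = formalPt σ w ((α' + β') / (2 * halfSteps m))) :
    IsGridCycle (stairNext σ m) (stairX σ p τ m) (stairY σ p τ m)
      (stairZ σ p τ m) (stairZ' σ p τ m) := by
  have hK := halfSteps_pos (m := m)
  refine ⟨?_, ?_, ?_, ?_⟩
  · rintro ⟨k, v⟩ he
    by_cases hk : k.val < 2 * m
    · rw [stairNext_of_lt hk] at he
      have := congrArg (fun z => z.1.val) he
      simp at this
    · obtain rfl : k = Fin.last (2 * m) := Fin.ext (by rw [Fin.val_last]; omega)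
      rw [stairNext_last] at he
      exact h.embedded.apply_ne v (congrArg Prod.snd he)
  · rintro ⟨k, v⟩ ⟨l, w⟩ he
    have hlt : ∀ k : Fin (2 * m + 1), (((2 * (k : ℕ) : ℚ) / halfSteps m : ℚ) : ℝ) ∈ Ico (0 : ℝ) 1 :=
      fun k => by
        push_cast
        refine ⟨by positivity, (div_lt_one hK).2 ?_⟩
        rw [cast_halfSteps']
        have : (k.val : ℝ) < ((2 * m + 1 : ℕ) : ℝ) := by exact_mod_cast k.2
        linarith
    obtain ⟨rfl, hkl⟩ := h.coord_zero v w ((2 * (k : ℕ) : ℚ) / halfSteps m)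
      ((2 * (l : ℕ) : ℚ) / halfSteps m) (hlt k) (hlt l) (by
        simp only [stairX, stairPt, edgeDir] at he
        simp only [coord]
        push_cast
        simp at he
        linarith)
    rw [div_left_inj' (by exact_mod_cast hK.ne')] at hkl
    have : k.val = l.val := by
      have : (k.val : ℚ) = l.val := by linarith
      exact_mod_cast this
    rw [Fin.ext this]
  · -- the ordinates of the horizontal steps as ordinates of rational points on the edges
    have hrep : ∀ w : Fin (2 * m + 1) × V, ∃ v : V, ∃ b : ℚ, (b : ℝ) ∈ Ico (0 : ℝ) 1 ∧
        stairY σ p τ m w = coord p 1 v + b * (coord p 1 (σ v) - coord p 1 v) ∧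
        ((level σ τ m w.2 w.1 < halfSteps m ∧ v = w.2 ∧ b = (level σ τ m w.2 w.1 : ℚ) / halfSteps m) ∨
          (w.1 = Fin.last (2 * m) ∧ τ (σ w.2) = true ∧ v = σ w.2 ∧ b = 0)) := by
      rintro ⟨k, v⟩
      by_cases hlt : level σ τ m v k < halfSteps m
      · refine ⟨v, (level σ τ m v k : ℚ) / halfSteps m, ?_, ?_, Or.inl ⟨hlt, rfl, rfl⟩⟩
        · push_cast
          exact ⟨by positivity, (div_lt_one hK).2 (by exact_mod_cast hlt)⟩
        · simp [stairY, stairPt, coord, edgeDir]; ring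
      · have hlast : k = Fin.last (2 * m) ∧ τ (σ v) = true := by
          rw [not_lt, halfSteps] at hlt
          have h1 := level_le (σ := σ) (τ := τ) (m := m) v k
          have h2 : k.val = 2 * m := by have := k.2; omega
          refine ⟨Fin.ext (by rw [Fin.val_last]; exact h2), ?_⟩
          by_contra hτ
          rw [level, if_neg (by omega), if_neg (by omega), sideOffset, if_neg hτ] at hlt
          omega
        obtain ⟨rfl, hτ⟩ := hlast
        refine ⟨σ v, 0, by norm_num, ?_, Or.inr ⟨rfl, hτ, rfl, rfl⟩⟩
        simp only [stairY, Fin.val_last, level_last_of_true hτ hm]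
        simp [stairPt, coord, edgeDir, hK.ne']
    rintro ⟨k, v⟩ ⟨l, w⟩ he
    obtain ⟨v', b, hb, e1, h1⟩ := hrep (k, v)
    obtain ⟨w', b', hb', e2, h2⟩ := hrep (l, w)
    rw [e1, e2] at he
    obtain ⟨rfl, rfl⟩ := h.coord_one v' w' b b' hb hb' he
    simp only at h1 h2
    have hpos : ∀ (v : V) (k : Fin (2 * m + 1)), τ v = true → level σ τ m v k ≠ 0 := fun v k hτ h0 => by
      have h3 := two_mul_le_level (σ := σ) (τ := τ) (m := m) v k
      have h4 : k.val = 0 := by omega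
      rw [h4, level_zero_of_true hτ hm] at h0
      omega
    have hz : ∀ n : ℕ, (0 : ℚ) = (n : ℚ) / halfSteps m → n = 0 := fun n h0 => by
      rw [eq_comm, div_eq_zero_iff] at h0
      rcases h0 with h0 | h0
      · exact_mod_cast h0
      · exact absurd h0 (by exact_mod_cast hK.ne')
    rcases h1 with ⟨-, rfl, h1⟩ | ⟨rfl, hτ, rfl, h1⟩
    · rcases h2 with ⟨-, rfl, h2⟩ | ⟨rfl, hτ', hw, h2⟩
      · rw [h1, div_left_inj' (by exact_mod_cast hK.ne')] at h2
        have : level σ τ m v' k = level σ τ m v' l := by exact_mod_cast h2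
        rw [Fin.ext ((level_strictMono v').injective this)]
      · rw [h2] at h1
        exact absurd (hz _ h1) (hpos v' k (hw ▸ hτ'))
    · rcases h2 with ⟨-, hw, h2⟩ | ⟨rfl, hτ', hw, h2⟩
      · rw [h1] at h2
        exact absurd (hz _ h2) (hpos w l (hw ▸ hτ))
      · rw [σ.injective hw]
  · rintro ⟨k, v⟩ u a ha b hb he
    obtain ⟨v', i, β, hst, e⟩ := exists_onStairs_v (σ := σ) (p := p) (τ := τ) hm u ⟨hb.1.le, hb.2.le⟩
    rw [e, stair_gridKey, stair_gridCorner, lineMap_stairPt_h] at he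
    have hst' := onStairs_h (σ := σ) (τ := τ) k v ⟨ha.1.le, ha.2.le⟩
    have hf := hinj _ _ _ _ _ _ hst' hst he
    have hα1 : 0 < 2 * ((k : ℕ) : ℝ) + a * (2 * (k : ℕ) + 2 - 2 * (k : ℕ)) := by
      have := ha.1
      have : (0 : ℝ) ≤ (k : ℕ) := by positivity
      nlinarith
    have hα2 : 2 * ((k : ℕ) : ℝ) + a * (2 * (k : ℕ) + 2 - 2 * (k : ℕ)) < halfSteps m := by
      rw [cast_halfSteps']
      have : (k.val : ℝ) + 1 ≤ ((2 * m + 1 : ℕ) : ℝ) := by exact_mod_cast k.2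
      nlinarith [ha.2]
    have hbd := hst'.bounds
    have hθ := hst'.params.1
    have hη := hst.params.1
    have hθ' : (2 * ((k : ℕ) : ℝ) + a * (2 * (k : ℕ) + 2 - 2 * (k : ℕ)) + level σ τ m v k) /
        (2 * halfSteps m) ∈ Ioo (0 : ℝ) 1 :=
      ⟨by have := hbd.2.2.1; positivity, (div_lt_one (by positivity)).2 (by linarith [hbd.2.2.2.1])⟩
    rcases hη.2.eq_or_lt with h1 | h1
    · rw [h1, formalPt_one] at hf
      have := (h.embedded.formalPt_inj ⟨hθ.1, hθ'.2⟩ ⟨le_rfl, one_pos⟩ hf).2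
      exact hθ'.1.ne' this
    · obtain ⟨rfl, h2⟩ := h.embedded.formalPt_inj ⟨hθ.1, hθ'.2⟩ ⟨hη.1, h1⟩ hf
      rw [div_left_inj' (by positivity)] at h2
      -- Equal sums on a monotone staircase force equal `α`. A vertical step has `α = 2 * i`,
      -- whereas interior points of the horizontal step `k` lie strictly between `2 * k` and `2 * k
      -- + 2`.
      have h3 := hst'.mul_nonneg hst
      set α := 2 * ((k : ℕ) : ℝ) + a * (2 * (k : ℕ) + 2 - 2 * (k : ℕ)) with hα
      have h4 : α = 2 * (i : ℝ) := by
        have : (level σ τ m v k : ℝ) - β = -(α - 2 * i) := by linarith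
        rw [this] at h3
        have : (α - 2 * i) ^ 2 ≤ 0 := by nlinarith
        have := pow_eq_zero_iff two_ne_zero |>.1 (le_antisymm this (sq_nonneg _))
        linarith
      have h5 : (k.val : ℝ) < i := by nlinarith [ha.1]
      have h6 : (i : ℝ) < (k.val : ℝ) + 1 := by nlinarith [ha.2]
      have h5' : k.val < i := by exact_mod_cast h5
      have h6' : i < k.val + 1 := by exact_mod_cast h6
      omega

/-- Every tame link is ambient isotopic to a link with a grid diagram. -/
theorem IsPolygonalLink.exists_gridCycle {L : Set Space} (hL : IsPolygonalLink L) :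
    ∃ (W : Type) (_ : Fintype W) (_ : Nonempty W) (s : Equiv.Perm W)
      (x y zK zC : W → ℝ), IsGridCycle s x y zK zC ∧ AmbientIsotopic L (gridSet s x y zK zC) := by
  obtain ⟨V, _, _, _, σ, p, hp, rfl⟩ := hL.exists_cycle
  obtain ⟨q, hq, hpq⟩ := hp.exists_generic
  obtain ⟨τ, m, hm, hiso, hinj⟩ := hq.exists_stairSet
  refine ⟨Fin (2 * m + 1) × V, inferInstance, inferInstance, _, _, _, _, _,
    hq.isGridCycle hm hinj, ?_⟩
  rw [← stairSet_eq hm]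
  exact hpq.trans hiso

end KnotMosaic

namespace KnotMosaic

open Set

/-! ### Tiles and their connection points -/

/-- The abscissa of the connection points of a traditional tile. -/
def sideX : Fin 4 → ℤ := ![1, 0, -1, 0]

/-- The ordinate of the connection points of a traditional tile. -/
def sideY : Fin 4 → ℤ := ![0, 1, 0, -1]

theorem sidePoint_eq (k : Fin 4) : sidePoint k = ((sideX k : ℝ), (sideY k : ℝ)) := by
  fin_cases k <;> simp [sidePoint, sideX, sideY]

theorem place_zero {n : ℕ} (i j : Fin n) (q : ℝ × ℝ) (z : ℝ) :
    place i j q z 0 = 2 * ((j : ℕ) : ℝ) + q.1 := by simp [place]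

theorem place_one {n : ℕ} (i j : Fin n) (q : ℝ × ℝ) (z : ℝ) :
    place i j q z 1 = -2 * ((i : ℕ) : ℝ) + q.2 := by simp [place]

theorem place_two {n : ℕ} (i j : Fin n) (q : ℝ × ℝ) (z : ℝ) : place i j q z 2 = z := by
  simp [place]

theorem place_sidePoint_eq_iff {n : ℕ} (i j i' j' : Fin n) (k l : Fin 4) :
    place i j (sidePoint k) 0 = place i' j' (sidePoint l) 0 ↔
      2 * (j.val : ℤ) + sideX k = 2 * j'.val + sideX l ∧
        -2 * (i.val : ℤ) + sideY k = -2 * i'.val + sideY l := by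
  constructor
  · intro h
    have h0 := congrArg (fun x : Space => x 0) h
    have h1 := congrArg (fun x : Space => x 1) h
    simp only [place_zero, place_one, sidePoint_eq] at h0 h1
    exact ⟨by exact_mod_cast h0, by exact_mod_cast h1⟩
  · rintro ⟨h0, h1⟩
    refine space_ext ?_ ?_ ?_
    · simp only [place_zero, sidePoint_eq]; exact_mod_cast h0
    · simp only [place_one, sidePoint_eq]; exact_mod_cast h1
    · simp only [place_two]

/-- The tile without double arcs that has given connection points; `o` says whether in a crossing
the horizontal strand passes over the vertical one. -/
def tileOf (c : Fin 4 → Bool) (o : Bool) : Tile :=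
  match c 0, c 1, c 2, c 3 with
  | true, true, true, true => if o then .T10 else .T9
  | true, false, true, false => .T5
  | false, true, false, true => .T6
  | true, true, false, false => .T3
  | false, true, true, false => .T4
  | false, false, true, true => .T1
  | true, false, false, true => .T2
  | _, _, _, _ => .T0

/-- The connection points allow a drawing with one strand, two crossing strands or none. -/
def IsBalanced (c : Fin 4 → Bool) : Prop := (c 0 = c 2 ∧ c 1 = c 3) ∨ (c 0 ≠ c 2 ∧ c 1 ≠ c 3)

theorem IsBalanced.eq_cases {c : Fin 4 → Bool} (h : IsBalanced c) :
    c ∈ [![true, true, true, true], ![true, false, true, false], ![false, true, false, true],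
      ![true, true, false, false], ![false, true, true, false], ![false, false, true, true],
      ![true, false, false, true], ![false, false, false, false]] := by
  have hc : c = ![c 0, c 1, c 2, c 3] := by
    funext k; fin_cases k <;> rfl
  rw [hc]
  unfold IsBalanced at h
  revert h
  generalize c 0 = a
  generalize c 1 = b
  generalize c 2 = d
  generalize c 3 = e
  revert a b d e
  decide

theorem isConnection_tileOf {c : Fin 4 → Bool} (h : IsBalanced c) (o : Bool) (k : Fin 4) :
    (tileOf c o).IsConnection k ↔ c k = true := by
  have hc := h.eq_cases
  simp only [List.mem_cons, List.not_mem_nil, or_false] at hc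
  rcases hc with rfl | rfl | rfl | rfl | rfl | rfl | rfl | rfl <;> cases o <;> fin_cases k <;>
    simp [tileOf, Tile.IsConnection, Tile.strands, Strand.first, Strand.last]

/-- The position of the middle points of the strands. -/
noncomputable def midPoint (c : Fin 4 → Bool) : ℝ × ℝ :=
  (((if c 0 then 1 else 0) - (if c 2 then 1 else 0)) / 4,
    ((if c 1 then 1 else 0) - (if c 3 then 1 else 0)) / 4)

/-- Whether the strand through the connection point `k` counts as vertical. -/
def isVert (c : Fin 4 → Bool) (k : Fin 4) : Bool := (k.val % 2 == 1) && (c 0 == c 2)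

/-- The height of the middle point of the horizontal (`false`) or vertical (`true`) strand. -/
noncomputable def midHeight (c : Fin 4 → Bool) (o v : Bool) : ℝ :=
  if c 0 && c 1 && c 2 && c 3 && (o != v) then 1 else 0

/-- Cutting each strand at its middle point gives one half strand per connection point, a
description uniform in the tile. Only a crossing needs two middle points over the same place, told
apart by `isVert`. -/
theorem iUnion_curve_tileOf {n : ℕ} (i j : Fin n) {c : Fin 4 → Bool} (h : IsBalanced c) (o : Bool) :
    ⋃ s ∈ (tileOf c o).strands, s.curve sidePoint i j =
      ⋃ k : Fin 4, ⋃ _ : c k = true, segment ℝ (place i j (midPoint c) (midHeight c o (isVert c k)))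
        (place i j (sidePoint k) 0) := by
  have hc := h.eq_cases
  have e4 : ∀ f : Fin 4 → Set Space, ⋃ k, f k = f 0 ∪ f 1 ∪ f 2 ∪ f 3 := fun f => by
    ext z; simp [Fin.exists_fin_succ]; tauto
  simp only [List.mem_cons, List.not_mem_nil, or_false] at hc
  have hseg : ∀ k q z, segment ℝ (place i j (sidePoint k) 0) (place i j q z) =
      segment ℝ (place i j q z) (place i j (sidePoint k) 0) := fun _ _ _ => segment_symm ℝ _ _
  have hz : (0 : ℝ × ℝ) = (0, 0) := rfl
  have h01 : (4⁻¹ : ℝ) • sidePoint 0 + (4⁻¹ : ℝ) • sidePoint 1 = (4⁻¹, 4⁻¹) := by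
    ext <;> simp [sidePoint]
  have h12 : (4⁻¹ : ℝ) • sidePoint 1 + (4⁻¹ : ℝ) • sidePoint 2 = (-1 / 4, 4⁻¹) := by
    ext <;> simp [sidePoint]; norm_num
  have h23 : (4⁻¹ : ℝ) • sidePoint 2 + (4⁻¹ : ℝ) • sidePoint 3 = (-1 / 4, -1 / 4) := by
    ext <;> simp [sidePoint] <;> norm_num
  have h30 : (4⁻¹ : ℝ) • sidePoint 3 + (4⁻¹ : ℝ) • sidePoint 0 = (4⁻¹, -1 / 4) := by
    ext <;> simp [sidePoint]; norm_num
  rcases hc with rfl | rfl | rfl | rfl | rfl | rfl | rfl | rfl <;> cases o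
  all_goals
    rw [e4]
    simp [tileOf, Tile.strands, Strand.curve, Strand.first, Strand.last, Strand.mid,
      Strand.height, midPoint, midHeight, isVert, Fin.isValue]
  all_goals
    ext z
    simp only [hz, h01, h12, h23, h30, hseg, mem_union] <;> tauto

/-! ### Charts that give the segments of a grid cycle integer positions -/

/-- An injective function on a finite type takes its values at the even positions of a strictly
monotone sequence. -/
theorem exists_strictMono_int {W : Type*} [Fintype W] [Nonempty W] {x : W → ℝ}
    (hx : Function.Injective x) :
    ∃ (col : W ≃ Fin (Fintype.card W)) (X : ℤ → ℝ), StrictMono X ∧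
      ∀ w, X (2 * ((col w : ℕ) : ℤ)) = x w := by
  classical
  let _ : LinearOrder W := LinearOrder.lift' x hx
  have hlt : ∀ v w : W, v < w → x v < x w := fun v w h => h
  obtain ⟨n, hn⟩ : ∃ n, Fintype.card W = n + 1 := ⟨Fintype.card W - 1, by
    have := Fintype.card_pos (α := W); omega⟩
  rw [hn]
  let e : Fin (n + 1) ≃o W := Fintype.orderIsoFinOfCardEq W hn
  -- The sorted values are extended by constants; `g` adds a linear term outside the range to become
  -- strictly monotone. In the end the values go to the even integers, and means of neighbours fill
  -- the odd ones.
  let f : ℤ → ℝ := fun k => x (e ⟨min k.toNat n, by omega⟩)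
  let g : ℤ → ℝ := fun k => f k + (k - max 0 (min k n) : ℤ)
  have hg : StrictMono g := by
    refine strictMono_int_of_lt_succ fun k => ?_
    by_cases hk : 0 ≤ k ∧ k < n
    · have h1 : f k < f (k + 1) := hlt _ _ (e.strictMono (by simp only [Fin.mk_lt_mk]; omega))
      have h2 : k - max 0 (min k n) = 0 := by omega
      have h3 : k + 1 - max 0 (min (k + 1) n) = 0 := by omega
      simp only [g, h2, h3]
      linarith
    · have h1 : f k = f (k + 1) := by
        simp only [f]
        congr 3
        omega
      have h2 : k - max 0 (min k n) < k + 1 - max 0 (min (k + 1) n) := by omega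
      have h3 : ((k - max 0 (min k n) : ℤ) : ℝ) < (k + 1 - max 0 (min (k + 1) n) : ℤ) := by
        exact_mod_cast h2
      simp only [g]
      linarith
  refine ⟨e.symm.toEquiv, fun a => (g (a / 2) + g ((a + 1) / 2)) / 2, ?_, fun w => ?_⟩
  · refine strictMono_int_of_lt_succ fun a => ?_
    have h2 : a / 2 ≤ (a + 1) / 2 := by omega
    have h3 : (a + 1) / 2 ≤ (a + 1 + 1) / 2 := by omega
    have h4 : a / 2 < (a + 1 + 1) / 2 := by omega
    linarith [hg h4]
  · obtain ⟨k, rfl⟩ := e.surjective w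
    have h1 : (2 * ((k : ℕ) : ℤ)) / 2 = (k : ℕ) := by omega
    have h2 : (2 * ((k : ℕ) : ℤ) + 1) / 2 = (k : ℕ) := by omega
    have h3 : ((k : ℕ) : ℤ) - max 0 (min ((k : ℕ) : ℤ) n) = 0 := by omega
    have h4 : f (k : ℕ) = x (e k) := by
      simp only [f]
      congr 2
      exact Fin.ext (by simp; omega)
    have h5 : g (k : ℕ) = x (e k) := by simp only [g, h3, h4, Int.cast_zero, add_zero]
    change (g (2 * ((e.symm (e k) : ℕ) : ℤ) / 2) + g ((2 * ((e.symm (e k) : ℕ) : ℤ) + 1) / 2)) / 2 = _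
    rw [e.symm_apply_apply, h1, h2, h5, add_self_div_two]

/-- The two half-open intervals between `p` and `q` differ only in the end points: a segment uses
both or neither of the opposite sides of a tile unless it ends there. -/
theorem half_open_iff {p q : ℤ} (hpq : p ≠ q) {a : ℤ} :
    ((min p q ≤ a ∧ a < max p q) ↔ (min p q < a ∧ a ≤ max p q)) ↔ ¬ (a = p ∨ a = q) := by
  rcases lt_or_gt_of_ne hpq with h | h
  · rw [min_eq_left h.le, max_eq_right h.le]
    constructor
    · intro hi hpa
      have := hi.1
      have := hi.2
      omega
    · intro hne
      constructor <;> omega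
  · rw [min_eq_right h.le, max_eq_left h.le]
    constructor
    · intro hi hpa
      have := hi.1
      have := hi.2
      omega
    · intro hne
      constructor <;> omega

/-- Integer positions for the vertical and horizontal segments. -/
structure GridChart {W : Type*} (x y : W → ℝ) (n : ℕ) where
  /-- The column of a vertical segment. -/
  col : W ≃ Fin n
  /-- The row of a horizontal segment. -/
  row : W ≃ Fin n
  /-- The abscissa of an integer position. -/
  X : ℤ → ℝ
  /-- The ordinate of an integer position. -/
  Y : ℤ → ℝ
  strictMono_X : StrictMono X
  strictMono_Y : StrictMono Y
  X_col : ∀ w, X (2 * ((col w : ℕ) : ℤ)) = x w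
  Y_row : ∀ w, Y (-2 * ((row w : ℕ) : ℤ)) = y w

theorem IsGridCycle.nonempty_gridChart {W : Type*} [Fintype W] [Nonempty W] {s : Equiv.Perm W}
    {x y zK zC : W → ℝ} (h : IsGridCycle s x y zK zC) :
    Nonempty (GridChart x y (Fintype.card W)) := by
  obtain ⟨col, X, hX, hc⟩ := exists_strictMono_int h.x_injective
  -- Rows are numbered downwards, so it is the negatives of the ordinates that are sorted.
  obtain ⟨row, Y, hY, hr⟩ := exists_strictMono_int (x := fun w => -y w)
    fun v w hvw => h.y_injective (neg_injective hvw)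
  exact ⟨⟨col, row, X, fun b => -Y (-b), hX, fun a b hab => neg_lt_neg (hY (neg_lt_neg hab)), hc,
    fun w => by rw [neg_mul, neg_neg, hr, neg_neg]⟩⟩

namespace GridChart

variable {W : Type*} {x y : W → ℝ} {n : ℕ} (G : GridChart x y n)

/-- The integer abscissa of a vertical segment. -/
def cx (w : W) : ℤ := 2 * (G.col w : ℕ)

/-- The integer ordinate of a horizontal segment. -/
def cy (w : W) : ℤ := -2 * (G.row w : ℕ)

theorem X_cx (w : W) : G.X (G.cx w) = x w := G.X_col w

theorem Y_cy (w : W) : G.Y (G.cy w) = y w := G.Y_row w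

theorem cx_inj {v w : W} : G.cx v = G.cx w ↔ v = w :=
  ⟨fun h => G.col.injective (Fin.ext (by unfold cx at h; omega)), fun h => h ▸ rfl⟩

theorem cy_inj {v w : W} : G.cy v = G.cy w ↔ v = w :=
  ⟨fun h => G.row.injective (Fin.ext (by unfold cy at h; omega)), fun h => h ▸ rfl⟩

theorem cx_col_symm (j : Fin n) : G.cx (G.col.symm j) = 2 * (j : ℕ) := by simp [cx]

theorem cy_row_symm (i : Fin n) : G.cy (G.row.symm i) = -2 * (i : ℕ) := by simp [cy]

/-- The vertical segment at an even abscissa. -/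
noncomputable def atCol [Nonempty W] (a : ℤ) : W := Function.invFun G.cx a

/-- The horizontal segment at an even ordinate. -/
noncomputable def atRow [Nonempty W] (b : ℤ) : W := Function.invFun G.cy b

theorem atCol_cx [Nonempty W] (w : W) : G.atCol (G.cx w) = w :=
  Function.leftInverse_invFun (fun _ _ h => G.cx_inj.1 h) w

theorem atRow_cy [Nonempty W] (w : W) : G.atRow (G.cy w) = w :=
  Function.leftInverse_invFun (fun _ _ h => G.cy_inj.1 h) w

variable (s : Equiv.Perm W)

/-- The directions in which the grid cycle leaves the point where the vertical segment `u` and the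
horizontal segment `w`, or the lines through them, cross. -/
def conn (w u : W) : Fin 4 → Bool :=
  ![decide (min (G.cx w) (G.cx (s w)) ≤ G.cx u ∧ G.cx u < max (G.cx w) (G.cx (s w))),
    decide (min (G.cy (s.symm u)) (G.cy u) ≤ G.cy w ∧ G.cy w < max (G.cy (s.symm u)) (G.cy u)),
    decide (min (G.cx w) (G.cx (s w)) < G.cx u ∧ G.cx u ≤ max (G.cx w) (G.cx (s w))),
    decide (min (G.cy (s.symm u)) (G.cy u) < G.cy w ∧ G.cy w ≤ max (G.cy (s.symm u)) (G.cy u))]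

variable {s}

theorem conn_zero {w u : W} : G.conn s w u 0 = true ↔
    min (G.cx w) (G.cx (s w)) ≤ G.cx u ∧ G.cx u < max (G.cx w) (G.cx (s w)) := decide_eq_true_iff

theorem conn_one {w u : W} : G.conn s w u 1 = true ↔
    min (G.cy (s.symm u)) (G.cy u) ≤ G.cy w ∧ G.cy w < max (G.cy (s.symm u)) (G.cy u) :=
  decide_eq_true_iff

theorem conn_two {w u : W} : G.conn s w u 2 = true ↔
    min (G.cx w) (G.cx (s w)) < G.cx u ∧ G.cx u ≤ max (G.cx w) (G.cx (s w)) := decide_eq_true_iff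

theorem conn_three {w u : W} : G.conn s w u 3 = true ↔
    min (G.cy (s.symm u)) (G.cy u) < G.cy w ∧ G.cy w ≤ max (G.cy (s.symm u)) (G.cy u) :=
  decide_eq_true_iff

/-- The positions of a key and a corner are the only ones where a strand turns. -/
theorem conn_turn (hs : ∀ w, s w ≠ w) (w u : W) :
    ((G.conn s w u 0 = G.conn s w u 2) ↔ ¬ (u = w ∨ u = s w)) ∧
      ((G.conn s w u 1 = G.conn s w u 3) ↔ ¬ (u = w ∨ u = s w)) := by
  have e1 := G.cx_inj (v := u) (w := w)
  have e2 := G.cx_inj (v := u) (w := s w)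
  have e3 : G.cx (s w) ≠ G.cx w := fun h => hs w (G.cx_inj.1 h)
  have e4 := G.cy_inj (v := w) (w := u)
  have e5 := G.cy_inj (v := w) (w := s.symm u)
  have e6 : G.cy (s.symm u) ≠ G.cy u := fun h => hs (s.symm u) (by
    rw [s.apply_symm_apply]; exact (G.cy_inj.1 h).symm)
  have e7 : w = s.symm u ↔ u = s w := by rw [Equiv.eq_symm_apply, eq_comm]
  have e8 : w = u ↔ u = w := eq_comm
  rw [e7] at e5
  rw [e8] at e4
  rw [Bool.eq_iff_iff (a := G.conn s w u 0), Bool.eq_iff_iff (a := G.conn s w u 1), conn_zero,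
    conn_one, conn_two, conn_three]
  rw [half_open_iff e3.symm, half_open_iff e6, e1, e2, e4, e5]
  exact ⟨Iff.rfl, by rw [or_comm]⟩

theorem isBalanced_conn (hs : ∀ w, s w ≠ w) (w u : W) : IsBalanced (G.conn s w u) := by
  have := G.conn_turn hs w u
  unfold IsBalanced
  tauto

/-- The next segment, in a direction in which a strand goes on, is met by this strand. -/
theorem exists_conn_neighbour {i j : Fin n} {k : Fin 4}
    (h : G.conn s (G.row.symm i) (G.col.symm j) k = true) :
    ∃ i' j' : Fin n, (j' : ℤ) = j + sideX k ∧ -(i' : ℤ) = -i + sideY k ∧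
      G.conn s (G.row.symm i') (G.col.symm j') (k + 2) = true := by
  set w := G.row.symm i with hw
  set u := G.col.symm j with hu
  have b1 := (G.col w).2
  have b2 := (G.col (s w)).2
  have b3 := (G.row (s.symm u)).2
  have b4 := (G.row u).2
  have hi := i.2
  have hj := j.2
  have hcx := G.cx_col_symm j
  have hcy := G.cy_row_symm i
  rw [← hu] at hcx
  rw [← hw] at hcy
  fin_cases k
  · rw [Fin.zero_eta, conn_zero] at h
    have hlt : (j : ℕ) + 1 < n := by simp only [cx] at *; omega
    refine ⟨i, ⟨j + 1, hlt⟩, by simp [sideX], by simp [sideY], ?_⟩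
    change G.conn s _ _ 2 = true
    rw [conn_two, G.cx_col_symm, ← hw]
    simp only [cx] at *
    push_cast
    omega
  · rw [Fin.mk_one, conn_one] at h
    have hlt : 1 ≤ (i : ℕ) := by simp only [cy] at *; omega
    refine ⟨⟨i - 1, by omega⟩, j, by simp [sideX], by simp [sideY]; omega, ?_⟩
    change G.conn s _ _ 3 = true
    rw [conn_three, G.cy_row_symm, ← hu]
    simp only [cy] at *
    push_cast [hlt]
    omega
  · change G.conn s w u 2 = true at h
    rw [conn_two] at h
    have hlt : 1 ≤ (j : ℕ) := by simp only [cx] at *; omega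
    refine ⟨i, ⟨j - 1, by omega⟩, by simp [sideX]; omega, by simp [sideY], ?_⟩
    change G.conn s _ _ 0 = true
    rw [conn_zero, G.cx_col_symm, ← hw]
    simp only [cx] at *
    push_cast [hlt]
    omega
  · change G.conn s w u 3 = true at h
    rw [conn_three] at h
    have hlt : (i : ℕ) + 1 < n := by simp only [cy] at *; omega
    refine ⟨⟨i + 1, hlt⟩, j, by simp [sideX], by simp [sideY]; omega, ?_⟩
    change G.conn s _ _ 1 = true
    rw [conn_one, G.cy_row_symm, ← hu]
    simp only [cy] at *
    push_cast
    omega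

/-- The mosaic of a grid cycle, for given crossing information. -/
def mosaic (s : Equiv.Perm W) (o : W → W → Bool) : TileArray n := fun i j =>
  tileOf (G.conn s (G.row.symm i) (G.col.symm j)) (o (G.row.symm i) (G.col.symm j))

theorem suitablyConnected_mosaic (hs : ∀ w, s w ≠ w) (o : W → W → Bool) :
    SuitablyConnected sidePoint (G.mosaic s o) := by
  intro i j k hk
  rw [mosaic, isConnection_tileOf (G.isBalanced_conn hs _ _)] at hk
  obtain ⟨i', j', hj, hi, hc⟩ := G.exists_conn_neighbour hk
  refine ⟨(i', j'), ⟨?_, k + 2, ?_, ?_⟩, ?_⟩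
  · intro h
    obtain ⟨rfl, rfl⟩ := Prod.ext_iff.1 h
    revert hi hj
    fin_cases k <;> simp [sideX, sideY]
  · exact (isConnection_tileOf (G.isBalanced_conn hs _ _) _ _).2 hc
  · rw [place_sidePoint_eq_iff]
    simp only
    revert hi hj
    clear hk hc
    fin_cases k <;> simp [sideX, sideY] <;> omega
  · rintro ⟨i₂, j₂⟩ ⟨hne, l, -, hl⟩
    rw [place_sidePoint_eq_iff] at hl
    simp only [ne_eq, Prod.mk.injEq, not_and_or, Fin.ext_iff] at hne hl ⊢
    revert hi hj hl
    clear hk hc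
    fin_cases k <;> fin_cases l <;> simp [sideX, sideY] <;> omega

end GridChart

/-! ### The tiling of a grid cycle -/

/-- The line through two points, parametrized such that these have given parameters. -/
noncomputable def lineThrough (P Q : Space) (a b : ℝ) : ℝ →ᵃ[ℝ] Space :=
  (AffineMap.lineMap P Q).comp (AffineMap.lineMap (-a / (b - a)) ((1 - a) / (b - a)))

theorem lineThrough_apply (P Q : Space) (a b ξ : ℝ) :
    lineThrough P Q a b ξ = AffineMap.lineMap P Q ((ξ - a) / (b - a)) := by
  simp only [lineThrough, AffineMap.comp_apply]
  congr 1
  rw [AffineMap.lineMap_apply_module, smul_eq_mul, smul_eq_mul]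
  ring

theorem lineThrough_left (P Q : Space) (a b : ℝ) : lineThrough P Q a b a = P := by
  simp [lineThrough_apply]

theorem lineThrough_right (P Q : Space) {a b : ℝ} (h : a ≠ b) : lineThrough P Q a b b = Q := by
  rw [lineThrough_apply, div_self (sub_ne_zero.2 h.symm), AffineMap.lineMap_apply_one]

theorem lineThrough_coord {P Q : Space} {a b : ℝ} (h : a ≠ b) (i : Fin 3) (hP : P i = a)
    (hQ : Q i = b) (ξ : ℝ) : lineThrough P Q a b ξ i = ξ := by
  rw [lineThrough_apply, lineMap_apply_coord, hP, hQ, div_mul_cancel₀ _ (sub_ne_zero.2 h.symm)]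
  ring

theorem lineThrough_coord_const {P Q : Space} {a b c : ℝ} (i : Fin 3) (hP : P i = c)
    (hQ : Q i = c) (ξ : ℝ) : lineThrough P Q a b ξ i = c := by
  rw [lineThrough_apply, lineMap_apply_coord, hP, hQ]
  ring

/-! ### Segments of a grid cycle, parametrized by their varying coordinate -/

section Lines

variable {W : Type*} (s : Equiv.Perm W) (x y zK zC : W → ℝ)

/-- The horizontal line of a grid cycle. -/
noncomputable def hLine (w : W) : ℝ →ᵃ[ℝ] Space :=
  lineThrough (gridKey x y zK w) (gridCorner s x y zC w) (x w) (x (s w))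

/-- The vertical line of a grid cycle that ends at a given start of a horizontal segment. -/
noncomputable def vLine (u : W) : ℝ →ᵃ[ℝ] Space :=
  lineThrough (gridCorner s x y zC (s.symm u)) (gridKey x y zK u) (y (s.symm u)) (y u)

variable {s x y zK zC}

theorem IsGridCycle.x_ne (h : IsGridCycle s x y zK zC) (w : W) : x w ≠ x (s w) := fun e =>
  h.apply_ne w (h.x_injective e.symm)

theorem IsGridCycle.y_ne (h : IsGridCycle s x y zK zC) (u : W) : y (s.symm u) ≠ y u := fun e =>
  h.apply_ne (s.symm u) (by rw [s.apply_symm_apply]; exact (h.y_injective e).symm)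

theorem gridKey_zero (w : W) : gridKey x y zK w 0 = x w := rfl

theorem gridKey_one (w : W) : gridKey x y zK w 1 = y w := rfl

theorem gridCorner_zero (w : W) : gridCorner s x y zC w 0 = x (s w) := rfl

theorem gridCorner_one (w : W) : gridCorner s x y zC w 1 = y w := rfl

theorem gridSet_eq_lines (h : IsGridCycle s x y zK zC) : gridSet s x y zK zC =
    (⋃ w, hLine s x y zK zC w '' uIcc (x w) (x (s w))) ∪
      ⋃ u, vLine s x y zK zC u '' uIcc (y (s.symm u)) (y u) := by
  rw [gridSet, iUnion_union_distrib]
  congr 1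
  · refine iUnion_congr fun w => ?_
    rw [← segment_eq_uIcc, image_segment, hLine, lineThrough_left, lineThrough_right _ _ (h.x_ne w)]
  · refine (s.iSup_congr fun w => ?_)
    rw [← segment_eq_uIcc, image_segment, vLine, lineThrough_left,
      lineThrough_right _ _ (h.y_ne (s w)), s.symm_apply_apply]

theorem hLine_zero (h : IsGridCycle s x y zK zC) (w : W) (ξ : ℝ) :
    hLine s x y zK zC w ξ 0 = ξ :=
  lineThrough_coord (h.x_ne w) 0 (gridKey_zero w) (gridCorner_zero w) ξ

theorem vLine_one (h : IsGridCycle s x y zK zC) (u : W) (η : ℝ) :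
    vLine s x y zK zC u η 1 = η :=
  lineThrough_coord (h.y_ne u) 1 (gridCorner_one _) (gridKey_one u) η

theorem hLine_one (w : W) (ξ : ℝ) : hLine s x y zK zC w ξ 1 = y w :=
  lineThrough_coord_const 1 (gridKey_one w) (gridCorner_one w) ξ

theorem vLine_zero (u : W) (η : ℝ) : vLine s x y zK zC u η 0 = x u :=
  lineThrough_coord_const 0 (by rw [gridCorner_zero, s.apply_symm_apply]) (gridKey_zero u) η

theorem hLine_eq_vLine (h : IsGridCycle s x y zK zC) {w u : W} (hwu : u = w ∨ u = s w) :
    hLine s x y zK zC w (x u) = vLine s x y zK zC u (y w) := by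
  rcases hwu with rfl | rfl
  · rw [hLine, vLine, lineThrough_left, lineThrough_right _ _ (h.y_ne _)]
  · rw [hLine, vLine, s.symm_apply_apply, lineThrough_left, lineThrough_right _ _ (h.x_ne _)]

end Lines

theorem exists_mem_Icc_succ {X : ℤ → ℝ} {α β : ℤ} (hαβ : α < β) {ξ : ℝ}
    (hξ : ξ ∈ Icc (X α) (X β)) : ∃ e, α ≤ e ∧ e < β ∧ ξ ∈ Icc (X e) (X (e + 1)) := by
  revert ξ
  induction β, hαβ using Int.leInduction with
  | base => exact fun hξ => ⟨α, le_rfl, by omega, hξ⟩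
  | succ β hβ ih =>
    intro ξ hξ
    rcases le_total ξ (X β) with hle | hle
    · obtain ⟨e, h1, h2, h3⟩ := ih ⟨hξ.1, hle⟩
      exact ⟨e, h1, by omega, h3⟩
    · exact ⟨β, by omega, by omega, hle, hξ.2⟩

namespace GridChart

variable {W : Type*} {x y : W → ℝ} {n : ℕ} (G : GridChart x y n) {s : Equiv.Perm W}

theorem exists_cx {a : ℤ} (ha : Even a) (h0 : 0 ≤ a) (hn : a < 2 * n) : ∃ u, G.cx u = a := by
  obtain ⟨q, rfl⟩ := ha
  refine ⟨G.col.symm ⟨q.toNat, by omega⟩, ?_⟩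
  rw [cx_col_symm]
  simp only
  omega

theorem exists_cy {b : ℤ} (hb : Even b) (h0 : b ≤ 0) (hn : -2 * n < b) : ∃ w, G.cy w = b := by
  obtain ⟨q, rfl⟩ := hb
  refine ⟨G.row.symm ⟨(-q).toNat, by omega⟩, ?_⟩
  rw [cy_row_symm]
  simp only
  omega

/-- The segment is cut at the integer positions. A piece with even left end is the half strand
leaving that column to the right; a piece with odd left end is the half strand leaving the next
column to the left. -/
theorem mem_uIcc_x_iff (hs : ∀ w, s w ≠ w) {w : W} {ξ : ℝ} : ξ ∈ uIcc (x w) (x (s w)) ↔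
    ∃ u, (G.conn s w u 0 = true ∧ ξ ∈ Icc (G.X (G.cx u)) (G.X (G.cx u + 1))) ∨
      (G.conn s w u 2 = true ∧ ξ ∈ Icc (G.X (G.cx u - 1)) (G.X (G.cx u))) := by
  have hm := G.strictMono_X.monotone
  have e3 : G.cx (s w) ≠ G.cx w := fun h => hs w (G.cx_inj.1 h)
  have h1 := (G.col w).2
  have h2 := (G.col (s w)).2
  have hw : G.cx w = 2 * (G.col w : ℕ) := rfl
  have hw' : G.cx (s w) = 2 * (G.col (s w) : ℕ) := rfl
  rw [uIcc, ← G.X_cx w, ← G.X_cx (s w), ← hm.map_inf, ← hm.map_sup]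
  constructor
  · intro hξ
    obtain ⟨e, he1, he2, he⟩ := exists_mem_Icc_succ (by
      rw [inf_lt_sup]; exact e3.symm) hξ
    have he1' : min (G.cx w) (G.cx (s w)) ≤ e := he1
    have he2' : e < max (G.cx w) (G.cx (s w)) := he2
    rcases Int.even_or_odd e with hev | hod
    · obtain ⟨u, rfl⟩ := G.exists_cx hev (by omega) (by omega)
      exact ⟨u, Or.inl ⟨G.conn_zero.2 ⟨he1, he2⟩, he⟩⟩
    · obtain ⟨q, hq⟩ := hod
      obtain ⟨u, hu⟩ := G.exists_cx (a := e + 1) ⟨q + 1, by omega⟩ (by omega) (by omega)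
      refine ⟨u, Or.inr ⟨G.conn_two.2 ⟨by omega, by omega⟩, ?_⟩⟩
      rw [hu, add_sub_cancel_right]
      exact he
  · have hmin : min (G.cx w) (G.cx (s w)) = G.cx w ⊓ G.cx (s w) := rfl
    have hmax : max (G.cx w) (G.cx (s w)) = G.cx w ⊔ G.cx (s w) := rfl
    rintro ⟨u, ⟨hc, h⟩ | ⟨hc, h⟩⟩
    · rw [conn_zero] at hc
      exact ⟨(hm (by omega)).trans h.1, h.2.trans (hm (by omega))⟩
    · rw [conn_two] at hc
      have : G.cx u = 2 * (G.col u : ℕ) := rfl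
      exact ⟨(hm (by omega)).trans h.1, h.2.trans (hm (by omega))⟩

theorem mem_uIcc_y_iff (hs : ∀ w, s w ≠ w) {u : W} {η : ℝ} : η ∈ uIcc (y (s.symm u)) (y u) ↔
    ∃ w, (G.conn s w u 1 = true ∧ η ∈ Icc (G.Y (G.cy w)) (G.Y (G.cy w + 1))) ∨
      (G.conn s w u 3 = true ∧ η ∈ Icc (G.Y (G.cy w - 1)) (G.Y (G.cy w))) := by
  have hm := G.strictMono_Y.monotone
  have e3 : G.cy (s.symm u) ≠ G.cy u := fun h => hs (s.symm u) (by
    rw [s.apply_symm_apply]; exact (G.cy_inj.1 h).symm)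
  have h1 := (G.row u).2
  have h2 := (G.row (s.symm u)).2
  have hw : G.cy u = -2 * (G.row u : ℕ) := rfl
  have hw' : G.cy (s.symm u) = -2 * (G.row (s.symm u) : ℕ) := rfl
  rw [uIcc, ← G.Y_cy u, ← G.Y_cy (s.symm u), ← hm.map_inf, ← hm.map_sup]
  constructor
  · intro hη
    obtain ⟨e, he1, he2, he⟩ := exists_mem_Icc_succ (by
      rw [inf_lt_sup]; exact e3) hη
    have he1' : min (G.cy (s.symm u)) (G.cy u) ≤ e := he1
    have he2' : e < max (G.cy (s.symm u)) (G.cy u) := he2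
    rcases Int.even_or_odd e with hev | hod
    · obtain ⟨w, rfl⟩ := G.exists_cy hev (by omega) (by omega)
      exact ⟨w, Or.inl ⟨G.conn_one.2 ⟨he1, he2⟩, he⟩⟩
    · obtain ⟨q, hq⟩ := hod
      obtain ⟨w, hu⟩ := G.exists_cy (b := e + 1) ⟨q + 1, by omega⟩ (by omega) (by omega)
      refine ⟨w, Or.inr ⟨G.conn_three.2 ⟨by omega, by omega⟩, ?_⟩⟩
      rw [hu, add_sub_cancel_right]
      exact he
  · have hmin : min (G.cy (s.symm u)) (G.cy u) = G.cy (s.symm u) ⊓ G.cy u := rfl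
    have hmax : max (G.cy (s.symm u)) (G.cy u) = G.cy (s.symm u) ⊔ G.cy u := rfl
    rintro ⟨w, ⟨hc, h⟩ | ⟨hc, h⟩⟩
    · rw [conn_one] at hc
      have : G.cy w = -2 * (G.row w : ℕ) := rfl
      exact ⟨(hm (by omega)).trans h.1, h.2.trans (hm (by omega))⟩
    · rw [conn_three] at hc
      have : G.cy w = -2 * (G.row w : ℕ) := rfl
      exact ⟨(hm (by omega)).trans h.1, h.2.trans (hm (by omega))⟩

theorem even_cx (u : W) : Even (G.cx u) := ⟨(G.col u : ℕ), by unfold cx; ring⟩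

theorem even_cy (u : W) : Even (G.cy u) := ⟨-(G.row u : ℕ), by unfold cy; ring⟩

/-! The complex that is formed by the strands of a mosaic has a vertex on each side of a tile that
is crossed, and up to two in the interior of each tile. -/

section Vertices

variable [Nonempty W] (zK zC : W → ℝ) (s) (o : W → W → Bool)

/-- The positions of the vertices on the grid cycle. -/
noncomputable def gridPos (v : ℤ × ℤ × Bool) : Space :=
  if Even v.2.1 ∧ v.2.2 = false then hLine s x y zK zC (G.atRow v.2.1) (G.X v.1)
  else vLine s x y zK zC (G.atCol v.1) (G.Y v.2.1)

/-- The positions of the vertices on the mosaic. -/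
noncomputable def tilePos (v : ℤ × ℤ × Bool) : Space :=
  if Even v.1 ∧ Even v.2.1 then
    !₂[v.1 + (midPoint (G.conn s (G.atRow v.2.1) (G.atCol v.1))).1,
      v.2.1 + (midPoint (G.conn s (G.atRow v.2.1) (G.atCol v.1))).2,
      midHeight (G.conn s (G.atRow v.2.1) (G.atCol v.1)) (o (G.atRow v.2.1) (G.atCol v.1)) v.2.2]
  else !₂[(v.1 : ℝ), v.2.1, 0]

/-- A vertex in the interior of a tile. -/
def center (w u : W) (b : Bool) : ℤ × ℤ × Bool := (G.cx u, G.cy w, b)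

/-- A vertex on the boundary of a tile. -/
def side (w u : W) (k : Fin 4) : ℤ × ℤ × Bool := (G.cx u + sideX k, G.cy w + sideY k, false)

theorem gridPos_center_false (w u : W) :
    G.gridPos s zK zC (G.center w u false) = hLine s x y zK zC w (x u) := by
  simp [gridPos, center, even_cy, atRow_cy, X_cx]

theorem gridPos_center_true (w u : W) :
    G.gridPos s zK zC (G.center w u true) = vLine s x y zK zC u (y w) := by
  simp [gridPos, center, atCol_cx, Y_cy]

theorem gridPos_side_zero (w u : W) :
    G.gridPos s zK zC (G.side w u 0) = hLine s x y zK zC w (G.X (G.cx u + 1)) := by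
  simp [gridPos, side, even_cy, atRow_cy, sideX, sideY]

theorem gridPos_side_two (w u : W) :
    G.gridPos s zK zC (G.side w u 2) = hLine s x y zK zC w (G.X (G.cx u - 1)) := by
  simp [gridPos, side, even_cy, atRow_cy, sideX, sideY, sub_eq_add_neg]

theorem gridPos_side_one (w u : W) :
    G.gridPos s zK zC (G.side w u 1) = vLine s x y zK zC u (G.Y (G.cy w + 1)) := by
  have : ¬ Even (G.cy w + 1) := by
    rw [Int.even_add_one]; exact not_not.2 (G.even_cy w)
  simp [gridPos, side, this, atCol_cx, sideX, sideY]

theorem gridPos_side_three (w u : W) :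
    G.gridPos s zK zC (G.side w u 3) = vLine s x y zK zC u (G.Y (G.cy w - 1)) := by
  have : ¬ Even (G.cy w - 1) := by
    rw [Int.even_sub_one]; exact not_not.2 (G.even_cy w)
  simp [gridPos, side, this, atCol_cx, sideX, sideY, ← sub_eq_add_neg]

theorem tilePos_center (w u : W) (b : Bool) : G.tilePos s o (G.center w u b) =
    !₂[G.cx u + (midPoint (G.conn s w u)).1, G.cy w + (midPoint (G.conn s w u)).2,
      midHeight (G.conn s w u) (o w u) b] := by
  simp [tilePos, center, even_cx, even_cy, atRow_cy, atCol_cx]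

theorem tilePos_side (w u : W) (k : Fin 4) : G.tilePos s o (G.side w u k) =
    !₂[(G.cx u : ℝ) + sideX k, G.cy w + sideY k, 0] := by
  have : ¬ (Even (G.cx u + sideX k) ∧ Even (G.cy w + sideY k)) := by
    have h1 := G.even_cx u
    have h2 := G.even_cy w
    fin_cases k <;> simp [sideX, sideY, Int.even_add, h1, h2]
  simp [tilePos, side, this]

end Vertices

end GridChart

/-- The isotopy theorem for complexes with a finite family of edges, of which each vertex is an
endpoint. -/
theorem ambientIsotopic_of_edges {ι V : Type*} [Finite ι] (a b : ι → V) (hab : ∀ i, a i ≠ b i)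
    (p q : V → Space)
    (hinj : ∀ t ∈ Icc (0 : ℝ) 1, ∀ i i', ∀ r ∈ Icc (0 : ℝ) 1, ∀ r' ∈ Icc (0 : ℝ) 1,
      (AffineMap.lineMap (p (a i) + t • (q (a i) - p (a i))) (p (b i) + t • (q (b i) - p (b i))) r :
          Space) =
        AffineMap.lineMap (p (a i') + t • (q (a i') - p (a i')))
          (p (b i') + t • (q (b i') - p (b i'))) r' →
      (a i = a i' ∧ b i = b i' ∧ r = r') ∨ (r = 0 ∧ r' = 0 ∧ a i = a i') ∨
        (r = 1 ∧ r' = 1 ∧ b i = b i')) :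
    AmbientIsotopic (⋃ i, segment ℝ (p (a i)) (p (b i))) (⋃ i, segment ℝ (q (a i)) (q (b i))) := by
  classical
  let F : Set V := range (Sum.elim a b)
  have := Fintype.ofFinite F
  let a' : ι → F := fun i => ⟨a i, ⟨Sum.inl i, rfl⟩⟩
  let b' : ι → F := fun i => ⟨b i, ⟨Sum.inr i, rfl⟩⟩
  have key := ambientIsotopic_of_complex (range fun i => (a' i, b' i))
    (by rintro _ ⟨i, rfl⟩ h; exact hab i (congrArg Subtype.val h))
    (fun v => p v) (fun v => q v - p v) (by
      rintro t ht z hz z' hz' hzz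
      simp only [formalEdges, exists_range_iff, mem_ofPred_eq] at hz hz'
      obtain ⟨i, hi⟩ := hz
      obtain ⟨i', hi'⟩ := hz'
      rw [segment_eq_image_lineMap] at hi hi'
      obtain ⟨r, hr, rfl⟩ := hi
      obtain ⟨r', hr', rfl⟩ := hi'
      rw [realize_lineMap, realize_lineMap] at hzz
      rcases hinj t ht i i' r hr r' hr' hzz with ⟨h1, h2, rfl⟩ | ⟨rfl, rfl, h1⟩ | ⟨rfl, rfl, h2⟩
      · rw [show a' i = a' i' from Subtype.ext h1, show b' i = b' i' from Subtype.ext h2]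
      · rw [AffineMap.lineMap_apply_zero, AffineMap.lineMap_apply_zero,
          show a' i = a' i' from Subtype.ext h1]
      · rw [AffineMap.lineMap_apply_one, AffineMap.lineMap_apply_one,
          show b' i = b' i' from Subtype.ext h2])
  simpa only [biUnion_range, add_sub_cancel, a', b'] using key

/-- This keeps a moving half strand inside the strip of its tile and lets it touch the boundary only
at its outer end. The margin `t / 4` absorbs the displacement of the middle point. -/
theorem strip_bounds {A m t r D lo hi : ℝ} (hlo : lo + t / 4 < A) (hhi : A + t / 4 < hi)
    (ht : 0 ≤ t) (hm : |m| ≤ 1 / 4) (hD : D ∈ Icc lo hi) (hr : r ∈ Icc (0 : ℝ) 1) :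
    lo ≤ (1 - r) * (A + t * m) + r * D ∧ (1 - r) * (A + t * m) + r * D ≤ hi ∧
      ((1 - r) * (A + t * m) + r * D = lo → r = 1) ∧
      ((1 - r) * (A + t * m) + r * D = hi → r = 1) := by
  obtain ⟨hm1, hm2⟩ := abs_le.1 hm
  have h1 : 0 < A + t * m - lo := by nlinarith
  have h2 : 0 < hi - (A + t * m) := by nlinarith
  have h3 := mul_nonneg hr.1 (sub_nonneg.2 hD.1)
  have h4 := mul_nonneg hr.1 (sub_nonneg.2 hD.2)
  have h5 : 0 ≤ 1 - r := sub_nonneg.2 hr.2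
  have h6 := mul_nonneg h5 h1.le
  have h7 := mul_nonneg h5 h2.le
  refine ⟨by linarith, by linarith, fun h => ?_, fun h => ?_⟩
  · have : (1 - r) * (A + t * m - lo) = 0 := by linarith
    linarith [(mul_eq_zero.1 this).resolve_right h1.ne']
  · have : (1 - r) * (hi - (A + t * m)) = 0 := by linarith
    linarith [(mul_eq_zero.1 this).resolve_right h2.ne']

theorem abs_midPoint_le (c : Fin 4 → Bool) :
    |(midPoint c).1| ≤ 1 / 4 ∧ |(midPoint c).2| ≤ 1 / 4 := by
  simp only [midPoint]
  cases c 0 <;> cases c 1 <;> cases c 2 <;> cases c 3 <;> norm_num [abs_le]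

/-- The strands on a tile only meet in the middle points. -/
theorem tile_injective {c : Fin 4 → Bool} (hc : IsBalanced c) {t : ℝ} (ht : 0 ≤ t)
    {dX dY : Fin 4 → ℝ} (hX0 : t / 4 < dX 0) (hX1 : dX 1 = 0) (hX2 : dX 2 < -(t / 4))
    (hX3 : dX 3 = 0) (hY0 : dY 0 = 0) (hY1 : t / 4 < dY 1) (hY2 : dY 2 = 0)
    (hY3 : dY 3 < -(t / 4)) {k k' : Fin 4} (hk : c k = true) (hk' : c k' = true) {r r' : ℝ}
    (hr : 0 ≤ r) (hr' : 0 ≤ r')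
    (ex : (1 - r) * (t * (midPoint c).1) + r * dX k = (1 - r') * (t * (midPoint c).1) + r' * dX k')
    (ey : (1 - r) * (t * (midPoint c).2) + r * dY k = (1 - r') * (t * (midPoint c).2) + r' * dY k') :
    (k = k' ∧ r = r') ∨ (r = 0 ∧ r' = 0 ∧ (isVert c k = isVert c k' ∨
      ((∀ l, c l = true) ∧ isVert c k ≠ isVert c k'))) := by
  have hD : ∀ l, 0 < sideX l * dX l + sideY l * dY l := fun l => by
    fin_cases l <;> simp [sideX, sideY] <;> linarith
  -- Half strands of one tile have different middle points only in a crossing.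
  have hlev : isVert c k = isVert c k' ∨ ((∀ l, c l = true) ∧ isVert c k ≠ isVert c k') := by
    clear ex ey
    have h8 := hc.eq_cases
    simp only [List.mem_cons, List.not_mem_nil, or_false] at h8
    rcases h8 with rfl | rfl | rfl | rfl | rfl | rfl | rfl | rfl <;> revert k k' <;> decide
  by_cases hkk : k = k'
  · subst hkk
    left
    refine ⟨rfl, ?_⟩
    obtain ⟨hm1, hm2⟩ := abs_midPoint_le c
    obtain ⟨h1, h2⟩ := abs_le.1 hm1
    obtain ⟨h3, h4⟩ := abs_le.1 hm2
    have ex' : (r - r') * (dX k - t * (midPoint c).1) = 0 := by linarith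
    have ey' : (r - r') * (dY k - t * (midPoint c).2) = 0 := by linarith
    refine sub_eq_zero.1 ?_
    fin_cases k
    · exact (mul_eq_zero.1 ex').resolve_right (by change dX 0 - _ ≠ 0; nlinarith)
    · exact (mul_eq_zero.1 ey').resolve_right (by change dY 1 - _ ≠ 0; nlinarith)
    · exact (mul_eq_zero.1 ex').resolve_right (by change dX 2 - _ ≠ 0; nlinarith)
    · exact (mul_eq_zero.1 ey').resolve_right (by change dY 3 - _ ≠ 0; nlinarith)
  · right
    have hn := fun l => mul_nonneg hr (hD l).le
    have hn' := fun l => mul_nonneg hr' (hD l).le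
    -- These products are `r` and `r'` times positive outward distances. In every pattern the two
    -- equations make nonnegative multiples of distinct directions cancel, so both products vanish.
    suffices hs : r * (sideX k * dX k + sideY k * dY k) = 0 ∧
        r' * (sideX k' * dX k' + sideY k' * dY k') = 0 from
      ⟨(mul_eq_zero.1 hs.1).resolve_right (hD k).ne',
        (mul_eq_zero.1 hs.2).resolve_right (hD k').ne', hlev⟩
    have n0 := hn 0
    have n1 := hn 1
    have n2 := hn 2
    have n3 := hn 3
    have m0 := hn' 0
    have m1 := hn' 1
    have m2 := hn' 2
    have m3 := hn' 3
    clear hlev hD hn hn'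
    have h8 := hc.eq_cases
    simp only [List.mem_cons, List.not_mem_nil, or_false] at h8
    simp only [sideX, sideY, Matrix.cons_val, Int.cast_zero, Int.cast_one, Int.cast_neg, zero_mul,
      one_mul, neg_mul, add_zero, zero_add, mul_neg] at n0 n1 n2 n3 m0 m1 m2 m3
    rcases h8 with rfl | rfl | rfl | rfl | rfl | rfl | rfl | rfl <;> fin_cases k <;>
      first
      | exact absurd hk (by decide)
      | (fin_cases k' <;>
          first
          | exact absurd hk' (by decide)
          | exact absurd rfl hkk
          | (simp [midPoint, sideX, sideY, hX1, hX3, hY0, hY2, -mul_eq_zero, -zero_eq_mul,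
              -mul_eq_mul_left_iff, -mul_eq_mul_right_iff] at ex ey ⊢
             constructor <;> linarith))

theorem div_sub_mem_Ioo {p q ξ : ℝ} (h1 : min p q < ξ) (h2 : ξ < max p q) :
    (ξ - p) / (q - p) ∈ Ioo (0 : ℝ) 1 := by
  rcases le_total p q with h | h
  · rw [min_eq_left h] at h1
    rw [max_eq_right h] at h2
    exact ⟨div_pos (by linarith) (by linarith), (div_lt_one (by linarith)).2 (by linarith)⟩
  · rw [min_eq_right h] at h1
    rw [max_eq_left h] at h2
    exact ⟨div_pos_of_neg_of_neg (by linarith) (by linarith),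
      (div_lt_one_of_neg (by linarith)).2 (by linarith)⟩

/-! ### Half strands on the grid cycle and on the mosaic -/

namespace GridChart

variable {W : Type*} {x y : W → ℝ} {n : ℕ} (G : GridChart x y n) {s : Equiv.Perm W}
  {zK zC : W → ℝ}

/-- The half strands of the mosaic. -/
def Half (s : Equiv.Perm W) : Type _ := {q : W × W × Fin 4 // G.conn s q.1 q.2.1 q.2.2 = true}

/-- The inner endpoint of a half strand. -/
def inner (i : G.Half s) : ℤ × ℤ × Bool :=
  G.center i.1.1 i.1.2.1 (isVert (G.conn s i.1.1 i.1.2.1) i.1.2.2)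

/-- The outer endpoint of a half strand. -/
def outer (i : G.Half s) : ℤ × ℤ × Bool := G.side i.1.1 i.1.2.1 i.1.2.2

theorem inner_ne_outer (i : G.Half s) : G.inner i ≠ G.outer i := by
  obtain ⟨⟨w, u, k⟩, hk⟩ := i
  intro h
  simp only [inner, outer, center, side, Prod.mk.injEq] at h
  obtain ⟨h1, h2, -⟩ := h
  clear hk
  revert h1 h2
  fin_cases k <;> simp [sideX, sideY]

instance [Finite W] : Finite (G.Half s) := inferInstanceAs (Finite (Subtype _))

variable [Nonempty W]

theorem gridPos_inner_even (w u : W) {k : Fin 4}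
    (hk : k = 0 ∨ k = 2) : G.gridPos s zK zC (G.center w u (isVert (G.conn s w u) k)) =
      hLine s x y zK zC w (x u) := by
  have : isVert (G.conn s w u) k = false := by rcases hk with rfl | rfl <;> rfl
  rw [this, gridPos_center_false]

/-- A strand that does not turn has its own vertical middle point. At a turn the middle point counts
as horizontal, but there the two lines meet. -/
theorem gridPos_inner_odd (h : IsGridCycle s x y zK zC) (w u : W) {k : Fin 4}
    (hk : k = 1 ∨ k = 3) : G.gridPos s zK zC (G.center w u (isVert (G.conn s w u) k)) =
      vLine s x y zK zC u (y w) := by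
  have : isVert (G.conn s w u) k = (G.conn s w u 0 == G.conn s w u 2) := by
    rcases hk with rfl | rfl <;> simp [isVert]
  rw [this]
  by_cases hb : G.conn s w u 0 = G.conn s w u 2
  · rw [beq_iff_eq.2 hb, gridPos_center_true]
  · have ht := G.conn_turn h.apply_ne w u
    rw [beq_false_of_ne hb, gridPos_center_false, hLine_eq_vLine h (by tauto)]

theorem iUnion_segment_gridPos (h : IsGridCycle s x y zK zC) :
    ⋃ i : G.Half s, segment ℝ (G.gridPos s zK zC (G.inner i)) (G.gridPos s zK zC (G.outer i)) =
      gridSet s x y zK zC := by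
  have hX := G.strictMono_X.monotone
  have hY := G.strictMono_Y.monotone
  have hseg : ∀ (f : ℝ →ᵃ[ℝ] Space) {a b : ℝ}, a ≤ b → segment ℝ (f a) (f b) = f '' Icc a b :=
    fun f a b hab => by rw [← image_segment, segment_eq_Icc hab]
  have hseg' : ∀ (f : ℝ →ᵃ[ℝ] Space) {a b : ℝ}, a ≤ b → segment ℝ (f b) (f a) = f '' Icc a b :=
    fun f a b hab => by rw [segment_symm, hseg f hab]
  have e0 : ∀ w u, segment ℝ (G.gridPos s zK zC (G.center w u (isVert (G.conn s w u) 0)))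
      (G.gridPos s zK zC (G.side w u 0)) =
      hLine s x y zK zC w '' Icc (G.X (G.cx u)) (G.X (G.cx u + 1)) := fun w u => by
    rw [G.gridPos_inner_even w u (Or.inl rfl), gridPos_side_zero, ← G.X_cx u,
      hseg _ (hX (by omega))]
  have e2 : ∀ w u, segment ℝ (G.gridPos s zK zC (G.center w u (isVert (G.conn s w u) 2)))
      (G.gridPos s zK zC (G.side w u 2)) =
      hLine s x y zK zC w '' Icc (G.X (G.cx u - 1)) (G.X (G.cx u)) := fun w u => by
    rw [G.gridPos_inner_even w u (Or.inr rfl), gridPos_side_two, ← G.X_cx u,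
      hseg' _ (hX (by omega))]
  have e1 : ∀ w u, segment ℝ (G.gridPos s zK zC (G.center w u (isVert (G.conn s w u) 1)))
      (G.gridPos s zK zC (G.side w u 1)) =
      vLine s x y zK zC u '' Icc (G.Y (G.cy w)) (G.Y (G.cy w + 1)) := fun w u => by
    rw [G.gridPos_inner_odd h w u (Or.inl rfl), gridPos_side_one, ← G.Y_cy w,
      hseg _ (hY (by omega))]
  have e3 : ∀ w u, segment ℝ (G.gridPos s zK zC (G.center w u (isVert (G.conn s w u) 3)))
      (G.gridPos s zK zC (G.side w u 3)) =
      vLine s x y zK zC u '' Icc (G.Y (G.cy w - 1)) (G.Y (G.cy w)) := fun w u => by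
    rw [G.gridPos_inner_odd h w u (Or.inr rfl), gridPos_side_three, ← G.Y_cy w,
      hseg' _ (hY (by omega))]
  rw [gridSet_eq_lines h]
  ext z
  simp only [mem_iUnion, mem_union, mem_image]
  constructor
  · rintro ⟨⟨⟨w, u, k⟩, hk⟩, hz⟩
    simp only [inner, outer] at hz hk
    fin_cases k
    · obtain ⟨ξ, hξ, rfl⟩ := (e0 w u).subset hz
      exact Or.inl ⟨w, ξ, (G.mem_uIcc_x_iff h.apply_ne).2 ⟨u, Or.inl ⟨hk, hξ⟩⟩, rfl⟩
    · obtain ⟨ξ, hξ, rfl⟩ := (e1 w u).subset hz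
      exact Or.inr ⟨u, ξ, (G.mem_uIcc_y_iff h.apply_ne).2 ⟨w, Or.inl ⟨hk, hξ⟩⟩, rfl⟩
    · obtain ⟨ξ, hξ, rfl⟩ := (e2 w u).subset hz
      exact Or.inl ⟨w, ξ, (G.mem_uIcc_x_iff h.apply_ne).2 ⟨u, Or.inr ⟨hk, hξ⟩⟩, rfl⟩
    · obtain ⟨ξ, hξ, rfl⟩ := (e3 w u).subset hz
      exact Or.inr ⟨u, ξ, (G.mem_uIcc_y_iff h.apply_ne).2 ⟨w, Or.inr ⟨hk, hξ⟩⟩, rfl⟩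
  · rintro (⟨w, ξ, hξ, rfl⟩ | ⟨u, ξ, hξ, rfl⟩)
    · obtain ⟨u, ⟨hk, hξ⟩ | ⟨hk, hξ⟩⟩ := (G.mem_uIcc_x_iff h.apply_ne).1 hξ
      · exact ⟨⟨(w, u, 0), hk⟩, (e0 w u).superset ⟨ξ, hξ, rfl⟩⟩
      · exact ⟨⟨(w, u, 2), hk⟩, (e2 w u).superset ⟨ξ, hξ, rfl⟩⟩
    · obtain ⟨w, ⟨hk, hξ⟩ | ⟨hk, hξ⟩⟩ := (G.mem_uIcc_y_iff h.apply_ne).1 hξ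
      · exact ⟨⟨(w, u, 1), hk⟩, (e1 w u).superset ⟨ξ, hξ, rfl⟩⟩
      · exact ⟨⟨(w, u, 3), hk⟩, (e3 w u).superset ⟨ξ, hξ, rfl⟩⟩

theorem iUnion_segment_tilePos (hs : ∀ w, s w ≠ w) (o : W → W → Bool) :
    ⋃ i : G.Half s, segment ℝ (G.tilePos s o (G.inner i)) (G.tilePos s o (G.outer i)) =
      drawing sidePoint (G.mosaic s o) := by
  have key : ∀ i j, ⋃ t ∈ (G.mosaic s o i j).strands, t.curve sidePoint i j =
      ⋃ k : Fin 4, ⋃ _ : G.conn s (G.row.symm i) (G.col.symm j) k = true,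
        segment ℝ (G.tilePos s o (G.center (G.row.symm i) (G.col.symm j)
            (isVert (G.conn s (G.row.symm i) (G.col.symm j)) k)))
          (G.tilePos s o (G.side (G.row.symm i) (G.col.symm j) k)) := fun i j => by
    rw [mosaic, iUnion_curve_tileOf i j (G.isBalanced_conn hs _ _)]
    refine iUnion_congr fun k => iUnion_congr fun _ => ?_
    rw [tilePos_center, tilePos_side, cx_col_symm, cy_row_symm, place, place, sidePoint_eq]
    push_cast
    rfl
  simp only [drawing, key]
  ext z
  simp only [mem_iUnion]
  constructor
  · rintro ⟨⟨⟨w, u, k⟩, hk⟩, hz⟩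
    refine ⟨G.row w, G.col u, k, ?_⟩
    simp only [Equiv.symm_apply_apply]
    exact ⟨hk, hz⟩
  · rintro ⟨i, j, k, hk, hz⟩
    exact ⟨⟨(_, _, k), hk⟩, hz⟩

theorem gridPos_side_coord (h : IsGridCycle s x y zK zC) (w u : W) (k : Fin 4) :
    G.gridPos s zK zC (G.side w u k) 0 = G.X (G.cx u + sideX k) ∧
      G.gridPos s zK zC (G.side w u k) 1 = G.Y (G.cy w + sideY k) := by
  fin_cases k
  · refine ⟨?_, ?_⟩ <;> simp only [Fin.zero_eta, gridPos_side_zero, hLine_zero h, hLine_one]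
    · rfl
    · rw [← G.Y_cy]; simp [sideY]
  · refine ⟨?_, ?_⟩ <;> simp only [Fin.mk_one, gridPos_side_one, vLine_zero, vLine_one h]
    · rw [← G.X_cx]; simp [sideX]
    · rfl
  · refine ⟨?_, ?_⟩ <;> simp only [Fin.reduceFinMk, gridPos_side_two, hLine_zero h, hLine_one]
    · rfl
    · rw [← G.Y_cy]; simp [sideY]
  · refine ⟨?_, ?_⟩ <;> simp only [Fin.reduceFinMk, gridPos_side_three, vLine_zero, vLine_one h]
    · rw [← G.X_cx]; simp [sideX]
    · rfl

theorem gridPos_center_coord (h : IsGridCycle s x y zK zC) (w u : W) (b : Bool) :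
    G.gridPos s zK zC (G.center w u b) 0 = G.X (G.cx u) ∧
      G.gridPos s zK zC (G.center w u b) 1 = G.Y (G.cy w) := by
  cases b
  · rw [gridPos_center_false, hLine_zero h, hLine_one, G.X_cx, G.Y_cy]; exact ⟨rfl, rfl⟩
  · rw [gridPos_center_true, vLine_zero, vLine_one h, G.X_cx, G.Y_cy]; exact ⟨rfl, rfl⟩

-- Four connections mean that the crossing point is interior to both segments, so equal heights
-- would contradict `h.cross`.
omit [Nonempty W] in
theorem hLine_ne_vLine (h : IsGridCycle s x y zK zC) {w u : W}
    (hc : ∀ k, G.conn s w u k = true) :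
    hLine s x y zK zC w (x u) 2 ≠ vLine s x y zK zC u (y w) 2 := fun h2 => by
  have h0 := G.conn_zero.1 (hc 0)
  have h1 := G.conn_one.1 (hc 1)
  have h2' := G.conn_two.1 (hc 2)
  have h3 := G.conn_three.1 (hc 3)
  have hX := G.strictMono_X
  have hY := G.strictMono_Y
  have ha : (x u - x w) / (x (s w) - x w) ∈ Ioo (0 : ℝ) 1 := by
    refine div_sub_mem_Ioo ?_ ?_ <;> rw [← G.X_cx, ← G.X_cx, ← G.X_cx]
    · rw [← hX.monotone.map_min]; exact hX h2'.1
    · rw [← hX.monotone.map_max]; exact hX h0.2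
  have hb : (y w - y (s.symm u)) / (y u - y (s.symm u)) ∈ Ioo (0 : ℝ) 1 := by
    refine div_sub_mem_Ioo ?_ ?_ <;> rw [← G.Y_cy, ← G.Y_cy, ← G.Y_cy]
    · rw [← hY.monotone.map_min]; exact hY h3.1
    · rw [← hY.monotone.map_max]; exact hY h1.2
  refine h.cross w (s.symm u) _ ha _ hb ?_
  rw [s.apply_symm_apply, ← lineThrough_apply, ← lineThrough_apply]
  exact space_ext (by rw [← hLine, ← vLine, hLine_zero h, vLine_zero])
    (by rw [← hLine, ← vLine, hLine_one, vLine_one h]) h2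

end GridChart

/-! ### Linear motion of the grid cycle to the mosaic -/

namespace GridChart

variable {W : Type*} {x y : W → ℝ} {n : ℕ} (G : GridChart x y n) {s : Equiv.Perm W}
  {zK zC : W → ℝ}

/-- The abscissa of an integer position at the time `t`. -/
noncomputable def Xt (t : ℝ) (a : ℤ) : ℝ := (1 - t) * G.X a + t * a

/-- The ordinate of an integer position at the time `t`. -/
noncomputable def Yt (t : ℝ) (b : ℤ) : ℝ := (1 - t) * G.Y b + t * b

/-- At time 0 strictness comes from `X`; at positive times the term `t * (b - a)` leaves a gap of at
least `t`. -/
theorem add_quarter_lt {X : ℤ → ℝ} (hX : StrictMono X) {t : ℝ} (ht : t ∈ Icc (0 : ℝ) 1)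
    {a b : ℤ} (hab : a < b) :
    (1 - t) * X a + t * a + t / 4 < (1 - t) * X b + t * b := by
  have h1 : (a : ℝ) + 1 ≤ b := by exact_mod_cast hab
  have h2 := hX hab
  rcases ht.1.eq_or_lt with rfl | h0
  · simpa using h2
  · nlinarith [mul_le_mul_of_nonneg_left h2.le (sub_nonneg.2 ht.2),
      mul_le_mul_of_nonneg_left h1 h0.le]

theorem strictMono_Xt {t : ℝ} (ht : t ∈ Icc (0 : ℝ) 1) : StrictMono (G.Xt t) := fun a b hab => by
  have := add_quarter_lt G.strictMono_X ht hab
  have := ht.1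
  simp only [Xt]
  linarith

theorem strictMono_Yt {t : ℝ} (ht : t ∈ Icc (0 : ℝ) 1) : StrictMono (G.Yt t) := fun a b hab => by
  have := add_quarter_lt G.strictMono_Y ht hab
  have := ht.1
  simp only [Yt]
  linarith

variable [Nonempty W]

/-- The positions of the vertices at the time `t`. -/
noncomputable def pos (s : Equiv.Perm W) (zK zC : W → ℝ) (o : W → W → Bool) (t : ℝ)
    (v : ℤ × ℤ × Bool) : Space :=
  G.gridPos s zK zC v + t • (G.tilePos s o v - G.gridPos s zK zC v)

variable {o : W → W → Bool} {t : ℝ}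

theorem pos_apply (v : ℤ × ℤ × Bool) (i : Fin 3) : G.pos s zK zC o t v i =
    (1 - t) * G.gridPos s zK zC v i + t * G.tilePos s o v i := by
  simp only [pos, PiLp.add_apply, PiLp.smul_apply, PiLp.sub_apply, smul_eq_mul]
  ring

theorem pos_center_zero (h : IsGridCycle s x y zK zC) (w u : W) (b : Bool) :
    G.pos s zK zC o t (G.center w u b) 0 =
      G.Xt t (G.cx u) + t * (midPoint (G.conn s w u)).1 := by
  rw [pos_apply, (G.gridPos_center_coord h w u b).1, tilePos_center, Xt]
  simp
  ring

theorem pos_center_one (h : IsGridCycle s x y zK zC) (w u : W) (b : Bool) :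
    G.pos s zK zC o t (G.center w u b) 1 =
      G.Yt t (G.cy w) + t * (midPoint (G.conn s w u)).2 := by
  rw [pos_apply, (G.gridPos_center_coord h w u b).2, tilePos_center, Yt]
  simp
  ring

theorem pos_side_zero (h : IsGridCycle s x y zK zC) (w u : W) (k : Fin 4) :
    G.pos s zK zC o t (G.side w u k) 0 = G.Xt t (G.cx u + sideX k) := by
  rw [pos_apply, (G.gridPos_side_coord h w u k).1, tilePos_side, Xt]
  simp

theorem pos_side_one (h : IsGridCycle s x y zK zC) (w u : W) (k : Fin 4) :
    G.pos s zK zC o t (G.side w u k) 1 = G.Yt t (G.cy w + sideY k) := by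
  rw [pos_apply, (G.gridPos_side_coord h w u k).2, tilePos_side, Yt]
  simp

open Classical in
/-- Whether the horizontal strand passes over the vertical one. -/
noncomputable def passesOver (s : Equiv.Perm W) (x y zK zC : W → ℝ) (w u : W) : Bool :=
  decide (vLine s x y zK zC u (y w) 2 < hLine s x y zK zC w (x u) 2)

/-- The crossing is drawn such that the height difference has the same sign in the mosaic as on the
grid cycle; a convex combination of two numbers of one sign does not vanish. -/
theorem pos_center_ne (h : IsGridCycle s x y zK zC) {w u : W} (hc : ∀ k, G.conn s w u k = true)
    (ht : t ∈ Icc (0 : ℝ) 1) {b b' : Bool} (hb : b ≠ b') :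
    G.pos s zK zC (passesOver s x y zK zC) t (G.center w u b) ≠
      G.pos s zK zC (passesOver s x y zK zC) t (G.center w u b') := by
  wlog hbf : b = false generalizing b b'
  · exact (this hb.symm (by revert hb hbf; cases b <;> cases b' <;> simp)).symm
  obtain rfl := hbf
  obtain rfl : b' = true := by revert hb; cases b' <;> simp
  intro he
  have h2 := congrArg (fun v : Space => v 2) he
  simp only [pos_apply, gridPos_center_false, gridPos_center_true, tilePos_center, midHeight, hc,
    Bool.and_self, Bool.true_and, passesOver] at h2
  have hne := G.hLine_ne_vLine h hc
  obtain ⟨ht0, ht1⟩ := ht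
  by_cases hlt : vLine s x y zK zC u (y w) 2 < hLine s x y zK zC w (x u) 2
  · simp [hlt] at h2
    rcases ht0.eq_or_lt with rfl | h0
    · simp at h2; exact hne h2
    · nlinarith [mul_le_mul_of_nonneg_left hlt.le (sub_nonneg.2 ht1)]
  · have hlt' := lt_of_le_of_ne (not_lt.1 hlt) hne
    simp [hlt] at h2
    rcases ht0.eq_or_lt with rfl | h0
    · simp at h2; exact hne h2
    · nlinarith [mul_le_mul_of_nonneg_left hlt'.le (sub_nonneg.2 ht1)]

theorem mem_Icc_sideX (k : Fin 4) : -1 ≤ sideX k ∧ sideX k ≤ 1 ∧ -1 ≤ sideY k ∧ sideY k ≤ 1 := by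
  fin_cases k <;> simp [sideX, sideY]

theorem even_pos_far {a b : ℤ} (ha : Even a) (hb : Even b) (hab : a < b) : a + 1 ≤ b - 1 := by
  obtain ⟨p, rfl⟩ := ha
  obtain ⟨q, rfl⟩ := hb
  omega

/-- Different tiles lie in different rows or columns, whose strips remain separated by the moving
boundary lines, so their half strands meet only in outer ends. Within one tile the planar
projections meet only in the middle, and the two middle points of a crossing stay apart by height.
-/
theorem pos_injective (h : IsGridCycle s x y zK zC) (ht : t ∈ Icc (0 : ℝ) 1) (i i' : G.Half s)
    {r r' : ℝ} (hr : r ∈ Icc (0 : ℝ) 1) (hr' : r' ∈ Icc (0 : ℝ) 1)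
    (he : (AffineMap.lineMap (G.pos s zK zC (passesOver s x y zK zC) t (G.inner i))
        (G.pos s zK zC (passesOver s x y zK zC) t (G.outer i)) r : Space) =
      AffineMap.lineMap (G.pos s zK zC (passesOver s x y zK zC) t (G.inner i'))
        (G.pos s zK zC (passesOver s x y zK zC) t (G.outer i')) r') :
    (G.inner i = G.inner i' ∧ G.outer i = G.outer i' ∧ r = r') ∨
      (r = 0 ∧ r' = 0 ∧ G.inner i = G.inner i') ∨
        (r = 1 ∧ r' = 1 ∧ G.outer i = G.outer i') := by
  obtain ⟨⟨w, u, k⟩, hk⟩ := i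
  obtain ⟨⟨w', u', k'⟩, hk'⟩ := i'
  simp only [inner, outer] at he hk hk' ⊢
  have hX := G.strictMono_Xt ht
  have hY := G.strictMono_Yt ht
  have e0 := congrArg (fun v : Space => v 0) he
  have e1 := congrArg (fun v : Space => v 1) he
  have hcomb : ∀ A B ρ : ℝ, A + ρ * (B - A) = (1 - ρ) * A + ρ * B := fun A B ρ => by ring
  simp only [lineMap_apply_coord, pos_center_zero G h, pos_side_zero G h, pos_center_one G h,
    pos_side_one G h, hcomb] at e0 e1
  have bX : ∀ (w u : W) (k : Fin 4) {r : ℝ}, r ∈ Icc (0 : ℝ) 1 →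
      G.Xt t (G.cx u - 1) ≤ (1 - r) * (G.Xt t (G.cx u) + t * (midPoint (G.conn s w u)).1) +
        r * G.Xt t (G.cx u + sideX k) ∧
      (1 - r) * (G.Xt t (G.cx u) + t * (midPoint (G.conn s w u)).1) +
        r * G.Xt t (G.cx u + sideX k) ≤ G.Xt t (G.cx u + 1) ∧
      ((1 - r) * (G.Xt t (G.cx u) + t * (midPoint (G.conn s w u)).1) +
        r * G.Xt t (G.cx u + sideX k) = G.Xt t (G.cx u - 1) → r = 1) ∧
      ((1 - r) * (G.Xt t (G.cx u) + t * (midPoint (G.conn s w u)).1) +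
        r * G.Xt t (G.cx u + sideX k) = G.Xt t (G.cx u + 1) → r = 1) := fun w u k r hr => by
    have hk := mem_Icc_sideX k
    exact strip_bounds (add_quarter_lt G.strictMono_X ht (by omega))
      (add_quarter_lt G.strictMono_X ht (by omega)) ht.1 (abs_midPoint_le _).1
      ⟨hX.monotone (by omega), hX.monotone (by omega)⟩ hr
  have bY : ∀ (w u : W) (k : Fin 4) {r : ℝ}, r ∈ Icc (0 : ℝ) 1 →
      G.Yt t (G.cy w - 1) ≤ (1 - r) * (G.Yt t (G.cy w) + t * (midPoint (G.conn s w u)).2) +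
        r * G.Yt t (G.cy w + sideY k) ∧
      (1 - r) * (G.Yt t (G.cy w) + t * (midPoint (G.conn s w u)).2) +
        r * G.Yt t (G.cy w + sideY k) ≤ G.Yt t (G.cy w + 1) ∧
      ((1 - r) * (G.Yt t (G.cy w) + t * (midPoint (G.conn s w u)).2) +
        r * G.Yt t (G.cy w + sideY k) = G.Yt t (G.cy w - 1) → r = 1) ∧
      ((1 - r) * (G.Yt t (G.cy w) + t * (midPoint (G.conn s w u)).2) +
        r * G.Yt t (G.cy w + sideY k) = G.Yt t (G.cy w + 1) → r = 1) := fun w u k r hr => by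
    have hk := mem_Icc_sideX k
    exact strip_bounds (add_quarter_lt G.strictMono_Y ht (by omega))
      (add_quarter_lt G.strictMono_Y ht (by omega)) ht.1 (abs_midPoint_le _).2
      ⟨hY.monotone (by omega), hY.monotone (by omega)⟩ hr
  obtain ⟨x1, x2, x3, x4⟩ := bX w u k hr
  obtain ⟨x1', x2', x3', x4'⟩ := bX w' u' k' hr'
  obtain ⟨y1, y2, y3, y4⟩ := bY w u k hr
  obtain ⟨y1', y2', y3', y4'⟩ := bY w' u' k' hr'
  have hend : r = 1 → r' = 1 → G.side w u k = G.side w' u' k' := by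
    rintro rfl rfl
    simp only [sub_self, zero_mul, one_mul, zero_add] at e0 e1
    rw [side, side, hX.injective e0, hY.injective e1]
  by_cases hu : u = u'
  · by_cases hw : w = w'
    · subst hu hw
      have hloc := tile_injective (G.isBalanced_conn h.apply_ne w u) ht.1
        (dX := fun k => G.Xt t (G.cx u + sideX k) - G.Xt t (G.cx u))
        (dY := fun k => G.Yt t (G.cy w + sideY k) - G.Yt t (G.cy w))
        (lt_sub_iff_add_lt'.2 (add_quarter_lt G.strictMono_X ht (by simp [sideX])))
        (by simp [sideX])
        (by
          have := add_quarter_lt G.strictMono_X ht (a := G.cx u + sideX 2) (b := G.cx u)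
            (by simp [sideX])
          simp only [Xt]; linarith)
        (by simp [sideX]) (by simp [sideY])
        (lt_sub_iff_add_lt'.2 (add_quarter_lt G.strictMono_Y ht (by simp [sideY])))
        (by simp [sideY])
        (by
          have := add_quarter_lt G.strictMono_Y ht (a := G.cy w + sideY 3) (b := G.cy w)
            (by simp [sideY])
          simp only [Yt]; linarith)
        hk hk' hr.1 hr'.1 (by linarith) (by linarith)
      rcases hloc with ⟨rfl, rfl⟩ | ⟨rfl, rfl, hb | ⟨hall, hb⟩⟩
      · exact Or.inl ⟨rfl, rfl, rfl⟩
      · exact Or.inr (Or.inl ⟨rfl, rfl, by rw [hb]⟩)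
      · simp only [AffineMap.lineMap_apply_zero] at he
        exact absurd he (G.pos_center_ne h hall ht hb)
    · right; right
      -- Segments sit at even positions, so an odd position lies between the two rows, and a common
      -- point must be on the boundary of both strips.
      rcases lt_or_gt_of_ne (G.cy_inj.not.2 hw) with hlt | hlt
      · have := hY.monotone (even_pos_far (G.even_cy w) (G.even_cy w') hlt)
        have h1 := y4 (by linarith)
        have h2 := y3' (by linarith)
        exact ⟨h1, h2, hend h1 h2⟩
      · have := hY.monotone (even_pos_far (G.even_cy w') (G.even_cy w) hlt)
        have h1 := y3 (by linarith)
        have h2 := y4' (by linarith)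
        exact ⟨h1, h2, hend h1 h2⟩
  · right; right
    rcases lt_or_gt_of_ne (G.cx_inj.not.2 hu) with hlt | hlt
    · have := hX.monotone (even_pos_far (G.even_cx u) (G.even_cx u') hlt)
      have h1 := x4 (by linarith)
      have h2 := x3' (by linarith)
      exact ⟨h1, h2, hend h1 h2⟩
    · have := hX.monotone (even_pos_far (G.even_cx u') (G.even_cx u) hlt)
      have h1 := x3 (by linarith)
      have h2 := x4' (by linarith)
      exact ⟨h1, h2, hend h1 h2⟩

end GridChart

/-- Every tame link is represented by a mosaic of traditional tiles. -/
theorem IsTameLink.exists_mosaic {K : Set Space} (hK : IsTameLink K) :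
    ∃ (n : ℕ) (M : TileArray n), SuitablyConnected sidePoint M ∧
      AmbientIsotopic (drawing sidePoint M) K := by
  obtain ⟨L, hL, hLK⟩ := hK
  obtain ⟨W, _, _, s, x, y, zK, zC, h, hiso⟩ := hL.exists_gridCycle
  obtain ⟨G⟩ := h.nonempty_gridChart
  refine ⟨_, G.mosaic s (GridChart.passesOver s x y zK zC), G.suitablyConnected_mosaic h.apply_ne _, ?_⟩
  refine AmbientIsotopic.trans (AmbientIsotopic.symm ?_) hLK
  refine hiso.trans ?_
  rw [← G.iUnion_segment_gridPos h, ← G.iUnion_segment_tilePos h.apply_ne]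
  exact ambientIsotopic_of_edges G.inner G.outer G.inner_ne_outer _ _
    fun t ht i i' r hr r' hr' he => G.pos_injective h ht i i' hr hr' he

section

/-! ### The uppermost run of tiles -/

/-- The connection points of a tile, as a table. -/
def Tile.conn : Tile → Fin 4 → Bool
  | .T0 => ![false, false, false, false]
  | .T1 => ![false, false, true, true]
  | .T2 => ![true, false, false, true]
  | .T3 => ![true, true, false, false]
  | .T4 => ![false, true, true, false]
  | .T5 => ![true, false, true, false]
  | .T6 => ![false, true, false, true]
  | .T7 => ![true, true, true, true]
  | .T8 => ![true, true, true, true]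
  | .T9 => ![true, true, true, true]
  | .T10 => ![true, true, true, true]

theorem Tile.isConnection_iff (T : Tile) (k : Fin 4) : T.IsConnection k ↔ T.conn k = true := by
  cases T <;> fin_cases k <;>
    simp [Tile.IsConnection, Tile.strands, Strand.first, Strand.last, Tile.conn]

theorem Tile.eq_T2 {T : Tile} (h0 : T ≠ .T0) (h1 : T.conn 1 = false) (h2 : T.conn 2 = false) :
    T = .T2 := by
  cases T <;> simp_all [Tile.conn]

theorem Tile.eq_T5_or_T1 {T : Tile} (h1 : T.conn 1 = false) (h2 : T.conn 2 = true) :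
    T = .T5 ∨ T = .T1 := by
  cases T <;> simp_all [Tile.conn]

variable {n : ℕ} {M : TileArray n}

theorem SuitablyConnected.exists_neighbour (h : SuitablyConnected sidePoint M) {i j : Fin n}
    {k : Fin 4} (hk : (M i j).conn k = true) :
    ∃ i' j' : Fin n, (j' : ℤ) = j + sideX k ∧ -(i' : ℤ) = -i + sideY k ∧
      (M i' j').conn (k + 2) = true := by
  obtain ⟨⟨i', j'⟩, ⟨hne, l, hl, hp⟩, -⟩ := h i j k ((Tile.isConnection_iff _ _).2 hk)
  rw [place_sidePoint_eq_iff] at hp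
  rw [Tile.isConnection_iff] at hl
  obtain rfl : l = k + 2 := by
    simp only [ne_eq, Prod.mk.injEq, not_and_or, Fin.ext_iff] at hne hp
    revert hp
    clear hk hl
    fin_cases k <;> fin_cases l <;> simp [sideX, sideY] <;> omega
  refine ⟨i', j', ?_, ?_, hl⟩ <;>
  · revert hp
    clear hk hl
    fin_cases k <;> simp [sideX, sideY] <;> omega

/-- The uppermost row of tiles that are not blank begins with a run from a lower right arc to
a lower left arc. -/
structure IsTopRun (M : TileArray n) (r a b : Fin n) : Prop where
  lt : a < b
  blank_above : ∀ i j, i < r → M i j = .T0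
  blank_left : ∀ j, j < a → M r j = .T0
  left : M r a = .T2
  mid : ∀ c, a < c → c < b → M r c = .T5
  right : M r b = .T1

/-- In the uppermost non-blank row no tile has an upper connection, as its partner would be above.
The leftmost tile has no left connection either, so it must be `T2`. Its right connection is
continued by `T5`, or ended by `T1`, the only tiles with a left and no upper connection. -/
theorem SuitablyConnected.exists_topRun (h : SuitablyConnected sidePoint M)
    (hM : ∃ i j, M i j ≠ .T0) : ∃ r a b, IsTopRun M r a b := by
  classical
  obtain ⟨r, ⟨j₀, hj₀⟩, hr⟩ := (Set.toFinite {i | ∃ j, M i j ≠ .T0}).exists_minimal hM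
  obtain ⟨a, ha, ha'⟩ := (Set.toFinite {j | M r j ≠ .T0}).exists_minimal ⟨j₀, hj₀⟩
  have above : ∀ i j, i < r → M i j = .T0 := fun i j hi => by
    by_contra hne
    exact absurd (hr (show i ∈ {i | ∃ j, M i j ≠ .T0} from ⟨j, hne⟩) hi.le) (not_le.2 hi)
  have left : ∀ j, j < a → M r j = .T0 := fun j hj => by
    by_contra hne
    exact absurd (ha' (show j ∈ {j | M r j ≠ .T0} from hne) hj.le) (not_le.2 hj)
  have top : ∀ j, (M r j).conn 1 = false := fun j => by
    by_contra hne
    obtain ⟨i', j', -, hi, hc⟩ := h.exists_neighbour (Bool.not_eq_false _ ▸ hne)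
    rw [above i' j' (by simp [sideY] at hi; omega)] at hc
    exact absurd hc (by decide)
  have hT2 : M r a = .T2 := Tile.eq_T2 ha (top a) (by
    by_contra hne
    obtain ⟨i', j', hj, hi, hc⟩ := h.exists_neighbour (Bool.not_eq_false _ ▸ hne)
    simp [sideX, sideY] at hi hj
    obtain rfl : i' = r := Fin.ext (by omega)
    rw [left j' (by omega)] at hc
    exact absurd hc (by decide))
  -- The induction is on the number of remaining columns; it ends because a right connection always
  -- has a neighbour inside the array.
  have step : ∀ (m : ℕ) (c : Fin n), n - c.val = m → a ≤ c → (M r c).conn 0 = true →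
      (∀ d, a < d → d ≤ c → M r d = .T5) → ∃ b, a < b ∧ M r b = .T1 ∧
        ∀ d, a < d → d < b → M r d = .T5 := by
    intro m
    induction m with
    | zero => intro c hc; omega
    | succ m ih =>
      intro c hm hac hc hmid
      obtain ⟨i', j', hj, hi, hc'⟩ := h.exists_neighbour hc
      simp [sideX, sideY] at hi hj
      obtain rfl : i' = r := Fin.ext (by omega)
      rcases Tile.eq_T5_or_T1 (top j') hc' with h5 | h1
      · refine ih j' (by omega) (by omega) (by rw [h5]; rfl) fun d hd hd' => ?_
        rcases eq_or_ne d j' with rfl | hne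
        · exact h5
        · exact hmid d hd (by omega)
      · exact ⟨j', by omega, h1, fun d hd hd' => hmid d hd (by omega)⟩
  obtain ⟨b, hab, hb, hmid⟩ := step _ a rfl le_rfl (by rw [hT2]; rfl) fun d hd hd' => by omega
  exact ⟨r, a, b, hab, above, left, hT2, hmid, hb⟩

/-! ### The corner connection mosaic -/

/-- Whether a tile belongs to the run. -/
def inRun (r a b : Fin n) (q : Fin n × Fin n) : Prop := q.1 = r ∧ a ≤ q.2 ∧ q.2 ≤ b

instance (r a b : Fin n) (q : Fin n × Fin n) : Decidable (inRun r a b q) :=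
  inferInstanceAs (Decidable (_ ∧ _ ∧ _))

/-- The tiles of the run are shifted by half a tile in diagonal direction. -/
def runShift (r a b : Fin n) (q : Fin n × Fin n) : ℕ := if inRun r a b q then 1 else 0

theorem runShift_le (r a b : Fin n) (q : Fin n × Fin n) : runShift r a b q ≤ 1 := by
  unfold runShift; split_ifs <;> simp

/-- The position of a tile in the corner connection mosaic. -/
def newPos (r a b : Fin n) (q : Fin n × Fin n) : Fin (2 * n) × Fin (2 * n) :=
  (⟨n + q.1 - q.2, by omega⟩, ⟨q.1 + q.2 + runShift r a b q, by
    have := runShift_le r a b q; omega⟩)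

/-- The tile at this position. -/
def newTile (M : TileArray n) (r a b : Fin n) (q : Fin n × Fin n) : Tile :=
  if inRun r a b q then (if q.2 = b then .T0 else .T5) else M q.1 q.2

/-- The corner connection mosaic, in which the run is replaced by a straight line. -/
noncomputable def cornerMosaic (M : TileArray n) (r a b : Fin n) : TileArray (2 * n) := fun I J =>
  Function.extend (newPos r a b) (newTile M r a b) (fun _ => .T0) (I, J)

/-- The new row determines `i - j` and thus the parity of `i + j`, so a shift by 1 cannot be
mistaken for a change of `i + j`. -/
theorem newPos_injective (r a b : Fin n) : Function.Injective (newPos r a b) := by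
  rintro ⟨i, j⟩ ⟨i', j'⟩ h
  simp only [newPos, Prod.mk.injEq, Fin.mk.injEq] at h
  have h1 := runShift_le r a b (i, j)
  have h2 := runShift_le r a b (i', j')
  obtain ⟨e1, e2⟩ := h
  exact Prod.ext (Fin.ext (by simp only; omega)) (Fin.ext (by simp only; omega))

theorem cornerMosaic_newPos (r a b : Fin n) (q : Fin n × Fin n) :
    cornerMosaic M r a b (newPos r a b q).1 (newPos r a b q).2 = newTile M r a b q :=
  (newPos_injective r a b).extend_apply _ _ q

theorem exists_newPos_of_ne {r a b : Fin n} {I J : Fin (2 * n)}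
    (h : cornerMosaic M r a b I J ≠ .T0) : ∃ q, newPos r a b q = (I, J) := by
  by_contra hne
  exact h (Function.extend_apply' _ _ _ hne)

theorem IsTopRun.ne_of_newTile_ne {r a b : Fin n} (h : IsTopRun M r a b) {q : Fin n × Fin n}
    (hq : newTile M r a b q ≠ .T0) : M q.1 q.2 ≠ .T0 ∧ q ≠ (r, b) := by
  obtain ⟨i, j⟩ := q
  simp only [newTile] at hq
  split_ifs at hq with h1 h2
  · exact absurd rfl hq
  · obtain ⟨rfl, h3, h4⟩ := h1
    simp only at h3 h4 h2 ⊢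
    refine ⟨?_, fun he => h2 (Prod.ext_iff.1 he).2⟩
    rcases h3.eq_or_lt with rfl | h3
    · rw [h.left]; decide
    · rw [h.mid j h3 (lt_of_le_of_ne h4 h2)]; decide
  · exact ⟨hq, fun he => h1 (by rw [he]; exact ⟨rfl, h.lt.le, le_rfl⟩)⟩

/-- Every non-blank new tile comes from its own old tile, and the last tile of the run, which was
`T1`, becomes blank. -/
theorem IsTopRun.tileCount_lt {r a b : Fin n} (h : IsTopRun M r a b) :
    tileCount (cornerMosaic M r a b) < tileCount M := by
  classical
  have hb : (r, b) ∈ Finset.univ.filter fun q : Fin n × Fin n => M q.1 q.2 ≠ .T0 := by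
    simp [h.right]
  refine lt_of_le_of_lt ?_ (Finset.card_erase_lt_of_mem hb)
  refine (Finset.card_le_card fun p hp => ?_).trans (Finset.card_image_le (f := newPos r a b))
  obtain ⟨I, J⟩ := p
  simp only [Finset.mem_filter, Finset.mem_univ, true_and] at hp
  obtain ⟨q, hq⟩ := exists_newPos_of_ne hp
  obtain ⟨rfl, rfl⟩ := Prod.ext_iff.1 hq
  rw [cornerMosaic_newPos] at hp
  obtain ⟨h1, h2⟩ := h.ne_of_newTile_ne hp
  simp only [Finset.mem_image, Finset.mem_erase, Finset.mem_filter, Finset.mem_univ, true_and]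
  exact ⟨q, ⟨h2, h1⟩, rfl⟩

end

/-! ### Suitable connectedness of the corner connection mosaic -/

section

variable {n : ℕ} {M : TileArray n} {r a b : Fin n}

theorem cornerPoint_eq (k : Fin 4) :
    cornerPoint k = ((sideX k - sideY k : ℝ), (sideX k + sideY k : ℝ)) := by
  fin_cases k <;> simp [cornerPoint, sideX, sideY]

/-- The integer coordinates, in the given mosaic, of a connection point. -/
def newX (r a b : Fin n) (q : Fin n × Fin n) (k : Fin 4) : ℤ :=
  2 * q.2 + runShift r a b q + sideX k

/-- The integer coordinates, in the given mosaic, of a connection point. -/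
def newY (r a b : Fin n) (q : Fin n × Fin n) (k : Fin 4) : ℤ :=
  -2 * q.1 - runShift r a b q + sideY k

theorem place_newPos (r a b : Fin n) (q : Fin n × Fin n) (k : Fin 4) :
    place (newPos r a b q).1 (newPos r a b q).2 (cornerPoint k) 0 =
      !₂[((newX r a b q k - newY r a b q k : ℤ) : ℝ),
        ((newX r a b q k + newY r a b q k - 2 * n : ℤ) : ℝ), 0] := by
  have h : (q.2 : ℕ) ≤ n + q.1 := by omega
  refine space_ext ?_ ?_ ?_ <;>
    simp [place, cornerPoint_eq, newPos, newX, newY, Nat.cast_sub h] <;> ring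

theorem place_newPos_eq_iff (q q' : Fin n × Fin n) (k l : Fin 4) :
    place (newPos r a b q).1 (newPos r a b q).2 (cornerPoint k) 0 =
        place (newPos r a b q').1 (newPos r a b q').2 (cornerPoint l) 0 ↔
      newX r a b q k = newX r a b q' l ∧ newY r a b q k = newY r a b q' l := by
  rw [place_newPos, place_newPos]
  constructor
  · intro h
    have h0 := congrArg (fun v : Space => v 0) h
    have h1 := congrArg (fun v : Space => v 1) h
    simp only [Matrix.cons_val_zero, Matrix.cons_val_one] at h0 h1
    have h0' : newX r a b q k - newY r a b q k = newX r a b q' l - newY r a b q' l := by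
      exact_mod_cast h0
    have h1' : newX r a b q k + newY r a b q k - 2 * n =
      newX r a b q' l + newY r a b q' l - 2 * n := by exact_mod_cast h1
    omega
  · rintro ⟨h0, h1⟩
    rw [h0, h1]

/-- Positions that no old tile is sent to are blank, so the condition can be checked in the integer
coordinates of the given mosaic. -/
theorem suitablyConnected_of_newTile
    (h : ∀ q k, (newTile M r a b q).conn k = true → ∃! q', q' ≠ q ∧ ∃ l,
      (newTile M r a b q').conn l = true ∧ newX r a b q' l = newX r a b q k ∧
        newY r a b q' l = newY r a b q k) :
    SuitablyConnected cornerPoint (cornerMosaic M r a b) := by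
  intro I J k hk
  have hconn : ∀ {I J k}, (cornerMosaic M r a b I J).IsConnection k → ∃ q,
      newPos r a b q = (I, J) := fun {I J k} hk => exists_newPos_of_ne fun h0 => by
    rw [h0, Tile.isConnection_iff] at hk
    revert hk
    clear h0
    fin_cases k <;> decide
  obtain ⟨q, hq⟩ := hconn hk
  obtain ⟨rfl, rfl⟩ := Prod.ext_iff.1 hq
  rw [cornerMosaic_newPos, Tile.isConnection_iff] at hk
  obtain ⟨q', ⟨hne, l, hl, hx, hy⟩, huniq⟩ := h q k hk
  refine ⟨newPos r a b q', ⟨fun he => hne (newPos_injective r a b he), l, ?_, ?_⟩, ?_⟩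
  · rw [cornerMosaic_newPos, Tile.isConnection_iff]; exact hl
  · rw [place_newPos_eq_iff]; exact ⟨hx, hy⟩
  · rintro ⟨I', J'⟩ ⟨hne', l', hl', hp⟩
    obtain ⟨q₂, hq₂⟩ := hconn hl'
    obtain ⟨rfl, rfl⟩ := Prod.ext_iff.1 hq₂
    simp only at hl' hp
    rw [cornerMosaic_newPos, Tile.isConnection_iff] at hl'
    rw [place_newPos_eq_iff] at hp
    rw [Prod.mk.eta, huniq q₂ ⟨fun he => hne' (by rw [he]), l', hl', hp⟩]

/-- Away from the run the partners stay the same. The new straight tiles are linked at the midpoints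
of the lower sides of the old run. At the two ends they meet the tiles below; at the midpoints in
between nothing else arrives, since the old `T5` had no lower connection. This matters because four
corner tiles may touch at one point. -/
theorem IsTopRun.suitablyConnected (hR : IsTopRun M r a b)
    (hM : SuitablyConnected sidePoint M) :
    SuitablyConnected cornerPoint (cornerMosaic M r a b) := by
  have hab := hR.lt
  have hTa : (M r a).conn = ![true, false, false, true] := by rw [hR.left]; rfl
  have hTb : (M r b).conn = ![false, false, true, true] := by rw [hR.right]; rfl
  have hTc : ∀ c, a < c → c < b → (M r c).conn = ![true, false, true, false] := fun c h1 h2 => by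
    rw [hR.mid c h1 h2]; rfl
  have new : ∀ q k, (newTile M r a b q).conn k = true ↔
      (¬ inRun r a b q ∧ (M q.1 q.2).conn k = true) ∨
        (q.1 = r ∧ a ≤ q.2 ∧ q.2 < b ∧ (k = 0 ∨ k = 2)) := fun q k => by
    have h0 : Tile.T0.conn k = false := by fin_cases k <;> rfl
    have h5 : Tile.T5.conn k = true ↔ k = 0 ∨ k = 2 := by fin_cases k <;> decide
    simp only [newTile]
    split_ifs with h1 h2
    · simp [h0, h1, h2]
    · rw [h5]
      have h3 : q.1 = r := h1.1
      have h4 : a ≤ q.2 := h1.2.1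
      have h6 : q.2 < b := lt_of_le_of_ne h1.2.2 h2
      tauto
    · have h3 : ¬ (q.1 = r ∧ a ≤ q.2 ∧ q.2 < b) := fun h => h1 ⟨h.1, h.2.1, h.2.2.le⟩
      tauto
  have hn : ∀ q k, ¬ inRun r a b q → newX r a b q k = 2 * q.2 + sideX k ∧
      newY r a b q k = -2 * q.1 + sideY k := fun q k h => by
    simp [newX, newY, runShift, h]
  have hr : ∀ q k, q.1 = r → a ≤ q.2 → q.2 < b → newX r a b q k = 2 * q.2 + 1 + sideX k ∧
      newY r a b q k = -2 * r - 1 + sideY k := fun q k h1 h2 h3 => by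
    have : inRun r a b q := ⟨h1, h2, h3.le⟩
    simp [newX, newY, runShift, this, h1]
  -- a tile outside the run only touches the run from below at its ends
  have below : ∀ i j k, ¬ inRun r a b (i, j) → (M i j).conn k = true → ∀ c : Fin n, a ≤ c →
      c ≤ b → 2 * (j : ℤ) + sideX k = 2 * c → -2 * (i : ℤ) + sideY k = -2 * r - 1 →
        k = 1 ∧ (i : ℕ) = r + 1 ∧ j = c ∧ (c = a ∨ c = b) := by
    intro i j k hq hk c hac hcb hx hy
    obtain ⟨i', j', hj', hi', hk'⟩ := hM.exists_neighbour hk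
    have hk1 : k = 1 := by
      fin_cases k <;> simp [sideX, sideY] at hx hy ⊢
      · omega
      · omega
      · exact hq ⟨Fin.ext (by simp only; omega), by simp only; omega, by simp only; omega⟩
    subst hk1
    simp [sideX, sideY] at hx hy hi' hj'
    obtain rfl : j = c := Fin.ext (by omega)
    obtain rfl : i' = r := Fin.ext (by omega)
    obtain rfl : j' = j := Fin.ext (by omega)
    refine ⟨rfl, by omega, rfl, ?_⟩
    by_contra hne
    rw [hTc j' (by omega) (by omega)] at hk'
    exact absurd hk' (by decide)
  have ends : ∀ c, c = a ∨ c = b → ∃ i : Fin n, (i : ℕ) = r + 1 ∧ (M i c).conn 1 = true := by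
    intro c hc
    have h3 : (M r c).conn 3 = true := by
      rcases hc with rfl | rfl
      · rw [hTa]; rfl
      · rw [hTb]; rfl
    obtain ⟨i', j', hj', hi', hk'⟩ := hM.exists_neighbour h3
    simp [sideX, sideY] at hi' hj'
    obtain rfl : j' = c := Fin.ext (by omega)
    exact ⟨i', by omega, hk'⟩
  have notRun : ∀ i j : Fin n, (i : ℕ) = r + 1 → ¬ inRun r a b (i, j) := fun i j h h' => by
    have := congrArg Fin.val h'.1
    simp only at this
    omega
  refine suitablyConnected_of_newTile fun q k hk => ?_
  obtain ⟨i, j⟩ := q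
  have hk₀ := (new _ _).1 hk
  clear hk
  rcases hk₀ with ⟨hq, hk⟩ | ⟨hi, haj, hjb, hk02⟩
  · obtain ⟨ex, ey⟩ := hn (i, j) k hq
    simp only at ex ey hk
    obtain ⟨i', j', hj', hi', hk'⟩ := hM.exists_neighbour hk
    -- If the old partner was in the run, the tile lies directly below one of its two ends and now
    -- meets the first or the last of the straight tiles.
    by_cases hq' : inRun r a b (i', j')
    · have hi'r : i' = r := hq'.1
      have haj' : a ≤ j' := hq'.2.1
      have hj'b : j' ≤ b := hq'.2.2
      subst hi'r
      have hk1 : k = 1 := by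
        by_contra hne
        have hne' : k ≠ 3 := by
          rintro rfl
          change (M i' j').conn 1 = true at hk'
          rcases haj'.eq_or_lt with rfl | h1
          · rw [hTa] at hk'; exact absurd hk' (by decide)
          · rcases hj'b.eq_or_lt with rfl | h2
            · rw [hTb] at hk'; exact absurd hk' (by decide)
            · rw [hTc _ h1 h2] at hk'; exact absurd hk' (by decide)
        have hii : i = i' := Fin.ext (by
          clear hk hk' ex ey
          revert hi' hne hne'
          fin_cases k <;> simp [sideY] <;> omega)
        refine hq ⟨hii, ?_⟩
        simp only
        clear ex ey
        have h02 : k = 0 ∨ k = 2 := by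
          clear hk hk' hi' hj'
          revert hne hne'
          fin_cases k <;> simp
        rcases h02 with rfl | rfl
        · simp [sideX] at hj'
          refine ⟨?_, by omega⟩
          rcases haj'.eq_or_lt with rfl | h1
          · rw [hTa] at hk'; exact absurd hk' (by decide)
          · omega
        · simp [sideX] at hj'
          refine ⟨by omega, ?_⟩
          rcases hj'b.eq_or_lt with rfl | h1
          · rw [hTb] at hk'; exact absurd hk' (by decide)
          · omega
      subst hk1
      simp [sideX, sideY] at hi' hj' ex ey
      obtain rfl : j' = j := Fin.ext (by omega)
      obtain ⟨-, -, -, hab'⟩ := below i j' 1 hq hk j' haj' hj'b (by simp [sideX])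
        (by simp [sideY]; omega)
      have uniq : ∀ q' l, q' ≠ (i, j') → (newTile M i' a b q').conn l = true →
          newX i' a b q' l = newX i' a b (i, j') 1 → newY i' a b q' l = newY i' a b (i, j') 1 →
            q'.1 = i' ∧ a ≤ q'.2 ∧ q'.2 < b ∧ ((l = 0 ∧ (q'.2 : ℕ) + 1 = j') ∨
              (l = 2 ∧ (q'.2 : ℕ) = j')) := by
        rintro ⟨i₂, j₂⟩ l hne hl hx hy
        rcases (new _ _).1 hl with ⟨hq₂, hl⟩ | ⟨h1, h2, h3, h4⟩
        · obtain ⟨fx, fy⟩ := hn _ l hq₂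
          obtain ⟨-, h5, h6, -⟩ := below i₂ j₂ l hq₂ hl j' haj' hj'b (by simp only at fx; omega)
            (by simp only at fy; omega)
          exact absurd (Prod.ext (Fin.ext (by simp only; omega)) h6) hne
        · refine ⟨h1, h2, h3, ?_⟩
          obtain ⟨fx, fy⟩ := hr _ l h1 h2 h3
          rw [fx, ex] at hx
          simp only at hx h2 h3 ⊢
          rcases h4 with rfl | rfl <;> simp [sideX] at hx ⊢ <;> omega
      rcases hab' with rfl | rfl
      · obtain ⟨fx, fy⟩ := hr (i', j') 2 rfl le_rfl hab
        refine ⟨(i', j'), ⟨?_, 2, (new _ _).2 (Or.inr ⟨rfl, le_rfl, hab, Or.inr rfl⟩), ?_, ?_⟩, ?_⟩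
        · intro h; have := congrArg Fin.val (Prod.ext_iff.1 h).1; simp only at this; omega
        · rw [fx, ex]; simp [sideX]
        · rw [fy, ey]; simp [sideY]; omega
        · rintro q' ⟨hne, l, hl, hx, hy⟩
          obtain ⟨h1, h2, h3, h4⟩ := uniq q' l hne hl hx hy
          exact Prod.ext h1 (Fin.ext (by simp only; omega))
      · let d : Fin n := ⟨j' - 1, by omega⟩
        have had : a ≤ d := by change a.val ≤ j' - 1; omega
        have hdb : d < j' := by change j'.val - 1 < j'; omega
        have hd : ((d : ℕ) : ℤ) = j' - 1 := by change ((j' - 1 : ℕ) : ℤ) = _; omega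
        obtain ⟨fx, fy⟩ := hr (i', d) 0 rfl had hdb
        refine ⟨(i', d), ⟨?_, 0, (new _ _).2 (Or.inr ⟨rfl, had, hdb, Or.inl rfl⟩), ?_, ?_⟩, ?_⟩
        · intro h; have := congrArg Fin.val (Prod.ext_iff.1 h).1; simp only at this; omega
        · rw [fx, ex]; simp [sideX]; omega
        · rw [fy, ey]; simp [sideY]; omega
        · rintro q' ⟨hne, l, hl, hx, hy⟩
          obtain ⟨h1, h2, h3, h4⟩ := uniq q' l hne hl hx hy
          exact Prod.ext h1 (Fin.ext (by simp only; omega))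
    · obtain ⟨gx, gy⟩ := hn (i', j') (k + 2) hq'
      simp only at gx gy
      refine ⟨(i', j'), ⟨?_, k + 2, (new _ _).2 (Or.inl ⟨hq', hk'⟩), ?_, ?_⟩, ?_⟩
      · intro h
        obtain ⟨rfl, rfl⟩ := Prod.ext_iff.1 h
        clear ex ey gx gy hk hk'
        revert hi' hj'
        fin_cases k <;> simp [sideX, sideY]
      · rw [gx, ex]
        clear ex ey gx gy hk hk'
        revert hi' hj'
        fin_cases k <;> simp [sideX, sideY] <;> omega
      · rw [gy, ey]
        clear ex ey gx gy hk hk'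
        revert hi' hj'
        fin_cases k <;> simp [sideX, sideY] <;> omega
      · rintro ⟨i₂, j₂⟩ ⟨hne, l, hl, hx, hy⟩
        rw [ex] at hx
        rw [ey] at hy
        have hl₀ := (new _ _).1 hl
        clear hl
        rcases hl₀ with ⟨hq₂, hl⟩ | ⟨h1, h2, h3, h4⟩
        · obtain ⟨fx, fy⟩ := hn _ l hq₂
          rw [fx] at hx
          rw [fy] at hy
          simp only [ne_eq, Prod.mk.injEq, not_and_or, Fin.ext_iff] at hne hx hy ⊢
          clear ex ey gx gy hk hk' hl fx fy
          revert hi' hj' hx hy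
          fin_cases k <;> fin_cases l <;> simp [sideX, sideY] <;> omega
        · exfalso
          obtain ⟨fx, fy⟩ := hr _ l h1 h2 h3
          rw [fx] at hx
          rw [fy] at hy
          simp only at hx hy h1 h2 h3
          have h5 : ∃ c : Fin n, a ≤ c ∧ c ≤ b ∧ 2 * (j : ℤ) + sideX k = 2 * c ∧
              -2 * (i : ℤ) + sideY k = -2 * r - 1 := by
            rcases h4 with rfl | rfl
            · refine ⟨⟨j₂ + 1, by omega⟩, ?_, ?_, ?_, ?_⟩
              · change a.val ≤ j₂ + 1; omega
              · change j₂.val + 1 ≤ b; omega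
              · rw [← hx]; simp [sideX]; ring
              · rw [← hy]; simp [sideY]
            · refine ⟨j₂, h2, h3.le, ?_, ?_⟩
              · rw [← hx]; simp [sideX]
              · rw [← hy]; simp [sideY]
          obtain ⟨c, hac, hcb, hcx, hcy⟩ := h5
          obtain ⟨rfl, h6, rfl, -⟩ := below i j k hq hk c hac hcb hcx hcy
          simp [sideX, sideY] at hi' hj'
          exact hq' ⟨Fin.ext (by simp only; omega), by simp only; omega, by simp only; omega⟩
  · obtain rfl : i = r := hi
    simp only at haj hjb
    obtain ⟨ex, ey⟩ := hr (i, j) k rfl haj hjb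
    simp only at ex ey
    obtain ⟨c, hac, hcb, hcx, hck⟩ : ∃ c : Fin n, a ≤ c ∧ c ≤ b ∧ 2 * (j : ℤ) + 1 + sideX k = 2 * c ∧
        ((k = 0 ∧ (j : ℕ) + 1 = c) ∨ (k = 2 ∧ j = c)) := by
      rcases hk02 with rfl | rfl
      · refine ⟨⟨j + 1, by omega⟩, ?_, ?_, ?_, ?_⟩
        · change a.val ≤ j + 1; omega
        · change j.val + 1 ≤ b; omega
        · simp [sideX]; ring
        · simp
      · exact ⟨j, haj, hjb.le, by simp [sideX], by simp⟩
    have hsy : sideY k = 0 := by rcases hk02 with rfl | rfl <;> rfl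
    rw [hcx] at ex
    rw [hsy, add_zero] at ey
    rw [ex, ey]
    have uniq : ∀ q' l, q' ≠ (i, j) → (newTile M i a b q').conn l = true →
        newX i a b q' l = 2 * c → newY i a b q' l = -2 * i - 1 →
          ((q'.1 : ℕ) = i + 1 ∧ q'.2 = c ∧ (c = a ∨ c = b)) ∨
            (q'.1 = i ∧ a ≤ q'.2 ∧ q'.2 < b ∧ ((k = 2 ∧ (q'.2 : ℕ) + 1 = c) ∨
              (k = 0 ∧ q'.2 = c))) := by
      rintro ⟨i₂, j₂⟩ l hne hl hx hy
      rcases (new _ _).1 hl with ⟨hq₂, hl⟩ | ⟨h1, h2, h3, h4⟩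
      · left
        obtain ⟨fx, fy⟩ := hn _ l hq₂
        obtain ⟨-, h5, h6, h7⟩ := below i₂ j₂ l hq₂ hl c hac hcb (by simp only at fx; omega)
          (by simp only at fy; omega)
        exact ⟨h5, h6, h7⟩
      · right
        refine ⟨h1, h2, h3, ?_⟩
        obtain ⟨fx, fy⟩ := hr _ l h1 h2 h3
        rw [fx] at hx
        simp only [ne_eq, Prod.mk.injEq, not_and_or] at hx h1 h2 h3 hne ⊢
        have hne2 : (j₂ : ℕ) ≠ j := by
          rcases hne with h | h
          · exact absurd h1 h
          · exact fun he => h (Fin.ext he)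
        rcases h4 with rfl | rfl <;> rcases hck with ⟨rfl, hc⟩ | ⟨rfl, hc⟩ <;>
          simp [sideX, Fin.ext_iff] at hx hc ⊢ <;> omega
    -- The connection point is the midpoint of the lower side of the old tile in column `c`. At an
    -- end of the run the partner is the tile below; otherwise it is the adjacent straight tile.
    by_cases hend : c = a ∨ c = b
    · obtain ⟨i', hi', hk'⟩ := ends c hend
      obtain ⟨fx, fy⟩ := hn (i', c) 1 (notRun i' c hi')
      refine ⟨(i', c), ⟨?_, 1, (new _ _).2 (Or.inl ⟨notRun i' c hi', hk'⟩), ?_, ?_⟩, ?_⟩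
      · intro h; have := congrArg Fin.val (Prod.ext_iff.1 h).1; simp only at this; omega
      · rw [fx]; simp [sideX]
      · rw [fy]; simp [sideY]; omega
      · rintro q' ⟨hne, l, hl, hx, hy⟩
        rcases uniq q' l hne hl hx hy with ⟨h1, h2, -⟩ | ⟨h1, h2, h3, h4⟩
        · exact Prod.ext (Fin.ext (by simp only; omega)) h2
        · exfalso
          rcases h4 with ⟨rfl, h4⟩ | ⟨rfl, h4⟩ <;> rcases hck with ⟨h5, h6⟩ | ⟨h5, h6⟩ <;>
            simp at h5 <;> omega
    · push Not at hend
      rcases hck with ⟨rfl, hc⟩ | ⟨rfl, hc⟩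
      · have hcb' : c < b := lt_of_le_of_ne hcb hend.2
        obtain ⟨fx, fy⟩ := hr (i, c) 2 rfl hac hcb'
        refine ⟨(i, c), ⟨?_, 2, (new _ _).2 (Or.inr ⟨rfl, hac, hcb', Or.inr rfl⟩), ?_, ?_⟩, ?_⟩
        · intro h; have := congrArg Fin.val (Prod.ext_iff.1 h).2; simp only at this; omega
        · rw [fx]; simp [sideX]
        · rw [fy]; simp [sideY]
        · rintro q' ⟨hne, l, hl, hx, hy⟩
          rcases uniq q' l hne hl hx hy with ⟨h1, h2, h3⟩ | ⟨h1, h2, h3, h4⟩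
          · tauto
          · rcases h4 with ⟨h4, -⟩ | ⟨-, h4⟩
            · simp at h4
            · exact Prod.ext h1 h4
      · subst hc
        let d : Fin n := ⟨j - 1, by omega⟩
        have haj' : a < j := lt_of_le_of_ne haj (Ne.symm hend.1)
        have had : a ≤ d := by change a.val ≤ j - 1; omega
        have hdb : d < b := by change j.val - 1 < b; omega
        have hd : ((d : ℕ) : ℤ) = j - 1 := by change ((j - 1 : ℕ) : ℤ) = _; omega
        obtain ⟨fx, fy⟩ := hr (i, d) 0 rfl had hdb
        refine ⟨(i, d), ⟨?_, 0, (new _ _).2 (Or.inr ⟨rfl, had, hdb, Or.inl rfl⟩), ?_, ?_⟩, ?_⟩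
        · intro h; have := congrArg Fin.val (Prod.ext_iff.1 h).2; simp only at this; omega
        · rw [fx]; simp [sideX]; omega
        · rw [fy]; simp [sideY]
        · rintro q' ⟨hne, l, hl, hx, hy⟩
          rcases uniq q' l hne hl hx hy with ⟨h1, h2, h3⟩ | ⟨h1, h2, h3, h4⟩
          · tauto
          · rcases h4 with ⟨-, h4⟩ | ⟨h4, -⟩
            · exact Prod.ext h1 (Fin.ext (by simp only; omega))
            · simp at h4

end

/-! ### Flattening an arc above the rest of a link -/

section Flatten

variable {A B Y : ℝ} {g : ℝ → ℝ} {Q : Set Space}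

/-- The graph of a function over an interval, in a horizontal plane. -/
def graphArc (A B Y : ℝ) (g : ℝ → ℝ) : Set Space := {p | p 0 ∈ Icc A B ∧ p 1 = Y + g (p 0) ∧ p 2 = 0}

open Classical in
/-- The amount by which a point has to be moved. -/
noncomputable def flattening (A B Y : ℝ) (g : ℝ → ℝ) (p : Space) : ℝ :=
  if p ∈ graphArc A B Y g then g (p 0) else 0

/-- For two points of the arc this is the Lipschitz bound for `g`. A point `p` of the partly lowered
arc still lies on or above the line, and a point `q` outside lies at least `g (q 0)` below it. So `g
(q 0) ≤ δ`, and passing from `q 0` to `p 0` costs at most `3 * δ`. -/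
theorem abs_flattening_sub_le (hlip : ∀ x x', g x ≤ g x' + 3 * |x - x'|)
    (h0 : ∀ x ∈ Icc A B, 0 ≤ g x) (hQ : ∀ p ∈ Q, p 1 ≤ Y - g (p 0)) {p q : Space}
    (hp : p ∈ graphArc A B Y g ∪ Q) (hq : q ∈ graphArc A B Y g ∪ Q) {t : ℝ}
    (ht : t ∈ Icc (0 : ℝ) 1) {δ : ℝ} (hx : |p 0 - q 0| ≤ δ)
    (hy : |(p 1 - t * flattening A B Y g p) - (q 1 - t * flattening A B Y g q)| ≤ δ) :
    |flattening A B Y g p - flattening A B Y g q| ≤ 4 * δ := by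
  have hone : ∀ p q : Space, p ∈ graphArc A B Y g → q ∈ Q → q ∉ graphArc A B Y g →
      |p 0 - q 0| ≤ δ →
      |(p 1 - t * flattening A B Y g p) - (q 1 - t * flattening A B Y g q)| ≤ δ →
        |flattening A B Y g p - flattening A B Y g q| ≤ 4 * δ := by
    intro p q hp hq hq' hx hy
    rw [flattening, flattening, if_pos hp, if_neg hq'] at hy ⊢
    have h1 := hQ q hq
    have h2 := hlip (p 0) (q 0)
    have h3 := h0 _ hp.1
    have h4 := hp.2.1
    have h5 := (le_abs_self _).trans hy
    rw [sub_zero, abs_of_nonneg h3]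
    have h6 := mul_nonneg (sub_nonneg.2 ht.2) h3
    linarith
  by_cases hp' : p ∈ graphArc A B Y g <;> by_cases hq' : q ∈ graphArc A B Y g
  · have h1 := hlip (p 0) (q 0)
    have h2 := hlip (q 0) (p 0)
    rw [abs_sub_comm] at h2
    have h3 := (abs_nonneg _).trans hx
    rw [flattening, flattening, if_pos hp', if_pos hq', abs_le]
    constructor <;> linarith
  · exact hone p q hp' (hq.resolve_left hq') hq' hx hy
  · rw [abs_sub_comm] at hx hy ⊢
    exact hone q p hq' (hp.resolve_left hp') hp' hx hy
  · rw [flattening, flattening, if_neg hp', if_neg hq', sub_self, abs_zero]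
    have h3 := (abs_nonneg _).trans hx
    linarith

theorem ambientIsotopic_flatten (hlip : ∀ x x', g x ≤ g x' + 3 * |x - x'|)
    (h0 : ∀ x ∈ Icc A B, 0 ≤ g x) (hQ : ∀ p ∈ Q, p 1 ≤ Y - g (p 0)) :
    AmbientIsotopic (graphArc A B Y g ∪ Q) (graphArc A B Y 0 ∪ Q) := by
  let X := ↥(graphArc A B Y g ∪ Q)
  let h : Space → ℝ := flattening A B Y g
  have hdist : ∀ a b : Space, dist a b ≤ |a 0 - b 0| + |a 1 - b 1| + |a 2 - b 2| := fun a b => by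
    rw [dist_eq_norm]; exact norm_le_sum_abs _
  have hS : ∀ (a : X) (t : ℝ), (a : Space) + t • !₂[0, -h a, 0] =
      !₂[(a : Space) 0, (a : Space) 1 - t * h a, (a : Space) 2] := fun a t => by
    refine space_ext ?_ ?_ ?_ <;> simp [sub_eq_add_neg]
  have key : ∀ t ∈ Icc (0 : ℝ) 1, ∀ a b : X, |h a - h b| ≤
      4 * dist ((a : Space) + t • !₂[0, -h a, 0]) ((b : Space) + t • !₂[0, -h b, 0]) := by
    intro t ht a b
    rw [hS, hS]
    exact abs_flattening_sub_le hlip h0 hQ a.2 b.2 ht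
      (dist_coord_le !₂[(a : Space) 0, (a : Space) 1 - t * h a, (a : Space) 2]
        !₂[(b : Space) 0, (b : Space) 1 - t * h b, (b : Space) 2] 0)
      (dist_coord_le !₂[(a : Space) 0, (a : Space) 1 - t * h a, (a : Space) 2]
        !₂[(b : Space) 0, (b : Space) 1 - t * h b, (b : Space) 2] 1)
  have main := ambientIsotopic_of_gauge (X := X) (fun a b => dist (a : Space) b) Subtype.val
    (fun a => !₂[0, -h a, 0]) 4 (fun a b => dist_nonneg) (fun a b => by
      have h1 := key 0 ⟨le_rfl, zero_le_one⟩ a b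
      simp only [zero_smul, add_zero] at h1
      refine (hdist _ _).trans ?_
      simpa [abs_sub_comm, neg_add_eq_sub] using h1)
    -- The coordinate differences are at most `δ`, `5 * δ` and `δ`, so any constant up to 1/7 would
    -- serve.
    (fun t ht => ⟨1 / 13, by norm_num, fun a b => by
      have h1 := key t ht a b
      set δ := dist ((a : Space) + t • !₂[0, -h a, 0]) ((b : Space) + t • !₂[0, -h b, 0]) with hδ
      rw [hS, hS] at hδ
      have x0 := dist_coord_le !₂[(a : Space) 0, (a : Space) 1 - t * h a, (a : Space) 2]
        !₂[(b : Space) 0, (b : Space) 1 - t * h b, (b : Space) 2] 0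
      have x1 := dist_coord_le !₂[(a : Space) 0, (a : Space) 1 - t * h a, (a : Space) 2]
        !₂[(b : Space) 0, (b : Space) 1 - t * h b, (b : Space) 2] 1
      have x2 := dist_coord_le !₂[(a : Space) 0, (a : Space) 1 - t * h a, (a : Space) 2]
        !₂[(b : Space) 0, (b : Space) 1 - t * h b, (b : Space) 2] 2
      rw [← hδ] at x0 x1 x2
      change |(a : Space) 0 - (b : Space) 0| ≤ δ at x0
      change |(a : Space) 1 - t * h a - ((b : Space) 1 - t * h b)| ≤ δ at x1
      change |(a : Space) 2 - (b : Space) 2| ≤ δ at x2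
      have h2 := hdist (a : Space) b
      have h3 : |(a : Space) 1 - (b : Space) 1| ≤ δ + 4 * δ := by
        have h4 : (a : Space) 1 - (b : Space) 1 =
          ((a : Space) 1 - t * h a - ((b : Space) 1 - t * h b)) + t * (h a - h b) := by ring
        rw [h4]
        refine (abs_add_le _ _).trans (add_le_add x1 ?_)
        rw [abs_mul, abs_of_nonneg ht.1]
        exact (mul_le_of_le_one_left (abs_nonneg _) ht.2).trans h1
      have h5 : 0 ≤ δ := (abs_nonneg _).trans x0
      linarith⟩)
  rw [Subtype.range_val] at main
  convert main using 1
  have hS1 : ∀ a : X, (a : Space) + !₂[0, -h a, 0] =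
      !₂[(a : Space) 0, (a : Space) 1 - h a, (a : Space) 2] := fun a => by
    simpa using hS a 1
  simp only [hS1]
  ext p
  simp only [mem_union, mem_range]
  constructor
  · rintro (hp | hp)
    · have hR : !₂[p 0, Y + g (p 0), 0] ∈ graphArc A B Y g := ⟨hp.1, rfl, rfl⟩
      refine ⟨⟨_, Or.inl hR⟩, ?_⟩
      simp only [h, flattening, if_pos hR]
      refine space_ext rfl ?_ hp.2.2.symm
      change Y + g (p 0) - g (p 0) = p 1
      rw [hp.2.1]; simp
    · refine ⟨⟨p, Or.inr hp⟩, ?_⟩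
      -- A point of `Q` on the arc is on the line itself, hence does not move; these are the places
      -- where the arc is joined to the rest.
      have hz : h p = 0 := by
        simp only [h, flattening]
        split_ifs with hR
        · have h1 := hQ p hp
          have h2 := hR.2.1
          have h3 := h0 _ hR.1
          linarith
        · rfl
      refine space_ext rfl ?_ rfl
      change p 1 - h p = p 1
      rw [hz, sub_zero]
  · rintro ⟨⟨q, hq⟩, rfl⟩
    by_cases hR : q ∈ graphArc A B Y g
    · left
      refine ⟨hR.1, ?_, hR.2.2⟩
      change q 1 - h q = Y + 0
      simp only [h, flattening, if_pos hR]
      rw [hR.2.1]; ring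
    · right
      have hz : h q = 0 := if_neg hR
      have : (!₂[q 0, q 1 - h q, q 2] : Space) = q := by
        refine space_ext rfl ?_ rfl
        change q 1 - h q = q 1
        rw [hz, sub_zero]
      rw [this]
      exact hq.resolve_left hR

end Flatten

/-! ### The passage to the corner connection tiles -/

/-- The similarity that carries the traditional tiles to corner connection tiles. -/
noncomputable def diag (m : ℝ) (p : Space) : Space := !₂[p 0 - p 1, p 0 + p 1 - m, p 2]

theorem diag_segment (m : ℝ) (P Q : Space) :
    segment ℝ (diag m P) (diag m Q) = diag m '' segment ℝ P Q := by
  rw [segment_eq_image_lineMap, segment_eq_image_lineMap, image_image]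
  refine image_congr fun θ _ => ?_
  refine space_ext ?_ ?_ ?_ <;> simp only [lineMap_apply_coord, diag] <;> simp <;> ring

/-- In the complex coordinate of the horizontal plane the map is, up to a translation,
multiplication by `1 + i`. The interpolating maps multiply by `1 + t * i`, of absolute value at
least 1, so they never contract. -/
theorem ambientIsotopic_diag (m : ℝ) (A : Set Space) : AmbientIsotopic A (diag m '' A) := by
  have hdist : ∀ a b : Space, dist a b ^ 2 =
      (a 0 - b 0) ^ 2 + (a 1 - b 1) ^ 2 + (a 2 - b 2) ^ 2 := fun a b => by
    rw [EuclideanSpace.dist_eq, Real.sq_sqrt (by positivity)]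
    simp [Fin.sum_univ_three, Real.dist_eq, sq_abs]
  have main := ambientIsotopic_of_gauge (X := A) (fun a b => dist (a : Space) b) Subtype.val
    (fun a => diag m a - a) 1 (fun a b => dist_nonneg) (fun a b => by
      rw [one_mul]
      refine abs_le_of_sq_le_sq' ?_ dist_nonneg |>.2
      rw [hdist, hdist]
      simp [diag]
      nlinarith [sq_nonneg ((a : Space) 2 - (b : Space) 2)])
    (fun t ht => ⟨1, one_pos, fun a b => by
      rw [one_mul]
      refine abs_le_of_sq_le_sq' ?_ dist_nonneg |>.2
      rw [hdist, hdist]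
      simp [diag]
      nlinarith [mul_nonneg (sq_nonneg t) (sq_nonneg ((a : Space) 1 - (b : Space) 1)),
        mul_nonneg (sq_nonneg t) (sq_nonneg ((a : Space) 0 - (b : Space) 0))]⟩)
  rw [Subtype.range_val] at main
  convert main using 1
  simp only [add_sub_cancel]
  exact image_eq_range _ _

/-- A strand of a traditional tile with given centre. -/
noncomputable def Strand.curveAt (c : ℝ × ℝ) (s : Strand) : Set Space :=
  segment ℝ !₂[c.1 + (s.mid sidePoint).1, c.2 + (s.mid sidePoint).2, s.height]
      !₂[c.1 + sideX s.first, c.2 + sideY s.first, 0] ∪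
    segment ℝ !₂[c.1 + (s.mid sidePoint).1, c.2 + (s.mid sidePoint).2, s.height]
      !₂[c.1 + sideX s.last, c.2 + sideY s.last, 0]

theorem Strand.curve_sidePoint {n : ℕ} (i j : Fin n) (s : Strand) :
    s.curve sidePoint i j = s.curveAt (2 * ((j : ℕ) : ℝ), -2 * ((i : ℕ) : ℝ)) := by
  rw [Strand.curve, Strand.curveAt, segment_symm ℝ (place i j (sidePoint s.first) 0), place, place,
    place, sidePoint_eq, sidePoint_eq]

theorem Strand.mid_cornerPoint (s : Strand) : s.mid cornerPoint =
    ((s.mid sidePoint).1 - (s.mid sidePoint).2, (s.mid sidePoint).1 + (s.mid sidePoint).2) := by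
  cases s with
  | arc i => simp [Strand.mid, cornerPoint_eq, sidePoint_eq]; constructor <;> ring
  | low i => simp [Strand.mid]; rfl
  | high i => simp [Strand.mid]; rfl

theorem Strand.curve_cornerPoint {n : ℕ} (r a b : Fin n) (q : Fin n × Fin n) (s : Strand) :
    s.curve cornerPoint (newPos r a b q).1 (newPos r a b q).2 = diag (2 * n) ''
      s.curveAt (2 * ((q.2 : ℕ) : ℝ) + runShift r a b q, -2 * ((q.1 : ℕ) : ℝ) - runShift r a b q) := by
  have hp : ∀ (p : ℝ × ℝ) (z : ℝ), place (newPos r a b q).1 (newPos r a b q).2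
      (p.1 - p.2, p.1 + p.2) z = diag (2 * n)
        !₂[2 * ((q.2 : ℕ) : ℝ) + runShift r a b q + p.1,
          -2 * ((q.1 : ℕ) : ℝ) - runShift r a b q + p.2, z] := fun p z => by
    have h : (q.2 : ℕ) ≤ n + q.1 := by omega
    refine space_ext ?_ ?_ ?_ <;> simp [place, newPos, diag, Nat.cast_sub h] <;> ring
  rw [Strand.curve, Strand.curveAt, segment_symm ℝ (place _ _ (cornerPoint s.first) 0),
    s.mid_cornerPoint, cornerPoint_eq, cornerPoint_eq, hp, hp (sideX s.first, sideY s.first),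
    hp (sideX s.last, sideY s.last), diag_segment, diag_segment, image_union]

theorem Strand.mem_curveAt_iff {c : ℝ × ℝ} {s : Strand} {p : Space} : p ∈ s.curveAt c ↔
    ∃ k, (k = s.first ∨ k = s.last) ∧ ∃ θ ∈ Icc (0 : ℝ) 1,
      p 0 = c.1 + (1 - θ) * (s.mid sidePoint).1 + θ * sideX k ∧
      p 1 = c.2 + (1 - θ) * (s.mid sidePoint).2 + θ * sideY k ∧ p 2 = (1 - θ) * s.height := by
  have key : ∀ k, p ∈ segment ℝ !₂[c.1 + (s.mid sidePoint).1, c.2 + (s.mid sidePoint).2, s.height]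
      !₂[c.1 + sideX k, c.2 + sideY k, 0] ↔ ∃ θ ∈ Icc (0 : ℝ) 1,
      p 0 = c.1 + (1 - θ) * (s.mid sidePoint).1 + θ * sideX k ∧
      p 1 = c.2 + (1 - θ) * (s.mid sidePoint).2 + θ * sideY k ∧ p 2 = (1 - θ) * s.height := by
    intro k
    rw [segment_eq_image_lineMap]
    refine exists_congr fun θ => and_congr_right fun _ => ?_
    have e : ∀ i, (AffineMap.lineMap
        !₂[c.1 + (s.mid sidePoint).1, c.2 + (s.mid sidePoint).2, s.height]
        !₂[c.1 + sideX k, c.2 + sideY k, 0] θ : Space) i =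
          !₂[c.1 + (1 - θ) * (s.mid sidePoint).1 + θ * sideX k,
            c.2 + (1 - θ) * (s.mid sidePoint).2 + θ * sideY k, (1 - θ) * s.height] i := fun i => by
      rw [lineMap_apply_coord]
      fin_cases i <;> simp <;> ring
    constructor
    · rintro rfl
      exact ⟨e 0, e 1, e 2⟩
    · rintro ⟨h0, h1, h2⟩
      exact space_ext ((e 0).trans h0.symm) ((e 1).trans h1.symm) ((e 2).trans h2.symm)
  rw [Strand.curveAt, mem_union, key, key]
  simp only [or_and_right, exists_or, exists_eq_left]

theorem Strand.curveAt_low_zero {c : ℝ × ℝ} {p : Space} : p ∈ (Strand.low 0).curveAt c ↔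
    p 0 ∈ Icc (c.1 - 1) (c.1 + 1) ∧ p 1 = c.2 ∧ p 2 = 0 := by
  rw [Strand.mem_curveAt_iff]
  simp only [Strand.first, Strand.last, Strand.mid, Strand.height, Prod.fst_zero, Prod.snd_zero,
    mul_zero, add_zero]
  constructor
  · rintro ⟨k, rfl | rfl, θ, ⟨h1, h2⟩, h3, h4, h5⟩
    · simp [sideX, sideY] at h3 h4
      exact ⟨⟨by linarith, by linarith⟩, h4, h5⟩
    · simp [sideX, sideY] at h3 h4
      exact ⟨⟨by linarith, by linarith⟩, h4, h5⟩
  · rintro ⟨⟨h1, h2⟩, h3, h4⟩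
    rcases le_total c.1 (p 0) with h | h
    · exact ⟨0, Or.inl rfl, p 0 - c.1, ⟨by linarith, by linarith⟩, by simp [sideX],
        by simp [sideY, h3], h4⟩
    · exact ⟨2, Or.inr rfl, c.1 - p 0, ⟨by linarith, by linarith⟩, by simp [sideX],
        by simp [sideY, h3], h4⟩

theorem Strand.mid_sidePoint (s : Strand) : s.mid sidePoint = match s with
    | .arc i => (((sideX i : ℝ) + sideX (i + 1)) / 4, ((sideY i : ℝ) + sideY (i + 1)) / 4)
    | .low _ => (0, 0)
    | .high _ => (0, 0) := by
  cases s with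
  | arc i => simp [Strand.mid, sidePoint_eq]; constructor <;> ring
  | low i => rfl
  | high i => rfl

/-- Bounds for the strands on a traditional tile: they do not leave the tile, they stay in its
lower half unless they meet the upper side, and they always stay below the mirror images of the
lower arcs in the upper side. -/
theorem Strand.curveAt_bounds {s : Strand} {c : ℝ × ℝ} {p : Space} (hp : p ∈ s.curveAt c) :
    (p 0 ∈ Icc (c.1 - 1) (c.1 + 1) ∧ p 1 ≤ c.2 + 1) ∧ (s.first ≠ 1 → s.last ≠ 1 → p 1 ≤ c.2) ∧
      p 1 + min (3 * (p 0 - c.1)) ((p 0 - c.1 + 2) / 3) ≤ c.2 + 1 ∧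
      p 1 + min (3 * (c.1 - p 0)) ((c.1 - p 0 + 2) / 3) ≤ c.2 + 1 := by
  rw [Strand.mem_curveAt_iff, Strand.mid_sidePoint] at hp
  obtain ⟨k, hk, θ, ⟨h1, h2⟩, hx, hy, -⟩ := hp
  have m1 := min_le_left (3 * (p 0 - c.1)) ((p 0 - c.1 + 2) / 3)
  have m2 := min_le_right (3 * (p 0 - c.1)) ((p 0 - c.1 + 2) / 3)
  have m3 := min_le_left (3 * (c.1 - p 0)) ((c.1 - p 0 + 2) / 3)
  have m4 := min_le_right (3 * (c.1 - p 0)) ((c.1 - p 0 + 2) / 3)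
  rcases s with i | i | i <;> fin_cases i <;> rcases hk with rfl | rfl <;>
    simp [Strand.first, Strand.last, sideX, sideY] at hx hy ⊢ <;>
    and_intros <;> linarith

/-! ### The run as a graph, and the rest of the drawing below its mirror image -/

section

/-- The height of the run above the lower sides of its tiles. -/
noncomputable def runHeight (A B x : ℝ) : ℝ :=
  min (min (3 * (x - A)) ((x - A + 2) / 3)) (min 1 (min (3 * (B - x)) ((B - x + 2) / 3)))

theorem le_runHeight_iff {A B x v : ℝ} : v ≤ runHeight A B x ↔ (v ≤ 3 * (x - A) ∧
    v ≤ (x - A + 2) / 3) ∧ v ≤ 1 ∧ v ≤ 3 * (B - x) ∧ v ≤ (B - x + 2) / 3 := by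
  simp only [runHeight, le_min_iff]

theorem runHeight_le_left (A B x : ℝ) :
    runHeight A B x ≤ min (3 * (x - A)) ((x - A + 2) / 3) := min_le_left _ _

theorem runHeight_le_right (A B x : ℝ) :
    runHeight A B x ≤ min (3 * (B - x)) ((B - x + 2) / 3) :=
  (min_le_right _ _).trans (min_le_right _ _)

theorem runHeight_le_one (A B x : ℝ) : runHeight A B x ≤ 1 :=
  (min_le_right _ _).trans (min_le_left _ _)

theorem runHeight_eq {A B x v : ℝ} (h : v ≤ runHeight A B x)
    (h' : 3 * (x - A) ≤ v ∨ (x - A + 2) / 3 ≤ v ∨ 1 ≤ v ∨ 3 * (B - x) ≤ v ∨ (B - x + 2) / 3 ≤ v) :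
    runHeight A B x = v := by
  obtain ⟨⟨h1, h2⟩, h3, h4, h5⟩ := le_runHeight_iff.1 (le_refl (runHeight A B x))
  refine le_antisymm ?_ h
  rcases h' with h' | h' | h' | h' | h' <;> linarith

theorem runHeight_lipschitz (A B x x' : ℝ) :
    runHeight A B x ≤ runHeight A B x' + 3 * |x - x'| := by
  obtain ⟨⟨h1, h2⟩, h3, h4, h5⟩ := le_runHeight_iff.1 (le_refl (runHeight A B x))
  have a1 := le_abs_self (x - x')
  have a2 := neg_le_abs (x - x')
  rw [← sub_le_iff_le_add, le_runHeight_iff]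
  refine ⟨⟨?_, ?_⟩, ?_, ?_, ?_⟩ <;> linarith

theorem runHeight_nonneg {A B x : ℝ} (hx : x ∈ Icc A B) : 0 ≤ runHeight A B x := by
  obtain ⟨h1, h2⟩ := hx
  rw [le_runHeight_iff]
  refine ⟨⟨?_, ?_⟩, ?_, ?_, ?_⟩ <;> linarith

variable {n : ℕ} {M : TileArray n} {r a b : Fin n}

/-- The strands outside the run. -/
noncomputable def restOfDrawing (M : TileArray n) (r a b : Fin n) : Set Space :=
  {p | ∃ q : Fin n × Fin n, ¬ inRun r a b q ∧ ∃ s ∈ (M q.1 q.2).strands,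
    p ∈ s.curveAt (2 * ((q.2 : ℕ) : ℝ), -2 * ((q.1 : ℕ) : ℝ))}

theorem mem_curveAt_arc_three {c : ℝ × ℝ} {p : Space} : p ∈ (Strand.arc 3).curveAt c ↔
    (p 0 ∈ Icc c.1 (c.1 + 1 / 4) ∧ p 1 = c.2 - 1 + 3 * (p 0 - c.1) ∧ p 2 = 0) ∨
      (p 0 ∈ Icc (c.1 + 1 / 4) (c.1 + 1) ∧ p 1 = c.2 - 1 + (p 0 - c.1 + 2) / 3 ∧ p 2 = 0) := by
  rw [Strand.mem_curveAt_iff, Strand.mid_sidePoint]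
  constructor
  · rintro ⟨k, rfl | rfl, θ, ⟨h1, h2⟩, hx, hy, hz⟩
    · left
      simp [Strand.first, sideX, sideY, Strand.height] at hx hy hz
      exact ⟨⟨by linarith, by linarith⟩, by linarith, hz⟩
    · right
      simp [Strand.last, sideX, sideY, Strand.height] at hx hy hz
      exact ⟨⟨by linarith, by linarith⟩, by linarith, hz⟩
  · rintro (⟨⟨h1, h2⟩, hy, hz⟩ | ⟨⟨h1, h2⟩, hy, hz⟩)
    · refine ⟨3, Or.inl rfl, 1 - 4 * (p 0 - c.1), ⟨by linarith, by linarith⟩, ?_⟩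
      simp [sideX, sideY, Strand.height]
      exact ⟨by linarith, by linarith, hz⟩
    · refine ⟨0, Or.inr rfl, (4 * (p 0 - c.1) - 1) / 3, ⟨by linarith, by linarith⟩, ?_⟩
      simp [sideX, sideY, Strand.height]
      exact ⟨by linarith, by linarith, hz⟩

theorem mem_curveAt_arc_two {c : ℝ × ℝ} {p : Space} : p ∈ (Strand.arc 2).curveAt c ↔
    (p 0 ∈ Icc (c.1 - 1 / 4) c.1 ∧ p 1 = c.2 - 1 + 3 * (c.1 - p 0) ∧ p 2 = 0) ∨
      (p 0 ∈ Icc (c.1 - 1) (c.1 - 1 / 4) ∧ p 1 = c.2 - 1 + (c.1 - p 0 + 2) / 3 ∧ p 2 = 0) := by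
  rw [Strand.mem_curveAt_iff, Strand.mid_sidePoint]
  constructor
  · rintro ⟨k, rfl | rfl, θ, ⟨h1, h2⟩, hx, hy, hz⟩
    · right
      simp [Strand.first, sideX, sideY, Strand.height] at hx hy hz
      exact ⟨⟨by linarith, by linarith⟩, by linarith, hz⟩
    · left
      simp [Strand.last, sideX, sideY, Strand.height] at hx hy hz
      exact ⟨⟨by linarith, by linarith⟩, by linarith, hz⟩
  · rintro (⟨⟨h1, h2⟩, hy, hz⟩ | ⟨⟨h1, h2⟩, hy, hz⟩)
    · refine ⟨3, Or.inr rfl, 1 - 4 * (c.1 - p 0), ⟨by linarith, by linarith⟩, ?_⟩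
      simp [sideX, sideY, Strand.height]
      exact ⟨by linarith, by linarith, hz⟩
    · refine ⟨2, Or.inl rfl, (4 * (c.1 - p 0) - 1) / 3, ⟨by linarith, by linarith⟩, ?_⟩
      simp [sideX, sideY, Strand.height]
      exact ⟨by linarith, by linarith, hz⟩

namespace IsTopRun

variable (h : IsTopRun M r a b)
include h

/-- The two halves of each end arc have slopes of absolute value 3 and 1/3, and the tiles between
contribute the constant 1; the curve is concave, so it is the minimum of these five affine
functions. -/
theorem mem_run_iff {p : Space} : (∃ c : Fin n, a ≤ c ∧ c ≤ b ∧ ∃ s ∈ (M r c).strands,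
      p ∈ s.curveAt (2 * ((c : ℕ) : ℝ), -2 * ((r : ℕ) : ℝ))) ↔
    p ∈ graphArc (2 * (a : ℕ)) (2 * (b : ℕ)) (-2 * ((r : ℕ) : ℝ) - 1)
      (runHeight (2 * (a : ℕ)) (2 * (b : ℕ))) := by
  have hab : ((a : ℕ) : ℝ) + 1 ≤ (b : ℕ) := by exact_mod_cast h.lt
  constructor
  · rintro ⟨c, hac, hcb, s, hs, hp⟩
    rcases hac.eq_or_lt with rfl | hac
    · rw [h.left] at hs
      obtain rfl := List.mem_singleton.1 hs
      rcases mem_curveAt_arc_three.1 hp with ⟨⟨h1, h2⟩, hy, hz⟩ | ⟨⟨h1, h2⟩, hy, hz⟩ <;>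
        simp only at h1 h2 hy <;> refine ⟨⟨by linarith, by linarith⟩, ?_, hz⟩
      · rw [hy, runHeight_eq (le_runHeight_iff.2 ?_) (Or.inl le_rfl)]
        refine ⟨⟨?_, ?_⟩, ?_, ?_, ?_⟩ <;> linarith
      · rw [hy, runHeight_eq (le_runHeight_iff.2 ?_) (Or.inr (Or.inl le_rfl))]
        refine ⟨⟨?_, ?_⟩, ?_, ?_, ?_⟩ <;> linarith
    rcases hcb.eq_or_lt with rfl | hcb
    · rw [h.right] at hs
      obtain rfl := List.mem_singleton.1 hs
      rcases mem_curveAt_arc_two.1 hp with ⟨⟨h1, h2⟩, hy, hz⟩ | ⟨⟨h1, h2⟩, hy, hz⟩ <;>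
        simp only at h1 h2 hy <;> refine ⟨⟨by linarith, by linarith⟩, ?_, hz⟩
      · rw [hy, runHeight_eq (le_runHeight_iff.2 ?_) (Or.inr (Or.inr (Or.inr (Or.inl le_rfl))))]
        refine ⟨⟨?_, ?_⟩, ?_, ?_, ?_⟩ <;> linarith
      · rw [hy, runHeight_eq (le_runHeight_iff.2 ?_) (Or.inr (Or.inr (Or.inr (Or.inr le_rfl))))]
        refine ⟨⟨?_, ?_⟩, ?_, ?_, ?_⟩ <;> linarith
    · rw [h.mid c hac hcb] at hs
      obtain rfl := List.mem_singleton.1 hs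
      obtain ⟨⟨h1, h2⟩, hy, hz⟩ := Strand.curveAt_low_zero.1 hp
      have hac' : ((a : ℕ) : ℝ) + 1 ≤ (c : ℕ) := by exact_mod_cast hac
      have hcb' : ((c : ℕ) : ℝ) + 1 ≤ (b : ℕ) := by exact_mod_cast hcb
      simp only at h1 h2 hy
      refine ⟨⟨by linarith, by linarith⟩, ?_, hz⟩
      rw [hy, runHeight_eq (le_runHeight_iff.2 ?_) (Or.inr (Or.inr (Or.inl le_rfl)))]
      · ring
      · refine ⟨⟨?_, ?_⟩, ?_, ?_, ?_⟩ <;> linarith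
  · rintro ⟨⟨h1, h2⟩, hy, hz⟩
    rcases le_or_gt (p 0) (2 * (a : ℕ) + 1) with h3 | h3
    · refine ⟨a, le_rfl, h.lt.le, .arc 3, by rw [h.left]; exact List.mem_singleton.2 rfl,
        mem_curveAt_arc_three.2 ?_⟩
      simp only
      rcases le_total (p 0) (2 * (a : ℕ) + 1 / 4) with h4 | h4
      · refine Or.inl ⟨⟨h1, h4⟩, ?_, hz⟩
        rw [hy, runHeight_eq (le_runHeight_iff.2 ?_) (Or.inl le_rfl)]
        refine ⟨⟨?_, ?_⟩, ?_, ?_, ?_⟩ <;> linarith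
      · refine Or.inr ⟨⟨h4, h3⟩, ?_, hz⟩
        rw [hy, runHeight_eq (le_runHeight_iff.2 ?_) (Or.inr (Or.inl le_rfl))]
        refine ⟨⟨?_, ?_⟩, ?_, ?_, ?_⟩ <;> linarith
    rcases le_or_gt (2 * ((b : ℕ) : ℝ) - 1) (p 0) with h4 | h4
    · refine ⟨b, h.lt.le, le_rfl, .arc 2, by rw [h.right]; exact List.mem_singleton.2 rfl,
        mem_curveAt_arc_two.2 ?_⟩
      simp only
      rcases le_total (2 * ((b : ℕ) : ℝ) - 1 / 4) (p 0) with h5 | h5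
      · refine Or.inl ⟨⟨h5, h2⟩, ?_, hz⟩
        rw [hy, runHeight_eq (le_runHeight_iff.2 ?_) (Or.inr (Or.inr (Or.inr (Or.inl le_rfl))))]
        refine ⟨⟨?_, ?_⟩, ?_, ?_, ?_⟩ <;> linarith
      · refine Or.inr ⟨⟨h4, h5⟩, ?_, hz⟩
        rw [hy, runHeight_eq (le_runHeight_iff.2 ?_) (Or.inr (Or.inr (Or.inr (Or.inr le_rfl))))]
        refine ⟨⟨?_, ?_⟩, ?_, ?_, ?_⟩ <;> linarith
    · have hpos : 0 ≤ (p 0 + 1) / 2 := by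
        have : (0 : ℝ) ≤ (a : ℕ) := Nat.cast_nonneg _
        linarith
      have hf1 := Nat.floor_le hpos
      have hf2 := Nat.lt_floor_add_one ((p 0 + 1) / 2)
      -- An old tile in column `c` covers the abscissae from `2c - 1` to `2c + 1`.
      set m := ⌊(p 0 + 1) / 2⌋₊
      have hmb : m < (b : ℕ) := by
        have : (m : ℝ) < (b : ℕ) := by linarith
        exact_mod_cast this
      have hma : (a : ℕ) < m := by
        have : ((a : ℕ) : ℝ) < (m + 1 : ℕ) := by push_cast; linarith
        have h5 : (a : ℕ) < m + 1 := by exact_mod_cast this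
        have : ((a : ℕ) : ℝ) + 1 < (m + 1 : ℕ) := by push_cast; linarith
        have h6 : (a : ℕ) + 1 < m + 1 := by exact_mod_cast this
        omega
      have hma' : ((a : ℕ) : ℝ) + 1 ≤ m := by exact_mod_cast hma
      have hmb' : (m : ℝ) + 1 ≤ (b : ℕ) := by exact_mod_cast hmb
      refine ⟨⟨m, by omega⟩, hma.le, hmb.le, .low 0, ?_, Strand.curveAt_low_zero.2 ?_⟩
      · rw [h.mid ⟨m, by omega⟩ hma hmb]; exact List.mem_singleton.2 rfl
      · simp only
        refine ⟨⟨by linarith, by linarith⟩, ?_, hz⟩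
        rw [hy, runHeight_eq (le_runHeight_iff.2 ?_) (Or.inr (Or.inr (Or.inl le_rfl)))]
        · ring
        · refine ⟨⟨?_, ?_⟩, ?_, ?_, ?_⟩ <;> linarith

theorem mem_newRun_iff {p : Space} : (∃ c : Fin n, a ≤ c ∧ c < b ∧
      p ∈ (Strand.low 0).curveAt (2 * ((c : ℕ) : ℝ) + 1, -2 * ((r : ℕ) : ℝ) - 1)) ↔
    p ∈ graphArc (2 * (a : ℕ)) (2 * (b : ℕ)) (-2 * ((r : ℕ) : ℝ) - 1) 0 := by
  have hab : ((a : ℕ) : ℝ) + 1 ≤ (b : ℕ) := by exact_mod_cast h.lt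
  constructor
  · rintro ⟨c, hac, hcb, hp⟩
    obtain ⟨⟨h1, h2⟩, hy, hz⟩ := Strand.curveAt_low_zero.1 hp
    have hac' : ((a : ℕ) : ℝ) ≤ (c : ℕ) := by exact_mod_cast hac
    have hcb' : ((c : ℕ) : ℝ) + 1 ≤ (b : ℕ) := by exact_mod_cast hcb
    simp only at h1 h2 hy
    exact ⟨⟨by linarith, by linarith⟩, by rw [hy]; simp, hz⟩
  · rintro ⟨⟨h1, h2⟩, hy, hz⟩
    simp only [Pi.zero_apply, add_zero] at hy
    -- A new tile covers `2c` to `2c + 2`. The last one is treated separately because rounding down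
    -- would send the right end point to column `b`.
    rcases le_or_gt (2 * ((b : ℕ) : ℝ) - 2) (p 0) with h4 | h4
    · have hb0 : 1 ≤ (b : ℕ) := by have := h.lt; omega
      refine ⟨⟨b - 1, by omega⟩, ?_, ?_, Strand.curveAt_low_zero.2 ⟨⟨?_, ?_⟩, hy, hz⟩⟩
      · have := h.lt; change a.val ≤ b - 1; omega
      · change b.val - 1 < b; omega
      · simp only; push_cast [hb0]; linarith
      · simp only; push_cast [hb0]; linarith
    · have hpos : 0 ≤ p 0 / 2 := by
        have : (0 : ℝ) ≤ (a : ℕ) := Nat.cast_nonneg _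
        linarith
      have hf1 := Nat.floor_le hpos
      have hf2 := Nat.lt_floor_add_one (p 0 / 2)
      set m := ⌊p 0 / 2⌋₊
      have hmb : m < (b : ℕ) := by
        have : (m : ℝ) < (b : ℕ) := by linarith
        exact_mod_cast this
      have hma : (a : ℕ) ≤ m := by
        have : ((a : ℕ) : ℝ) < (m + 1 : ℕ) := by push_cast; linarith
        have h5 : (a : ℕ) < m + 1 := by exact_mod_cast this
        omega
      exact ⟨⟨m, by omega⟩, hma, hmb, Strand.curveAt_low_zero.2
        ⟨⟨by simp only; linarith, by simp only; linarith⟩, hy, hz⟩⟩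

/-- Outside the columns of the run `runHeight` is so negative that even tiles to the right of the
run in its own row comply. Directly below an end of the run, `Strand.curveAt_bounds` compares with
the mirrored arc. Below the middle, tiles have no upper connection and stay in their lower half,
which is far enough as the run has height at most 1. Lower rows are far enough in any case. -/
theorem restOfDrawing_below (hM : SuitablyConnected sidePoint M) {p : Space}
    (hp : p ∈ restOfDrawing M r a b) :
    p 1 ≤ -2 * ((r : ℕ) : ℝ) - 1 - runHeight (2 * (a : ℕ)) (2 * (b : ℕ)) (p 0) := by
  obtain ⟨⟨i, j⟩, hq, s, hs, hp⟩ := hp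
  simp only at hs hp
  obtain ⟨⟨⟨h1, h2⟩, h3⟩, h4, h5, h6⟩ := Strand.curveAt_bounds hp
  simp only at h1 h2 h3 h4 h5 h6
  obtain ⟨⟨g1, -⟩, -, g4, -⟩ :=
    le_runHeight_iff.1 (le_refl (runHeight (2 * (a : ℕ)) (2 * (b : ℕ)) (p 0)))
  have g0 := runHeight_le_one (2 * (a : ℕ)) (2 * (b : ℕ)) (p 0)
  have gl := runHeight_le_left (2 * (a : ℕ)) (2 * (b : ℕ)) (p 0)
  have gr := runHeight_le_right (2 * (a : ℕ)) (2 * (b : ℕ)) (p 0)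
  have hne : M i j ≠ .T0 := fun h0 => by rw [h0] at hs; exact List.not_mem_nil hs
  have hir : r ≤ i := not_lt.1 fun hi => hne (h.blank_above i j hi)
  rcases hir.eq_or_lt with rfl | hir
  · have haj : a ≤ j := not_lt.1 fun hj => hne (h.blank_left j hj)
    have hbj : b < j := not_le.1 fun hj => hq ⟨rfl, haj, hj⟩
    have hbj' : ((b : ℕ) : ℝ) + 1 ≤ (j : ℕ) := by exact_mod_cast hbj
    linarith
  have hir' : ((r : ℕ) : ℝ) + 1 ≤ (i : ℕ) := by exact_mod_cast hir
  rcases lt_or_ge j a with hj | haj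
  · have : ((j : ℕ) : ℝ) + 1 ≤ (a : ℕ) := by exact_mod_cast hj
    linarith
  rcases lt_or_ge b j with hj | hjb
  · have : ((b : ℕ) : ℝ) + 1 ≤ (j : ℕ) := by exact_mod_cast hj
    linarith
  rcases haj.eq_or_lt with rfl | haj
  · linarith
  rcases hjb.eq_or_lt with rfl | hjb
  · linarith
  rcases eq_or_ne (i : ℕ) (r + 1) with hi | hi
  · have hc1 : (M i j).conn 1 = false := by
      by_contra hne
      obtain ⟨i', j', hj', hi', hk'⟩ := hM.exists_neighbour (Bool.not_eq_false _ ▸ hne)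
      simp [sideX, sideY] at hi' hj'
      obtain rfl : j' = j := Fin.ext (by omega)
      obtain rfl : i' = r := Fin.ext (by omega)
      rw [h.mid j' haj hjb] at hk'
      exact absurd hk' (by decide)
    have hnc : ∀ k, k = s.first ∨ k = s.last → k ≠ 1 := by
      rintro k hk rfl
      have := (Tile.isConnection_iff (M i j) 1).1 ⟨s, hs, hk⟩
      rw [hc1] at this
      exact absurd this (by decide)
    have := h4 (hnc _ (Or.inl rfl)) (hnc _ (Or.inr rfl))
    linarith
  · have : ((r : ℕ) : ℝ) + 2 ≤ (i : ℕ) := by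
      have : (r : ℕ) + 2 ≤ i := by omega
      exact_mod_cast this
    linarith

theorem drawing_eq : drawing sidePoint M =
    graphArc (2 * (a : ℕ)) (2 * (b : ℕ)) (-2 * ((r : ℕ) : ℝ) - 1)
      (runHeight (2 * (a : ℕ)) (2 * (b : ℕ))) ∪ restOfDrawing M r a b := by
  ext p
  rw [mem_union, ← h.mem_run_iff]
  simp only [drawing, mem_iUnion, exists_prop, Strand.curve_sidePoint]
  constructor
  · rintro ⟨i, j, s, hs, hp⟩
    by_cases hq : inRun r a b (i, j)
    · obtain ⟨rfl, h1, h2⟩ := hq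
      exact Or.inl ⟨j, h1, h2, s, hs, hp⟩
    · exact Or.inr ⟨(i, j), hq, s, hs, hp⟩
  · rintro (⟨c, -, -, s, hs, hp⟩ | ⟨q, -, s, hs, hp⟩)
    · exact ⟨r, c, s, hs, hp⟩
    · exact ⟨q.1, q.2, s, hs, hp⟩

theorem drawing_cornerMosaic : drawing cornerPoint (cornerMosaic M r a b) = diag (2 * n) ''
    (graphArc (2 * (a : ℕ)) (2 * (b : ℕ)) (-2 * ((r : ℕ) : ℝ) - 1) 0 ∪ restOfDrawing M r a b) := by
  have h1 : drawing cornerPoint (cornerMosaic M r a b) = diag (2 * n) ''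
      {p | ∃ q, ∃ s ∈ (newTile M r a b q).strands, p ∈ s.curveAt
        (2 * ((q.2 : ℕ) : ℝ) + runShift r a b q, -2 * ((q.1 : ℕ) : ℝ) - runShift r a b q)} := by
    ext p
    simp only [drawing, mem_iUnion, exists_prop]
    constructor
    · rintro ⟨I, J, s, hs, hp⟩
      obtain ⟨q, hq⟩ := exists_newPos_of_ne (M := M) (r := r) (a := a) (b := b) (I := I) (J := J)
        fun h0 => by rw [h0] at hs; exact List.not_mem_nil hs
      obtain ⟨rfl, rfl⟩ := Prod.ext_iff.1 hq
      rw [cornerMosaic_newPos] at hs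
      rw [Strand.curve_cornerPoint] at hp
      obtain ⟨p', hp', rfl⟩ := hp
      exact ⟨p', ⟨q, s, hs, hp'⟩, rfl⟩
    · rintro ⟨p', ⟨q, s, hs, hp'⟩, rfl⟩
      refine ⟨(newPos r a b q).1, (newPos r a b q).2, s, ?_, ?_⟩
      · rwa [cornerMosaic_newPos]
      · rw [Strand.curve_cornerPoint]; exact ⟨p', hp', rfl⟩
  rw [h1]
  congr 1
  ext p
  rw [mem_union, ← h.mem_newRun_iff]
  constructor
  · rintro ⟨q, s, hs, hp⟩
    by_cases hq : inRun r a b q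
    · left
      simp only [newTile, if_pos hq, runShift, Nat.cast_one] at hs hp
      split_ifs at hs with hqb
      · exact absurd hs List.not_mem_nil
      · obtain rfl := List.mem_singleton.1 hs
        obtain ⟨h2, h3, h4⟩ := hq
        rw [h2] at hp
        exact ⟨q.2, h3, lt_of_le_of_ne h4 hqb, hp⟩
    · right
      simp only [newTile, if_neg hq, runShift, Nat.cast_zero, add_zero, sub_zero] at hs hp
      exact ⟨q, hq, s, hs, hp⟩
  · rintro (⟨c, hac, hcb, hp⟩ | ⟨q, hq, s, hs, hp⟩)
    · have hq : inRun r a b (r, c) := ⟨rfl, hac, hcb.le⟩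
      refine ⟨(r, c), .low 0, ?_, ?_⟩
      · simp only [newTile, if_pos hq, if_neg hcb.ne]
        exact List.mem_singleton.2 rfl
      · simpa only [runShift, if_pos hq, Nat.cast_one] using hp
    · refine ⟨q, s, ?_, ?_⟩
      · simpa only [newTile, if_neg hq] using hs
      · simpa only [runShift, if_neg hq, Nat.cast_zero, add_zero, sub_zero] using hp

theorem ambientIsotopic_drawing (hM : SuitablyConnected sidePoint M) :
    AmbientIsotopic (drawing sidePoint M) (drawing cornerPoint (cornerMosaic M r a b)) := by
  rw [h.drawing_eq, h.drawing_cornerMosaic]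
  exact (ambientIsotopic_flatten (runHeight_lipschitz _ _) (fun x hx => runHeight_nonneg hx)
    fun p hp => h.restOfDrawing_below hM hp).trans (ambientIsotopic_diag _ _)

end IsTopRun

/-- A mosaic of traditional tiles that is not blank can be replaced by one with fewer corner
connection tiles. -/
theorem SuitablyConnected.exists_cornerMosaic (hM : SuitablyConnected sidePoint M)
    (hne : (drawing sidePoint M).Nonempty) :
    ∃ (m : ℕ) (M' : TileArray m), SuitablyConnected cornerPoint M' ∧
      AmbientIsotopic (drawing sidePoint M) (drawing cornerPoint M') ∧
        tileCount M' < tileCount M := by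
  obtain ⟨p, hp⟩ := hne
  simp only [drawing, mem_iUnion] at hp
  obtain ⟨i, j, s, hs, -⟩ := hp
  obtain ⟨r, a, b, h⟩ := hM.exists_topRun ⟨i, j, fun h0 => by
    rw [h0] at hs; exact List.not_mem_nil hs⟩
  exact ⟨_, _, h.suitablyConnected hM, h.ambientIsotopic_drawing hM, h.tileCount_lt⟩

theorem AmbientIsotopic.nonempty {A B : Set Space} (h : AmbientIsotopic A B) (hB : B.Nonempty) :
    A.Nonempty := by
  obtain ⟨H, -, -, rfl⟩ := h
  exact hB.of_image

end

end KnotMosaic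

/-- For every split link `K` the tile numbers `t_c(K)` and `t(K)` are finite (every tame link is
represented by mosaics of both kinds), and `t_c(K) < t(K)`. -/
theorem theorem4p2 (K : Set KnotMosaic.Space) (hK : KnotMosaic.IsTameLink K)
    (hsplit : KnotMosaic.IsSplit K) :
    KnotMosaic.cornerTileNumber K < KnotMosaic.tileNumber K ∧ KnotMosaic.tileNumber K < ⊤ := by
  have hne : K.Nonempty := by
    obtain ⟨K', hKK', -, -, -, -, ⟨p, hp, -⟩, -⟩ := hsplit
    exact hKK'.nonempty ⟨p, hp⟩
  obtain ⟨n₀, M₀, hM₀, hiso₀⟩ := hK.exists_mosaic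
  have hmem : KnotMosaic.tileNumber K ∈ {t : ℕ∞ | ∃ (n : ℕ) (M : KnotMosaic.TileArray n),
      KnotMosaic.SuitablyConnected KnotMosaic.sidePoint M ∧
        KnotMosaic.AmbientIsotopic (KnotMosaic.drawing KnotMosaic.sidePoint M) K ∧
          t = (KnotMosaic.tileCount M : ℕ∞)} :=
    -- A nonempty set of extended natural numbers contains its infimum, so a minimal mosaic exists.
    csInf_mem ⟨_, n₀, M₀, hM₀, hiso₀, rfl⟩
  obtain ⟨n, M, hM, hiso, ht⟩ := hmem
  obtain ⟨m, M', hM', hiso', hlt⟩ := hM.exists_cornerMosaic (hiso.nonempty hne)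
  rw [ht]
  refine ⟨lt_of_le_of_lt (sInf_le ⟨m, M', hM', hiso'.symm.trans hiso, rfl⟩) ?_, ?_⟩
  · exact_mod_cast hlt
  · exact ENat.natCast_lt_top _
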